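/- Conventions. For a smooth oriented Riemannian 3-manifold $(M,g)$ let $\nabla$ be the Levi-Civita connection, $\mathrm{vol}$ the Riemannian volume form, $R(u,v)w=\nabla_u\nabla_v w-\nabla_v\nabla_u w-\nabla_{[u,v]}w$, and $\mathrm{Ric}(v,w)=\mathrm{tr}\,(u\mapsto R(u,v)w)$. For a vector field $\xi$, identified with a 1-form through $g$, the 2-form $*\xi$ is $(*\xi)(v,w)=\mathrm{vol}(\xi,v,w)$; it is regarded as the skew-symmetric endomorphism with $g((*\xi)(v),w)=(*\xi)(v,w)$. For a real constant $f$ and a smooth vector field $\xi$ consider the conditions $$(\star)\qquad |\xi|_g=1,\qquad \nabla_v\xi=-\tfrac{f}{2}\,(*\xi)(v)\ \text{ for all } v,\qquad \mathrm{Ric}=\tfrac{f^2}{2}\,(-g+2\,\xi\otimes\xi).$$ Let $\mathrm{H}_3$ be the Heisenberg group, i.e. $\mathbb{R}^3$ with the product $(x,y,z)(x',y',z')=(x+x',\,y+y',\,z+z'+xy')$. Proposition. (a) Let $(M,g)$ be a complete, simply connected, smooth Riemannian manifold of dimension three, equipped with any orientation. If there exist a constant $f>0$ and a smooth vector field $\xi$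 on $M$ satisfying $(\star)$, then there exist a left-invariant Riemannian metric $g_0$ on $\mathrm{H}_3$ and a diffeomorphism $\Phi:M\to \mathrm{H}_3$ with $\Phi^*g_0=g$; that is, $(M,g)$ is isometric to $\mathrm{H}_3$ endowed with a left-invariant metric. (b) Conversely, $\mathrm{H}_3$ carries an orientation such that, for every left-invariant Riemannian metric $g_0$ on $\mathrm{H}_3$, there exist a constant $f>0$ and a smooth vector field $\xi$ on $\mathrm{H}_3$ satisfying $(\star)$ with respect to $g_0$ and this orientation. -/

import Mathlib

open Bundle Manifold Module
open scoped ContDiff Topology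

noncomputable section

section Geometry

variable {M : Type*} [TopologicalSpace M] [ChartedSpace (EuclideanSpace ℝ (Fin 3)) M] [IsManifold (𝓡 3) ∞ M]

instance factFinrankTangent (x : M) : Fact (finrank ℝ (TangentSpace (𝓡 3) x) = 3) :=
  ⟨finrank_euclideanSpace_fin⟩

instance finiteDimensionalTangent (x : M) : FiniteDimensional ℝ (TangentSpace (𝓡 3) x) :=
  inferInstanceAs (FiniteDimensional ℝ (EuclideanSpace ℝ (Fin 3)))

/-- The triple `v` of tangent vectors at `x` is a basis belonging to the orientation `o` of the
tangent space. -/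
def IsPositiveTriple {x : M} (o : Orientation ℝ (TangentSpace (𝓡 3) x) (Fin 3))
    (v : Fin 3 → TangentSpace (𝓡 3) x) : Prop :=
  ∃ b : Basis (Fin 3) ℝ (TangentSpace (𝓡 3) x), (⇑b = v) ∧ b.orientation = o

variable (M) in
/-- An orientation of a smooth 3-manifold: an orientation of each tangent space, varying
continuously, in the sense that a smooth local frame which is positive at a point is positive
in a neighbourhood of that point. -/
structure ManifoldOrientation where
  orient : ∀ x : M, Orientation ℝ (TangentSpace (𝓡 3) x) (Fin 3)
  eventually_positive : ∀ (x : M) (X : Fin 3 → Π y : M, TangentSpace (𝓡 3) y),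
    (∀ i, ContMDiffAt (𝓡 3) (𝓡 3).tangent ∞ (fun y ↦ (⟨y, X i y⟩ : TangentBundle (𝓡 3) M)) x) →
    IsPositiveTriple (orient x) (fun i ↦ X i x) →
    ∀ᶠ y in 𝓝 x, IsPositiveTriple (orient y) (fun i ↦ X i y)

/-- The curvature `R(u, v) w = ∇_U ∇_V W - ∇_V ∇_U W - ∇_[U, V] W` at `x`, where `U`, `V`, `W`
are vector fields extending `u`, `v`, `w`, smooth near `x`. -/
def curvatureAt (cov : CovariantDerivative (𝓡 3) (EuclideanSpace ℝ (Fin 3)) (TangentSpace (𝓡 3) : M → Type _)) (x : M)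
    (u v w : TangentSpace (𝓡 3) x) : TangentSpace (𝓡 3) x :=
  let U : Π y : M, TangentSpace (𝓡 3) y := FiberBundle.extend (EuclideanSpace ℝ (Fin 3)) u
  let V : Π y : M, TangentSpace (𝓡 3) y := FiberBundle.extend (EuclideanSpace ℝ (Fin 3)) v
  let W : Π y : M, TangentSpace (𝓡 3) y := FiberBundle.extend (EuclideanSpace ℝ (Fin 3)) w
  cov (fun y ↦ cov W y (V y)) x u - cov (fun y ↦ cov W y (U y)) x v
    - cov W x (VectorField.mlieBracket (𝓡 3) U V x)

variable [RiemannianBundle (fun x : M ↦ TangentSpace (𝓡 3) x)]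

/-- The Ricci tensor `Ric(v, w) = tr (u ↦ R(u, v) w)`, the trace being computed in an orthonormal
basis of the tangent space. -/
def ricciAt (cov : CovariantDerivative (𝓡 3) (EuclideanSpace ℝ (Fin 3)) (TangentSpace (𝓡 3) : M → Type _)) (x : M)
    (v w : TangentSpace (𝓡 3) x) : ℝ :=
  ∑ i, inner ℝ (curvatureAt cov x (stdOrthonormalBasis ℝ (TangentSpace (𝓡 3) x) i) v w)
    (stdOrthonormalBasis ℝ (TangentSpace (𝓡 3) x) i)

/-- The Hodge dual `∗u` of (the one-form dual to) a tangent vector `u` of an oriented Riemannian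
3-manifold: the two-form `(v, w) ↦ vol(u, v, w)`, `vol` being the Riemannian volume form. -/
def hodgeStarAt (o : ManifoldOrientation M) (x : M) (u v w : TangentSpace (𝓡 3) x) : ℝ :=
  (o.orient x).volumeForm ![u, v, w]

variable [IsContMDiffRiemannianBundle (𝓡 3) ∞ (EuclideanSpace ℝ (Fin 3)) (fun x : M ↦ TangentSpace (𝓡 3) x)]

/-- `∇` is the Levi-Civita connection: it is compatible with the metric and torsion-free. -/
def IsLeviCivita
    (cov : CovariantDerivative (𝓡 3) (EuclideanSpace ℝ (Fin 3)) (TangentSpace (𝓡 3) : M → Type _)) : Prop :=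
  haveI : IsContMDiffRiemannianBundle (𝓡 3) 1 (EuclideanSpace ℝ (Fin 3)) (fun x : M ↦ TangentSpace (𝓡 3) x) :=
    IsContMDiffRiemannianBundle.of_le (n := ∞) (by simp)
  cov.IsMetricCompatible ∧ cov.torsion = 0

/-- On an oriented Riemannian 3-manifold with Levi-Civita connection `∇`: `ξ` is a smooth unit
vector field with `∇ξ = -(f / 2) ∗ξ` and `Ric = (f² / 2) (-g + 2 ξ ⊗ ξ)`, where the two-form `∗ξ`
is regarded as an endomorphism through the metric, `g((∗ξ)(v), w) = (∗ξ)(v, w)`. -/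
structure IsHeisenbergField (o : ManifoldOrientation M) (f : ℝ)
    (ξ : Π x : M, TangentSpace (𝓡 3) x) : Prop where
  smooth : ContMDiff (𝓡 3) (𝓡 3).tangent ∞ (fun x ↦ (⟨x, ξ x⟩ : TangentBundle (𝓡 3) M))
  unit : ∀ x, ‖ξ x‖ = 1
  equations : ∃ cov : CovariantDerivative (𝓡 3) (EuclideanSpace ℝ (Fin 3)) (TangentSpace (𝓡 3) : M → Type _),
    IsLeviCivita cov ∧
    (∀ (x : M) (v w : TangentSpace (𝓡 3) x),
      inner ℝ (cov ξ x v) w = -(f / 2) * hodgeStarAt o x (ξ x) v w) ∧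
    (∀ (x : M) (v w : TangentSpace (𝓡 3) x),
      ricciAt cov x v w =
        f ^ 2 / 2 * (-inner ℝ v w + 2 * (inner ℝ (ξ x) v * inner ℝ (ξ x) w)))

end Geometry

section HeisenbergGroup

/-- The three-dimensional Heisenberg group, as a manifold: ℝ³ with its standard structure. The
point `(x, y, z)` stands for the upper unitriangular matrix with rows `(1, x, z)`, `(0, 1, y)`,
`(0, 0, 1)`. -/
def Heisenberg : Type := EuclideanSpace ℝ (Fin 3)

namespace Heisenberg

instance : TopologicalSpace Heisenberg := inferInstanceAs (TopologicalSpace (EuclideanSpace ℝ (Fin 3)))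

instance : ChartedSpace (EuclideanSpace ℝ (Fin 3)) Heisenberg := inferInstanceAs (ChartedSpace (EuclideanSpace ℝ (Fin 3)) (EuclideanSpace ℝ (Fin 3)))

instance : IsManifold (𝓡 3) ∞ Heisenberg := inferInstanceAs (IsManifold (𝓡 3) ∞ (EuclideanSpace ℝ (Fin 3)))

/-- The element with coordinates `(x, y, z)`. -/
def mk (x y z : ℝ) : Heisenberg := (!₂[x, y, z] : EuclideanSpace ℝ (Fin 3))

/-- The coordinates of an element. -/
def coord (p : Heisenberg) (i : Fin 3) : ℝ := (show (EuclideanSpace ℝ (Fin 3)) from p) i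

@[simp] lemma coord_mk_zero (x y z : ℝ) : (mk x y z).coord 0 = x := rfl
@[simp] lemma coord_mk_one (x y z : ℝ) : (mk x y z).coord 1 = y := rfl
@[simp] lemma coord_mk_two (x y z : ℝ) : (mk x y z).coord 2 = z := rfl

lemma ext {p q : Heisenberg} (h0 : p.coord 0 = q.coord 0) (h1 : p.coord 1 = q.coord 1)
    (h2 : p.coord 2 = q.coord 2) : p = q := by
  apply PiLp.ext (x := (show (EuclideanSpace ℝ (Fin 3)) from p)) (y := (show (EuclideanSpace ℝ (Fin 3)) from q))
  intro i
  fin_cases i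
  exacts [h0, h1, h2]

instance : Mul Heisenberg :=
  ⟨fun p q ↦ mk (p.coord 0 + q.coord 0) (p.coord 1 + q.coord 1)
    (p.coord 2 + q.coord 2 + p.coord 0 * q.coord 1)⟩

instance : One Heisenberg := ⟨mk 0 0 0⟩

instance : Inv Heisenberg :=
  ⟨fun p ↦ mk (-p.coord 0) (-p.coord 1) (-p.coord 2 + p.coord 0 * p.coord 1)⟩

lemma mul_def (p q : Heisenberg) : p * q =
    mk (p.coord 0 + q.coord 0) (p.coord 1 + q.coord 1)
      (p.coord 2 + q.coord 2 + p.coord 0 * q.coord 1) := rfl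

lemma one_def : (1 : Heisenberg) = mk 0 0 0 := rfl

lemma inv_def (p : Heisenberg) :
    p⁻¹ = mk (-p.coord 0) (-p.coord 1) (-p.coord 2 + p.coord 0 * p.coord 1) := rfl

instance : Group Heisenberg :=
  Group.ofLeftAxioms
    (fun p q r ↦ by apply ext <;> simp [mul_def] <;> ring)
    (fun p ↦ by apply ext <;> simp [mul_def, one_def])
    (fun p ↦ by apply ext <;> simp [mul_def, one_def, inv_def])

lemma contDiff_mk {V : Type*} [NormedAddCommGroup V] [NormedSpace ℝ V] {a b c : V → ℝ}
    (ha : ContDiff ℝ ∞ a) (hb : ContDiff ℝ ∞ b) (hc : ContDiff ℝ ∞ c) :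
    ContDiff ℝ ∞ (fun t ↦ (!₂[a t, b t, c t] : EuclideanSpace ℝ (Fin 3))) := by
  rw [contDiff_euclidean]
  intro i
  fin_cases i
  exacts [ha, hb, hc]

lemma contDiff_apply (i : Fin 3) : ContDiff ℝ ∞ (fun p : EuclideanSpace ℝ (Fin 3) ↦ p i) :=
  (EuclideanSpace.proj (𝕜 := ℝ) i).contDiff

/-- The Heisenberg group is a Lie group. -/
instance : LieGroup (𝓡 3) ∞ Heisenberg where
  contMDiff_mul := by
    have h1 (i : Fin 3) : ContDiff ℝ ∞ (fun p : EuclideanSpace ℝ (Fin 3) × EuclideanSpace ℝ (Fin 3) ↦ p.1 i) :=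
      (contDiff_apply i).comp contDiff_fst
    have h2 (i : Fin 3) : ContDiff ℝ ∞ (fun p : EuclideanSpace ℝ (Fin 3) × EuclideanSpace ℝ (Fin 3) ↦ p.2 i) :=
      (contDiff_apply i).comp contDiff_snd
    have h := (contDiff_mk ((h1 0).add (h2 0)) ((h1 1).add (h2 1))
      (((h1 2).add (h2 2)).add ((h1 0).mul (h2 1)))).contMDiff
    rw [modelWithCornersSelf_prod, ← chartedSpaceSelf_prod] at h
    exact h
  contMDiff_inv :=
    (contDiff_mk (contDiff_apply 0).neg (contDiff_apply 1).neg
      ((contDiff_apply 2).neg.add ((contDiff_apply 0).mul (contDiff_apply 1)))).contMDiff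

end Heisenberg

/-- A left-invariant Riemannian metric on the Heisenberg group: all left translations preserve
it. -/
def IsLeftInvariant (g : ContMDiffRiemannianMetric (𝓡 3) ∞ (EuclideanSpace ℝ (Fin 3))
    (fun p : Heisenberg ↦ TangentSpace (𝓡 3) p)) : Prop :=
  ∀ (a p : Heisenberg) (v w : TangentSpace (𝓡 3) p),
    g.inner (a * p) (mfderiv (𝓡 3) (𝓡 3) (fun q : Heisenberg ↦ a * q) p v)
      (mfderiv (𝓡 3) (𝓡 3) (fun q : Heisenberg ↦ a * q) p w) = g.inner p v w

end HeisenbergGroup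

end

/-! For (a), put `J v = -(2 / f) ∇_v ξ`. The equation for `∇ξ` makes `J` a quarter turn of the
planes orthogonal to `ξ`; the orientation matters only through the fact that the volume form is `±1`
on orthonormal triples, so it is dropped at once (`IsContactField`). In dimension three the Ricci
tensor determines the curvature, and the Ricci condition gives `⟪R(u, v) a, J a⟫ = (3/4) f² (a ∧ J
a)(u, v)` for unit `a ⊥ ξ` (`IsContactField.inner_curvatureAt`). For a local unit field `a ⊥ ξ`, the
connection form `⟪∇ a, J a⟫` then has exterior derivative `(f²/2) a ∧ J a`, while `dξ = -f a ∧ J a`.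
Hence `⟪∇ a, J a⟫ + (f/2) ξ` is closed, and rotating `a` by a local primitive of its opposite yields
a unit field `u` with `⟪∇_v u, J u⟫ = -(f/2) ⟪ξ, v⟫` (`exists_angle`, `exists_turning_near`). Two
such fields keep a constant angle, so their germs behave like sections of a covering, and simple
connectedness produces a global one (`exists_global_section`, `exists_turning`).

For a global `u`, with `e' = J u`, the covariant derivatives of `u` and `e'` are symmetric, so the
dual forms are closed: `u = dX`, `e' = dY`. Since `dξ = -f u ∧ e'`, the form `ξ / f + X e'` is
closed as well, and equals `dZ` (`exists_coordinates`). Thus `g = dX² + dY² + f² (dZ - X dY)²`: the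
map `Φ = (X, Y, Z)` pulls the left-invariant metric `heisenbergMetric f` back to `g`. It is a local
diffeomorphism. Along a straight segment of `ℝ³` the coordinate `x` is bounded, so lifts of the
segment have bounded speed, and completeness lets them be continued to the end
(`exists_lift_segment`). A local homeomorphism along which all segments from one point lift is
bijective (`IsLocalHomeomorph.bijective_of_lift_segments`), so `Φ` is an isometric diffeomorphism.

For (b), Gram–Schmidt at the identity in the order `∂z`, `∂x`, `∂y` gives a left-invariant
orthonormal frame with `e 0` central and `[e 1, e 2] = f e 0`. All diagonal coefficients are
positive, so `f > 0` and the frame is positive for the standard orientation, whatever the metric.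
The Levi-Civita connection is written down in this frame, and curvature becomes algebra with
constant coefficients (`IsHeisenbergFrame.curvatureAt_frameComb`); `ξ = e 0` satisfies the
equations. -/

noncomputable section

/-! ### Topology: global sections over simply connected spaces, bijectivity from lifting of
segments. -/

section Topology

/-- The étalé topology on the total space of a family of sets, with respect to a class `P` of germs
of sections. -/
@[reducible] def etaleTopology {X : Type*} [TopologicalSpace X] {F : X → Type*}
    (P : (Π x, F x) → X → Prop) : TopologicalSpace (Σ x, F x) where
  IsOpen A := ∀ e ∈ A, ∀ s : Π x, F x, P s e.1 → s e.1 = e.2 →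
    ∀ᶠ y in 𝓝 e.1, (⟨y, s y⟩ : Σ x, F x) ∈ A
  isOpen_univ := fun _ _ _ _ _ ↦ by simp
  isOpen_inter := fun _ _ hA hB e he s hs hse ↦ (hA e he.1 s hs hse).and (hB e he.2 s hs hse)
  isOpen_sUnion := fun _ hS e ⟨A, hA, he⟩ s hs hse ↦
    (hS A hA e he s hs hse).mono fun _ hy ↦ ⟨A, hA, hy⟩

/-- Over a simply connected space, a germ of section of a class with unique continuation along a
uniform cover extends to a global section. -/
theorem exists_global_section {X : Type*} [TopologicalSpace X] [SimplyConnectedSpace X]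
    [LocallyPathConnectedSpace X] {F : X → Type*} (P : (Π x, F x) → X → Prop)
    (congr : ∀ s s' x, P s x → (∀ᶠ y in 𝓝 x, s y = s' y) → P s' x)
    (unique : ∀ s s' x, P s x → P s' x → ∀ᶠ y in 𝓝 x, (s y = s' y ↔ s x = s' x))
    (ex : ∀ x, ∃ U ∈ 𝓝 x, ∀ y ∈ U, ∀ c : F y, ∃ s : Π x, F x, s y = c ∧ ∀ z ∈ U, P s z)
    (x₀ : X) (c₀ : F x₀) : ∃ s : Π x, F x, s x₀ = c₀ ∧ ∀ x, P s x := by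
  let _ : TopologicalSpace (Σ x, F x) := etaleTopology P
  let p : (Σ x, F x) → X := Sigma.fst
  have hp : Continuous p := continuous_def.2 fun V hV e he s _ _ ↦ hV.mem_nhds he
  -- Graphs of admissible sections are open, because two germs through the same point agree nearby.
  have sheet (s : Π x, F x) (V : Set X) (hV : IsOpen V) (hs : ∀ x ∈ V, P s x) :
      IsOpen {e : Σ x, F x | e.1 ∈ V ∧ e.2 = s e.1} := by
    rintro ⟨x, c⟩ ⟨hx, hc⟩ s' hs' hs'x
    dsimp only at hx hc hs' hs'x ⊢
    filter_upwards [hV.mem_nhds hx, unique s' s x hs' (hs x hx)] with y hy h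
    exact ⟨hy, h.2 (hs'x.trans hc)⟩
  have sec (s : Π x, F x) (x : X) (hs : P s x) :
      ContinuousAt (fun y ↦ (⟨y, s y⟩ : Σ x, F x)) x := by
    intro A hA
    obtain ⟨B, hBA, hB, hxB⟩ := mem_nhds_iff.1 hA
    exact (hB ⟨x, s x⟩ hxB s hs rfl).mono fun y hy ↦ hBA hy
  -- By `unique`, agreement and disagreement are both open conditions, so agreement propagates along
  -- preconnected sets.
  have agree (s s' : Π x, F x) (U : Set X) (hU : IsPreconnected U)
      (hs : ∀ x ∈ U, P s x) (hs' : ∀ x ∈ U, P s' x) (x y : X) (hx : x ∈ U) (hy : y ∈ U)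
      (h : s x = s' x) : s y = s' y := by
    classical
    let b : X → Bool := fun z ↦ decide (s z = s' z)
    have hb : ContinuousOn b U := fun z hz ↦ by
      have : b =ᶠ[𝓝 z] fun _ ↦ b z := by
        filter_upwards [unique s s' z (hs z hz) (hs' z hz)] with w hw
        simp [b, hw]
      exact (continuousAt_const.congr this.symm).continuousWithinAt
    have := hU.constant hb hx hy
    simp only [b, h, decide_true] at this
    simpa using this.symm
  -- Over a connected open `U` in a uniform neighbourhood of `x`, a point of the total space
  -- corresponds to the value at `x` of the section through it; this trivializes `p`. Local path
  -- connectedness makes the component `U` open.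
  have cov : IsCoveringMap p := by
    intro x
    obtain ⟨U₀, hU₀, hex⟩ := ex x
    obtain ⟨V, hVU, hVo, hxV⟩ := mem_nhds_iff.1 hU₀
    set U := connectedComponentIn V x
    have hUo : IsOpen U := hVo.connectedComponentIn
    have hUc : IsPreconnected U := isPreconnected_connectedComponentIn
    have hxU : x ∈ U := mem_connectedComponentIn hxV
    have hUU : U ⊆ U₀ := (connectedComponentIn_subset V x).trans hVU
    choose σ hσ hσP using fun y : U ↦ hex y (hUU y.2)
    have hσP' (y : U) (c) : ∀ z ∈ U, P (σ y c) z := fun z hz ↦ hσP y c z (hUU hz)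
    let x' : U := ⟨x, hxU⟩
    let _ : TopologicalSpace (F x) := ⊥
    have : DiscreteTopology (F x) := ⟨rfl⟩
    refine IsEvenlyCovered.to_isEvenlyCovered_preimage (I := F x)
      ⟨inferInstance, U, hxU, hUo, hUo.preimage hp, ⟨⟨fun e ↦ ⟨⟨p e, e.2⟩, σ ⟨_, e.2⟩ e.1.2 x⟩,
        fun a ↦ ⟨⟨a.1, σ x' a.2 a.1⟩, a.1.2⟩, ?_, ?_⟩, ?_, ?_⟩, fun _ ↦ rfl⟩
    · rintro ⟨⟨y, c⟩, hy : y ∈ U⟩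
      simp only [p, Subtype.mk.injEq, Sigma.mk.injEq, heq_eq_eq, true_and]
      rw [agree (σ x' (σ ⟨y, hy⟩ c x)) (σ ⟨y, hy⟩ c) U hUc (hσP' _ _) (hσP' ⟨y, hy⟩ c) x y hxU hy
        (hσ x' _), hσ ⟨y, hy⟩]
    · rintro ⟨y, c⟩
      simp only [p, Prod.mk.injEq, true_and]
      exact (agree (σ y (σ x' c y)) (σ x' c) U hUc (hσP' _ _) (hσP' x' c) y x y.2 hxU
        (hσ y _)).trans (hσ x' c)
    · refine Continuous.prodMk (Continuous.subtype_mk (hp.comp continuous_subtype_val) _)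
        (continuous_iff_continuousAt.2 ?_)
      rintro ⟨⟨y, c⟩, hy : y ∈ U⟩
      refine ContinuousAt.congr (f := fun _ ↦ σ ⟨y, hy⟩ c x) continuousAt_const ?_
      have := (sheet (σ ⟨y, hy⟩ c) U hUo (hσP' ⟨y, hy⟩ c)).mem_nhds (x := ⟨y, c⟩)
        ⟨hy, (hσ ⟨y, hy⟩ c).symm⟩
      filter_upwards [continuousAt_subtype_val.preimage_mem_nhds this]
      rintro ⟨⟨z, d⟩, hz : z ∈ U⟩ ⟨-, hd : d = σ ⟨y, hy⟩ c z⟩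
      dsimp only
      subst hd
      exact agree _ _ U hUc (hσP' ⟨y, hy⟩ c) (hσP' ⟨z, hz⟩ _) z x hz hxU (hσ ⟨z, hz⟩ _).symm
    · refine Continuous.subtype_mk (continuous_prod_of_discrete_right.2 fun c ↦ ?_) _
      refine continuous_iff_continuousAt.2 fun y ↦ ?_
      exact (sec (σ x' c) y (hσP' x' c y y.2)).comp continuousAt_subtype_val
  -- A global section is a lift of the identity, which exists because the base is simply connected.
  obtain ⟨G, ⟨hG₀, hG⟩, -⟩ := cov.existsUnique_continuousMap_lifts (ContinuousMap.id X) x₀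
    ⟨x₀, c₀⟩ rfl
  have : ∀ x, ∃ c : F x, G x = ⟨x, c⟩ := fun x ↦ by
    have hx : (G x).1 = x := congrFun hG x
    generalize G x = e at hx
    obtain ⟨y, c⟩ := e
    subst hx
    exact ⟨c, rfl⟩
  choose s hs using this
  refine ⟨s, ?_, fun x ↦ ?_⟩
  · have := (hs x₀).symm.trans hG₀
    simpa using this
  · obtain ⟨U, hU, hex⟩ := ex x
    obtain ⟨V, hVU, hVo, hxV⟩ := mem_nhds_iff.1 hU
    obtain ⟨σ, hσ, hσP⟩ := hex x (mem_of_mem_nhds hU) (s x)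
    refine congr σ s x (hσP x (mem_of_mem_nhds hU)) ?_
    -- By continuity the lift stays near `x` in the open graph of `σ`, so it is locally the
    -- admissible section `σ`.
    have h1 := (sheet σ V hVo fun z hz ↦ hσP z (hVU hz)).mem_nhds (x := G x)
      (by rw [hs]; exact ⟨hxV, hσ.symm⟩)
    filter_upwards [G.continuous.continuousAt.preimage_mem_nhds h1] with y hy
    rw [Set.mem_preimage, hs] at hy
    exact hy.2.symm

open unitInterval in
/-- A local homeomorphism from a nonempty connected Hausdorff space to a real topological vector
space, along which all segments issued from one point lift, is bijective. -/
theorem IsLocalHomeomorph.bijective_of_lift_segments {X E : Type*} [TopologicalSpace X] [T2Space X]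
    [PreconnectedSpace X] [AddCommGroup E] [TopologicalSpace E] [IsTopologicalAddGroup E]
    [Module ℝ E] [ContinuousSMul ℝ E] {Φ : X → E} (hΦ : IsLocalHomeomorph Φ) (x₀ : X)
    (lift : ∀ v : E, ∃ γ : C(I, X), γ 0 = x₀ ∧ ∀ t : I, Φ (γ t) = Φ x₀ + (t : ℝ) • v) :
    Function.Bijective Φ := by
  choose γ γ0 hγ using lift
  let H : C(I × E, E) := ⟨fun q ↦ Φ x₀ + (q.1 : ℝ) • q.2, by fun_prop⟩
  have hc : Continuous fun q : I × E ↦ γ q.2 q.1 := by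
    refine hΦ.continuous_lift (T2Space.isSeparatedMap Φ) H ?_ ?_ fun v ↦ (γ v).continuous
    · ext q; simp [H, hγ]
    · simp only [γ0]; exact continuous_const
  -- The endpoints of the lifts form a right inverse of `Φ`, continuous because lifts depend
  -- continuously on the segment. Its range is shown to be open and closed, hence everything.
  let Ψ : E → X := fun y ↦ γ (y - Φ x₀) 1
  have hΨ : Continuous Ψ :=
    hc.comp (Continuous.prodMk continuous_const (continuous_id.sub continuous_const))
  have hΦΨ (y) : Φ (Ψ y) = y := by simp [Ψ, hγ]
  have hop : IsOpen (Set.range Ψ) := by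
    rw [isOpen_iff_mem_nhds]
    rintro _ ⟨y, rfl⟩
    obtain ⟨N, hN, hinj⟩ := isLocallyInjective_iff_nhds.1 hΦ.isLocallyInjective (Ψ y)
    have h1 : ContinuousAt (fun x ↦ Ψ (Φ x)) (Ψ y) := (hΨ.comp hΦ.continuous).continuousAt
    -- For `x` near `Ψ y`, both `x` and `Ψ (Φ x)` lie in `N` and have the same image under `Φ`,
    -- which is injective on `N`.
    have h2 : N ∈ 𝓝 (Ψ (Φ (Ψ y))) := by rwa [hΦΨ]
    filter_upwards [hN, h1.preimage_mem_nhds h2] with x hx hx'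
    exact ⟨Φ x, hinj hx' hx (hΦΨ _)⟩
  have hcl : IsClosed (Set.range Ψ) := by
    have : Set.range Ψ = {x | Ψ (Φ x) = x} := by
      ext x
      exact ⟨fun ⟨y, hy⟩ ↦ by subst hy; exact congrArg Ψ (hΦΨ y), fun h ↦ ⟨_, h⟩⟩
    rw [this]
    exact isClosed_eq (hΨ.comp hΦ.continuous) continuous_id
  have hr : Set.range Ψ = Set.univ := IsClopen.eq_univ ⟨hcl, hop⟩ ⟨_, 0, rfl⟩
  refine ⟨fun x x' h ↦ ?_, fun y ↦ ⟨_, hΦΨ y⟩⟩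
  obtain ⟨y, rfl⟩ : x ∈ Set.range Ψ := hr ▸ Set.mem_univ _
  obtain ⟨y', rfl⟩ : x' ∈ Set.range Ψ := hr ▸ Set.mem_univ _
  rw [hΦΨ, hΦΨ] at h
  rw [h]

end Topology
end

noncomputable section

/-! ### Smooth functions and vector fields near a point, brackets as commutators. -/

section Calculus

/-- The model space of 3-manifolds. -/
abbrev E3 : Type := EuclideanSpace ℝ (Fin 3)

variable {M : Type*} [TopologicalSpace M] [ChartedSpace E3 M]

/-- The function `h` is smooth on a neighbourhood of `x`. -/
def FunSmoothNear (h : M → ℝ) (x : M) : Prop :=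
  ∀ᶠ y in 𝓝 x, ContMDiffAt (𝓡 3) 𝓘(ℝ) ∞ h y

lemma FunSmoothNear.eventually {h : M → ℝ} {x : M} (hh : FunSmoothNear h x) :
    ∀ᶠ y in 𝓝 x, FunSmoothNear h y := eventually_eventually_nhds.2 hh

lemma FunSmoothNear.congr {h k : M → ℝ} {x : M} (hh : FunSmoothNear h x)
    (hk : ∀ᶠ y in 𝓝 x, h y = k y) : FunSmoothNear k x := by
  filter_upwards [hh, eventually_eventually_nhds.2 hk] with y hy hy'
  refine hy.congr_of_eventuallyEq ?_
  filter_upwards [hy'] with z hz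
  rw [hz]

lemma FunSmoothNear.mdiffAt {h : M → ℝ} {x : M} (hh : FunSmoothNear h x) :
    MDifferentiableAt (𝓡 3) 𝓘(ℝ) h x :=
  hh.self_of_nhds.mdifferentiableAt (by simp)

lemma FunSmoothNear.add {h k : M → ℝ} {x : M} (hh : FunSmoothNear h x) (hk : FunSmoothNear k x) :
    FunSmoothNear (fun y ↦ h y + k y) x := by
  filter_upwards [hh, hk] with y h1 h2 using h1.add h2

lemma FunSmoothNear.sub {h k : M → ℝ} {x : M} (hh : FunSmoothNear h x) (hk : FunSmoothNear k x) :
    FunSmoothNear (fun y ↦ h y - k y) x := by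
  filter_upwards [hh, hk] with y h1 h2 using h1.sub h2

lemma FunSmoothNear.mul {h k : M → ℝ} {x : M} (hh : FunSmoothNear h x) (hk : FunSmoothNear k x) :
    FunSmoothNear (fun y ↦ h y * k y) x := by
  filter_upwards [hh, hk] with y h1 h2 using h1.mul h2

lemma funSmoothNear_const (c : ℝ) (x : M) : FunSmoothNear (fun _ ↦ c) x :=
  Filter.Eventually.of_forall fun _ ↦ contMDiffAt_const

lemma FunSmoothNear.comp {g : ℝ → ℝ} {h : M → ℝ} {x : M}
    (hg : ∀ᶠ t in 𝓝 (h x), ContDiffAt ℝ ∞ g t) (hh : FunSmoothNear h x) :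
    FunSmoothNear (fun y ↦ g (h y)) x := by
  filter_upwards [hh, hh.self_of_nhds.continuousAt.eventually hg] with y h1 h2
  exact h2.contMDiffAt.comp y h1

lemma FunSmoothNear.inv {h : M → ℝ} {x : M} (hh : FunSmoothNear h x) (h0 : h x ≠ 0) :
    FunSmoothNear (fun y ↦ (h y)⁻¹) x := by
  refine FunSmoothNear.comp (g := fun t ↦ t⁻¹) ?_ hh
  filter_upwards [isOpen_ne.mem_nhds h0] with t ht
  exact contDiffAt_inv ℝ ht

/-- Vector fields on a 3-manifold, without any regularity. -/
abbrev VField (M : Type*) [TopologicalSpace M] [ChartedSpace E3 M] : Type _ :=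
  Π y : M, TangentSpace (𝓡 3) y

variable [IsManifold (𝓡 3) ∞ M]

/-- The vector field `V` is smooth on a neighbourhood of `x`. -/
def SmoothNear (V : VField M) (x : M) : Prop :=
  ∀ᶠ y in 𝓝 x, ContMDiffAt (𝓡 3) (𝓡 3).tangent ∞
    (fun z ↦ (⟨z, V z⟩ : TangentBundle (𝓡 3) M)) y

lemma SmoothNear.eventually {V : VField M} {x : M} (hV : SmoothNear V x) :
    ∀ᶠ y in 𝓝 x, SmoothNear V y := eventually_eventually_nhds.2 hV

lemma SmoothNear.congr {V W : VField M} {x : M} (hV : SmoothNear V x)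
    (h : ∀ᶠ y in 𝓝 x, V y = W y) : SmoothNear W x := by
  filter_upwards [hV, eventually_eventually_nhds.2 h] with y hy hy'
  refine hy.congr_of_eventuallyEq ?_
  filter_upwards [hy'] with z hz
  rw [hz]

lemma SmoothNear.mdiffAt {V : VField M} {x : M} (hV : SmoothNear V x) :
    MDifferentiableAt (𝓡 3) (𝓡 3).tangent (fun z ↦ (⟨z, V z⟩ : TangentBundle (𝓡 3) M)) x :=
  hV.self_of_nhds.mdifferentiableAt (by simp)

lemma SmoothNear.add {V W : VField M} {x : M} (hV : SmoothNear V x) (hW : SmoothNear W x) :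
    SmoothNear (V + W) x := by
  filter_upwards [hV, hW] with y h1 h2 using h1.add_section h2

lemma SmoothNear.smul {h : M → ℝ} {V : VField M} {x : M} (hh : FunSmoothNear h x)
    (hV : SmoothNear V x) : SmoothNear (h • V) x := by
  filter_upwards [hh, hV] with y h1 h2 using h1.smul_section h2

lemma SmoothNear.sub {V W : VField M} {x : M} (hV : SmoothNear V x) (hW : SmoothNear W x) :
    SmoothNear (V - W) x := by
  filter_upwards [hV, hW] with y h1 h2 using h1.sub_section h2

lemma SmoothNear.const_smul {V : VField M} {x : M} (c : ℝ) (hV : SmoothNear V x) :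
    SmoothNear (c • V) x := by
  filter_upwards [hV] with y h1 using h1.const_smul_section

lemma SmoothNear.finset_sum {ι : Type*} (s : Finset ι) {V : ι → VField M} {x : M}
    (hV : ∀ i ∈ s, SmoothNear (V i) x) : SmoothNear (fun y ↦ ∑ i ∈ s, V i y) x := by
  filter_upwards [(Filter.eventually_all_finset s).2 hV] with y hy
  exact ContMDiffAt.sum_section hy

lemma SmoothNear.mlieBracket {V W : VField M} {x : M} (hV : SmoothNear V x)
    (hW : SmoothNear W x) : SmoothNear (VectorField.mlieBracket (𝓡 3) V W) x := by
  have : IsManifold (𝓡 3) (minSmoothness ℝ 2) M := by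
    rw [minSmoothness_of_isRCLikeNormedField]; infer_instance
  have : IsManifold (𝓡 3) (((⊤ : ℕ∞) : WithTop ℕ∞) + 1) M := by
    change IsManifold (𝓡 3) ∞ M; infer_instance
  filter_upwards [hV, hW] with y h1 h2
  refine ContMDiffAt.mlieBracket_vectorField (m := ⊤) (n := ⊤) h1 h2 ?_
  rw [minSmoothness_of_isRCLikeNormedField]
  exact le_rfl

lemma smoothNear_extend {x : M} (v : TangentSpace (𝓡 3) x) :
    SmoothNear (FiberBundle.extend E3 v) x := by
  obtain ⟨s, hs, hsm⟩ := FiberBundle.exists_contMDiffOn_extend (k := ∞) (𝓡 3) E3 v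
  filter_upwards [eventually_mem_nhds_iff.2 hs] with y hy
  exact hsm.contMDiffAt hy

lemma exists_smoothNear_apply_eq {x : M} (u : TangentSpace (𝓡 3) x) :
    ∃ U : VField M, SmoothNear U x ∧ U x = u :=
  ⟨_, smoothNear_extend u, FiberBundle.extend_apply_self ..⟩

/-- A vector field acts on brackets by commutators. -/
lemma mvfderiv_mlieBracket {U V : VField M} {h : M → ℝ} {x : M} (hU : SmoothNear U x)
    (hV : SmoothNear V x) (hh : FunSmoothNear h x)
    (hVh : FunSmoothNear (fun y ↦ mvfderiv (𝓡 3) h y (V y)) x)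
    (hUh : FunSmoothNear (fun y ↦ mvfderiv (𝓡 3) h y (U y)) x) :
    mvfderiv (𝓡 3) h x (VectorField.mlieBracket (𝓡 3) U V x) =
      mvfderiv (𝓡 3) (fun y ↦ mvfderiv (𝓡 3) h y (V y)) x (U x) -
        mvfderiv (𝓡 3) (fun y ↦ mvfderiv (𝓡 3) h y (U y)) x (V x) := by
  have i3 : IsManifold (𝓡 3) (minSmoothness ℝ 3) M := by
    rw [minSmoothness_of_isRCLikeNormedField]; infer_instance
  have key {A : VField M} (hA : SmoothNear A x) : ContMDiffAt (𝓡 3) (𝓡 3).tangent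
      (minSmoothness ℝ 2) (fun z ↦ (⟨z, A z⟩ : TangentBundle (𝓡 3) M)) x := by
    rw [minSmoothness_of_isRCLikeNormedField]
    exact hA.self_of_nhds.of_le (ENat.LEInfty.out)
  have rule {A B : VField M} {k : M → ℝ} {y : M} (hB : SmoothNear B y) (hk : FunSmoothNear k y) :
      VectorField.mlieBracket (𝓡 3) A (k • B) y = mvfderiv (𝓡 3) k y (A y) • B y +
        k y • VectorField.mlieBracket (𝓡 3) A B y :=
    VectorField.mlieBracket_smul_right hk.mdiffAt hB.mdiffAt
  have rule2 {A B C : VField M} {k : M → ℝ} (hA : SmoothNear A x) (hB : SmoothNear B x)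
      (hC : SmoothNear C x) (hk : FunSmoothNear k x)
      (hBk : FunSmoothNear (fun y ↦ mvfderiv (𝓡 3) k y (B y)) x) :
      VectorField.mlieBracket (𝓡 3) A (VectorField.mlieBracket (𝓡 3) B (k • C)) x =
        mvfderiv (𝓡 3) (fun y ↦ mvfderiv (𝓡 3) k y (B y)) x (A x) • C x +
        mvfderiv (𝓡 3) k x (B x) • VectorField.mlieBracket (𝓡 3) A C x +
        (mvfderiv (𝓡 3) k x (A x) • VectorField.mlieBracket (𝓡 3) B C x +
          k x • VectorField.mlieBracket (𝓡 3) A (VectorField.mlieBracket (𝓡 3) B C) x) := by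
    have e : VectorField.mlieBracket (𝓡 3) B (k • C) =ᶠ[𝓝 x]
        ((fun y ↦ mvfderiv (𝓡 3) k y (B y)) • C + k • VectorField.mlieBracket (𝓡 3) B C) := by
      filter_upwards [hC.eventually, hk.eventually] with y h1 h2
      rw [rule h1 h2]
      rfl
    rw [Filter.EventuallyEq.mlieBracket_vectorField_eq (Filter.EventuallyEq.refl _ A) e,
      VectorField.mlieBracket_add_right (SmoothNear.smul hBk hC).mdiffAt
        (SmoothNear.smul hk (hB.mlieBracket hC)).mdiffAt, rule hC hBk, rule (hB.mlieBracket hC) hk]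
  let w : TangentSpace (𝓡 3) x := (EuclideanSpace.single 0 1 : E3)
  have hw : w ≠ 0 := by
    change (EuclideanSpace.single 0 1 : E3) ≠ 0
    simp
  let W : VField M := FiberBundle.extend E3 w
  have hW : SmoothNear W x := smoothNear_extend w
  have hWx : W x = w := FiberBundle.extend_apply_self ..
  -- The Jacobi identity is taken for `h W` and for `W`. After expansion by the Leibniz rule their
  -- comparison leaves `[U, V] h - (U V h - V U h)` as a coefficient of `W`, and `W x ≠ 0`.
  have J := VectorField.leibniz_identity_mlieBracket_apply (key hU) (key hV)
    (key (SmoothNear.smul hh hW))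
  have J0 := VectorField.leibniz_identity_mlieBracket_apply (key hU) (key hV) (key hW)
  rw [rule2 hU hV hW hh hVh, rule2 hV hU hW hh hUh, rule hW hh, J0, hWx] at J
  refine smul_left_injective ℝ hw ?_
  simp only [sub_smul, smul_add] at J ⊢
  linear_combination (norm := module) (-1 : ℝ) • J

end Calculus
end

noncomputable section

/-! ### Charts: coordinate fields and functions with zero derivative. -/

section Chart

variable {M : Type*} [TopologicalSpace M] [ChartedSpace E3 M]

/-- Small balls in the chart at `x`. -/
lemma exists_ball_subset_chart (x : M) {s : Set M} (hs : s ∈ 𝓝 x) :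
    ∃ r > 0, ∀ z ∈ Metric.ball (extChartAt (𝓡 3) x x) r,
      z ∈ (extChartAt (𝓡 3) x).target ∧ (extChartAt (𝓡 3) x).symm z ∈ s := by
  have h1 : (extChartAt (𝓡 3) x).target ∈ 𝓝 (extChartAt (𝓡 3) x x) :=
    (isOpen_extChartAt_target x).mem_nhds (mem_extChartAt_target x)
  have h2 : (extChartAt (𝓡 3) x).symm ⁻¹' s ∈ 𝓝 (extChartAt (𝓡 3) x x) :=
    (continuousAt_extChartAt_symm x).preimage_mem_nhds (by simpa using hs)
  obtain ⟨r, hr, h⟩ := Metric.mem_nhds_iff.1 (Filter.inter_mem h1 h2)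
  exact ⟨r, hr, fun z hz ↦ h hz⟩

/-- The preimage of a ball in the chart at `x`. -/
lemma chart_preimage_ball_mem (x : M) {r : ℝ} (hr : 0 < r) :
    {y | y ∈ (extChartAt (𝓡 3) x).source ∧
      extChartAt (𝓡 3) x y ∈ Metric.ball (extChartAt (𝓡 3) x x) r} ∈ 𝓝 x :=
  Filter.inter_mem (extChartAt_source_mem_nhds x)
    ((continuousAt_extChartAt x).preimage_mem_nhds (Metric.ball_mem_nhds _ hr))

variable [IsManifold (𝓡 3) ∞ M]

/-- The vector field on the chart domain at `x` with constant coordinates `v`. -/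
def chartField (x : M) (v : E3) : VField M :=
  VectorField.mpullback (𝓡 3) 𝓘(ℝ, E3) (extChartAt (𝓡 3) x)
    (fun z ↦ (v : TangentSpace 𝓘(ℝ, E3) z))

lemma contMDiffAt_extChartAt_symm_target (x : M) {z : E3} (hz : z ∈ (extChartAt (𝓡 3) x).target) :
    ContMDiffAt 𝓘(ℝ, E3) (𝓡 3) ∞ (extChartAt (𝓡 3) x).symm z :=
  (contMDiffOn_extChartAt_symm x).contMDiffAt ((isOpen_extChartAt_target x).mem_nhds hz)

lemma mfderiv_extChartAt_comp_symm (x : M) {z : E3} (hz : z ∈ (extChartAt (𝓡 3) x).target)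
    (v : E3) :
    mfderiv (𝓡 3) 𝓘(ℝ, E3) (extChartAt (𝓡 3) x) ((extChartAt (𝓡 3) x).symm z)
      (mfderiv 𝓘(ℝ, E3) (𝓡 3) (extChartAt (𝓡 3) x).symm z v) = v := by
  have h := mfderiv_extChartAt_comp_mfderivWithin_extChartAt_symm (I := 𝓡 3) (x := x) hz
  simp only [ModelWithCorners.range_eq_univ, mfderivWithin_univ] at h
  exact congrArg (fun L : E3 →L[ℝ] E3 ↦ L v) h

lemma mfderiv_extChartAt_symm_comp (x : M) {y : M} (hy : y ∈ (extChartAt (𝓡 3) x).source)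
    (v : TangentSpace (𝓡 3) y) :
    mfderiv 𝓘(ℝ, E3) (𝓡 3) (extChartAt (𝓡 3) x).symm (extChartAt (𝓡 3) x y)
      (mfderiv (𝓡 3) 𝓘(ℝ, E3) (extChartAt (𝓡 3) x) y v) = v := by
  have h := mfderivWithin_extChartAt_symm_comp_mfderiv_extChartAt' (I := 𝓡 3) (x := x) hy
  simp only [ModelWithCorners.range_eq_univ, mfderivWithin_univ] at h
  exact congrArg (fun L : E3 →L[ℝ] E3 ↦ L v) h

lemma chartField_symm (x : M) {z : E3} (hz : z ∈ (extChartAt (𝓡 3) x).target) (v : E3) :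
    chartField x v ((extChartAt (𝓡 3) x).symm z) =
      mfderiv 𝓘(ℝ, E3) (𝓡 3) (extChartAt (𝓡 3) x).symm z v := by
  have hi := isInvertible_mfderiv_extChartAt (I := 𝓡 3) (x := x)
    ((extChartAt (𝓡 3) x).map_target hz)
  exact hi.inverse_apply_eq.2 (mfderiv_extChartAt_comp_symm x hz v).symm

lemma contMDiffAt_const_field (v z : E3) : ContMDiffAt 𝓘(ℝ, E3) 𝓘(ℝ, E3).tangent ∞
    (fun y : E3 ↦ (⟨y, v⟩ : TangentBundle 𝓘(ℝ, E3) E3)) z :=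
  contMDiffAt_vectorSpace_iff_contDiffAt.2 contDiffAt_const

lemma smoothNear_chartField (x : M) (v : E3) {y : M} (hy : y ∈ (extChartAt (𝓡 3) x).source) :
    SmoothNear (chartField x v) y := by
  filter_upwards [(isOpen_extChartAt_source (I := 𝓡 3) x).mem_nhds hy] with w hw
  refine ContMDiffAt.mpullback_vectorField_preimage (n := ∞) (contMDiffAt_const_field v _)
    ?_ (isInvertible_mfderiv_extChartAt hw) le_rfl
  exact contMDiffAt_extChartAt' (by simpa using hw)

/-- Pullback commutes with brackets and constant fields on `ℝ³` commute. In such fields, closedness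
of a form becomes symmetry of the derivative of its coordinate expression. -/
lemma mlieBracket_chartField (x : M) (u v : E3) {y : M} (hy : y ∈ (extChartAt (𝓡 3) x).source) :
    VectorField.mlieBracket (𝓡 3) (chartField x u) (chartField x v) y = 0 := by
  have : IsManifold (𝓡 3) (minSmoothness ℝ 2) M := by
    rw [minSmoothness_of_isRCLikeNormedField]; infer_instance
  have : IsManifold 𝓘(ℝ, E3) (minSmoothness ℝ 2) E3 := by
    rw [minSmoothness_of_isRCLikeNormedField]; infer_instance
  have h := VectorField.mpullback_mlieBracket (I := 𝓡 3) (I' := 𝓘(ℝ, E3)) (n := ∞)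
    (f := extChartAt (𝓡 3) x) (V := fun _ ↦ u) (W := fun _ ↦ v) (x₀ := y)
    ((contMDiffAt_const_field u _).mdifferentiableAt (by simp))
    ((contMDiffAt_const_field v _).mdifferentiableAt (by simp))
    (contMDiffAt_extChartAt' (by simpa using hy))
    (by rw [minSmoothness_of_isRCLikeNormedField]; exact ENat.LEInfty.out)
  have h0 : VectorField.mlieBracket 𝓘(ℝ, E3) (fun z ↦ (u : TangentSpace 𝓘(ℝ, E3) z))
      (fun z ↦ (v : TangentSpace 𝓘(ℝ, E3) z)) (extChartAt (𝓡 3) x y) = 0 := by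
    refine (congrFun VectorField.mlieBracketWithin_univ _).symm.trans
      ((congrFun (VectorField.mlieBracketWithin_eq_lieBracketWithin (V := fun _ : E3 ↦ u)
      (W := fun _ : E3 ↦ v) (s := Set.univ)) _).trans ?_)
    simp [VectorField.lieBracketWithin]
    rfl
  refine h.symm.trans ?_
  change (mfderiv (𝓡 3) 𝓘(ℝ, E3) (extChartAt (𝓡 3) x) y).inverse _ = 0
  rw [h0, map_zero]

lemma hasFDerivAt_comp_extChartAt_symm (x : M) {z : E3} (hz : z ∈ (extChartAt (𝓡 3) x).target)
    {h : M → ℝ} (hh : MDifferentiableAt (𝓡 3) 𝓘(ℝ) h ((extChartAt (𝓡 3) x).symm z)) :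
    HasFDerivAt (fun w ↦ h ((extChartAt (𝓡 3) x).symm w))
      ((mvfderiv (𝓡 3) h ((extChartAt (𝓡 3) x).symm z)).comp
        (mfderiv 𝓘(ℝ, E3) (𝓡 3) (extChartAt (𝓡 3) x).symm z)) z := by
  have h1 := ((contMDiffAt_extChartAt_symm_target x hz).mdifferentiableAt (by simp)).hasMFDerivAt
  exact (hh.hasMFDerivAt.comp z h1).hasFDerivAt

/-- A function with zero derivative near a point is constant near this point. -/
lemma eventually_eq_of_mvfderiv_eq_zero {h : M → ℝ} {x : M}
    (hh : ∀ᶠ y in 𝓝 x, MDifferentiableAt (𝓡 3) 𝓘(ℝ) h y ∧ mvfderiv (𝓡 3) h y = 0) :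
    ∀ᶠ y in 𝓝 x, h y = h x := by
  obtain ⟨r, hr, hB⟩ := exists_ball_subset_chart x hh
  have hd (z) (hz : z ∈ Metric.ball (extChartAt (𝓡 3) x x) r) :
      HasFDerivAt (fun w ↦ h ((extChartAt (𝓡 3) x).symm w)) (0 : E3 →L[ℝ] ℝ) z := by
    have := hasFDerivAt_comp_extChartAt_symm x (hB z hz).1 (hB z hz).2.1
    rw [(hB z hz).2.2] at this
    exact this
  filter_upwards [chart_preimage_ball_mem x hr] with y hy
  have := (convex_ball (extChartAt (𝓡 3) x x) r).is_const_of_fderivWithin_eq_zero (𝕜 := ℝ)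
    (f := fun w ↦ h ((extChartAt (𝓡 3) x).symm w))
    (fun z hz ↦ (hd z hz).differentiableAt.differentiableWithinAt)
    (fun z hz ↦ by
      rw [fderivWithin_of_isOpen Metric.isOpen_ball hz, (hd z hz).fderiv])
    hy.2 (Metric.mem_ball_self hr)
  rwa [(extChartAt (𝓡 3) x).left_inv hy.1, extChartAt_to_inv] at this

end Chart
end

noncomputable section

/-! ### Riemannian metric: local orthonormal frames and tensoriality. -/

section Metric

variable {M : Type*} [TopologicalSpace M] [ChartedSpace E3 M]
  [RiemannianBundle (fun x : M ↦ TangentSpace (𝓡 3) x)]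

/-- An orthonormal triple of tangent vectors as a basis. -/
lemma Orthonormal.exists_orthonormalBasis_coe {x : M} {b : Fin 3 → TangentSpace (𝓡 3) x}
    (hb : Orthonormal ℝ b) : ∃ B : OrthonormalBasis (Fin 3) ℝ (TangentSpace (𝓡 3) x), ⇑B = b := by
  have hc : Fintype.card (Fin 3) = finrank ℝ (TangentSpace (𝓡 3) x) := by
    rw [(Fact.out : finrank ℝ (TangentSpace (𝓡 3) x) = 3), Fintype.card_fin]
  let b' := basisOfOrthonormalOfCardEqFinrank hb hc
  have h : ⇑b' = b := coe_basisOfOrthonormalOfCardEqFinrank hb hc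
  exact ⟨b'.toOrthonormalBasis (by rw [h]; exact hb), by simp [h]⟩

lemma Orthonormal.eq_sum {x : M} {b : Fin 3 → TangentSpace (𝓡 3) x}
    (hb : Orthonormal ℝ b) (v : TangentSpace (𝓡 3) x) : v = ∑ i, inner ℝ (b i) v • b i := by
  obtain ⟨B, rfl⟩ := hb.exists_orthonormalBasis_coe
  exact (B.sum_repr' v).symm

variable [IsManifold (𝓡 3) ∞ M]
  [IsContMDiffRiemannianBundle (𝓡 3) ∞ E3 (fun x : M ↦ TangentSpace (𝓡 3) x)]

lemma SmoothNear.inner {V W : VField M} {x : M} (hV : SmoothNear V x) (hW : SmoothNear W x) :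
    FunSmoothNear (fun y ↦ inner ℝ (V y) (W y)) x := by
  filter_upwards [hV, hW] with y h1 h2
  exact ContMDiffAt.inner_bundle (F := E3) h1 h2

lemma SmoothNear.norm {V : VField M} {x : M} (hV : SmoothNear V x) (h0 : V x ≠ 0) :
    FunSmoothNear (fun y ↦ ‖V y‖) x := by
  have h := FunSmoothNear.comp (g := Real.sqrt) ?_ (hV.inner hV)
  · refine h.congr (Filter.Eventually.of_forall fun y ↦ ?_)
    simp only [real_inner_self_eq_norm_sq, Real.sqrt_sq (norm_nonneg _)]
  · filter_upwards [isOpen_ne.mem_nhds (inner_self_ne_zero.2 h0)] with t ht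
    exact Real.contDiffAt_sqrt ht

/-- The derivative of a smooth function along a smooth vector field is smooth. -/
lemma FunSmoothNear.mvfderiv {h : M → ℝ} {V : VField M} {x : M} (hh : FunSmoothNear h x)
    (hV : SmoothNear V x) : FunSmoothNear (fun y ↦ mvfderiv (𝓡 3) h y (V y)) x := by
  let w : TangentSpace (𝓡 3) x := (EuclideanSpace.single 0 1 : E3)
  have hw : w ≠ 0 := by
    change (EuclideanSpace.single 0 1 : E3) ≠ 0
    simp
  let W : VField M := FiberBundle.extend E3 w
  have hW : SmoothNear W x := smoothNear_extend w
  have hWx : W x = w := FiberBundle.extend_apply_self ..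
  have h1 : FunSmoothNear (fun y ↦ Inner.inner ℝ (W y) (W y)) x := hW.inner hW
  have h0 : Inner.inner ℝ (W x) (W x) ≠ 0 := by rw [hWx]; exact inner_self_ne_zero.2 hw
  -- `V h` is the coefficient of `W` in `[V, h W] - h [V, W]`, extracted by pairing with `W`; so its
  -- smoothness follows from that of brackets.
  refine ((((hV.mlieBracket (SmoothNear.smul hh hW)).sub
    (SmoothNear.smul hh (hV.mlieBracket hW))).inner hW).mul (h1.inv h0)).congr ?_
  filter_upwards [hh.eventually, hW.eventually,
    h1.self_of_nhds.continuousAt.eventually_ne h0] with y hy1 hy2 hy3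
  have rule : VectorField.mlieBracket (𝓡 3) V (h • W) y = _root_.mvfderiv (𝓡 3) h y (V y) • W y +
        h y • VectorField.mlieBracket (𝓡 3) V W y :=
    VectorField.mlieBracket_smul_right hy1.mdiffAt hy2.mdiffAt
  simp only [Pi.sub_apply, Pi.smul_apply', rule, add_sub_cancel_right]
  rw [real_inner_smul_left, mul_assoc, mul_inv_cancel₀ hy3, mul_one]

/-- A smooth orthonormal frame near `x`, from smooth fields which are orthonormal at `x`. -/
lemma exists_orthonormal_frame {x : M} {s : Fin 3 → VField M} (hs : ∀ i, SmoothNear (s i) x)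
    (hx : Orthonormal ℝ (fun i ↦ s i x)) :
    ∃ e : Fin 3 → VField M, (∀ i, e i x = s i x) ∧ (∀ i, SmoothNear (e i) x) ∧
      (∀ᶠ y in 𝓝 x, Orthonormal ℝ (fun i ↦ e i y)) ∧
      ∀ y, e 0 y = ‖s 0 y‖⁻¹ • s 0 y := by
  let g (i : Fin 3) : VField M := fun y ↦ InnerProductSpace.gramSchmidt ℝ (fun j ↦ s j y) i
  have hgx (i) : g i x = s i x := by
    change InnerProductSpace.gramSchmidt ℝ (fun j ↦ s j x) i = s i x
    rw [InnerProductSpace.gramSchmidt_of_orthogonal (𝕜 := ℝ) (f := fun j ↦ s j x)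
      (fun i j hij ↦ hx.2 hij)]
  have hg0 (i) : g i x ≠ 0 := by rw [hgx]; exact hx.ne_zero i
  have hg (i) : SmoothNear (g i) x := by
    induction i using WellFoundedLT.induction with
    | ind i ih =>
      have hsum : SmoothNear (fun y ↦ ∑ j ∈ Finset.Iio i,
          ((fun y ↦ inner ℝ (g j y) (s i y) * (inner ℝ (g j y) (g j y))⁻¹) • g j) y) x := by
        refine SmoothNear.finset_sum _ fun j hj ↦ ?_
        have hj := ih j (Finset.mem_Iio.1 hj)
        exact SmoothNear.smul ((hj.inner (hs i)).mul
          ((hj.inner hj).inv (inner_self_ne_zero.2 (hg0 j)))) hj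
      refine ((hs i).sub hsum).congr (Filter.Eventually.of_forall fun y ↦ ?_)
      change _ = InnerProductSpace.gramSchmidt ℝ (fun j ↦ s j y) i
      rw [InnerProductSpace.gramSchmidt_def]
      simp only [Pi.sub_apply, Submodule.starProjection_singleton, Pi.smul_apply',
        real_inner_self_eq_norm_sq, div_eq_mul_inv]
      rfl
  refine ⟨fun i y ↦ ‖g i y‖⁻¹ • g i y, fun i ↦ ?_, fun i ↦ ?_, ?_, fun y ↦ ?_⟩
  · have h1 : ‖s i x‖ = 1 := hx.1 i
    simp only [hgx, h1, inv_one, one_smul]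
  · exact SmoothNear.smul (((hg i).norm (hg0 i)).inv (norm_ne_zero_iff.2 (hg0 i))) (hg i)
  · have hne (i) : ∀ᶠ y in 𝓝 x, ‖g i y‖ ≠ 0 :=
      ((hg i).norm (hg0 i)).self_of_nhds.continuousAt.eventually_ne (norm_ne_zero_iff.2 (hg0 i))
    filter_upwards [Filter.eventually_all.2 hne] with y hy
    refine ⟨fun i ↦ ?_, fun i j hij ↦ ?_⟩
    · rw [norm_smul, norm_inv, norm_norm, inv_mul_cancel₀ (hy i)]
    · change inner ℝ (‖g i y‖⁻¹ • g i y) (‖g j y‖⁻¹ • g j y) = 0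
      rw [real_inner_smul_left, real_inner_smul_right]
      have : inner ℝ (g i y) (g j y) = 0 := InnerProductSpace.gramSchmidt_orthogonal ℝ _ hij
      rw [this, mul_zero, mul_zero]
  -- Gram–Schmidt changes the first field only by normalization, at every point; a field that
  -- already has unit length is kept.
  · have : g 0 y = s 0 y := by
      change InnerProductSpace.gramSchmidt ℝ (fun j ↦ s j y) ⊥ = _
      rw [InnerProductSpace.gramSchmidt_bot]; rfl
    simp only [this]

lemma exists_orthonormal_frame_apply {x : M} {b : Fin 3 → TangentSpace (𝓡 3) x}
    (hb : Orthonormal ℝ b) :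
    ∃ e : Fin 3 → VField M, (∀ i, e i x = b i) ∧ (∀ i, SmoothNear (e i) x) ∧
      (∀ᶠ y in 𝓝 x, Orthonormal ℝ (fun i ↦ e i y)) := by
  have h (i) : (FiberBundle.extend E3 (b i) : VField M) x = b i := FiberBundle.extend_apply_self ..
  obtain ⟨e, h1, h2, h3, -⟩ := exists_orthonormal_frame
    (s := fun i ↦ FiberBundle.extend E3 (b i)) (fun i ↦ smoothNear_extend (b i))
    (by simp only [h]; exact hb)
  exact ⟨e, fun i ↦ (h1 i).trans (h i), h2, h3⟩

lemma exists_orthonormal_frame_near (x : M) :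
    ∃ e : Fin 3 → VField M, (∀ i, SmoothNear (e i) x) ∧
      (∀ᶠ y in 𝓝 x, Orthonormal ℝ (fun i ↦ e i y)) := by
  let b := (stdOrthonormalBasis ℝ (TangentSpace (𝓡 3) x)).reindex
    (finCongr (Fact.out : finrank ℝ (TangentSpace (𝓡 3) x) = 3))
  obtain ⟨e, -, h2, h3⟩ := exists_orthonormal_frame_apply b.orthonormal
  exact ⟨e, h2, h3⟩

/-- A vector field is smooth if its products with smooth vector fields are. -/
lemma smoothNear_of_inner {V : VField M} {x : M}
    (h : ∀ W : VField M, SmoothNear W x → FunSmoothNear (fun y ↦ inner ℝ (W y) (V y)) x) :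
    SmoothNear V x := by
  obtain ⟨e, h2, h3⟩ := exists_orthonormal_frame_near x
  have := SmoothNear.finset_sum (Finset.univ)
    (V := fun i ↦ (fun y ↦ inner ℝ (e i y) (V y)) • e i) (x := x)
    (fun i _ ↦ SmoothNear.smul (h _ (h2 i)) (h2 i))
  refine this.congr ?_
  filter_upwards [h3] with y hy
  exact (hy.eq_sum _).symm

/-- Operations on smooth fields which are linear over smooth functions are pointwise. -/
lemma eq_of_tensorial {A : Type*} [AddCommGroup A] [Module ℝ A] {Φ : VField M → A} {x : M}
    (hadd : ∀ V W, SmoothNear V x → SmoothNear W x → Φ (V + W) = Φ V + Φ W)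
    (hsmul : ∀ (h : M → ℝ) V, FunSmoothNear h x → SmoothNear V x → Φ (h • V) = h x • Φ V)
    {V W : VField M} (hV : SmoothNear V x) (hW : SmoothNear W x) (hVW : V x = W x) :
    Φ V = Φ W := by
  classical
  obtain ⟨e, h2, h3⟩ := exists_orthonormal_frame_near x
  -- The cutoff equals `1` near `x`, hence is smooth there. Multiplying by it makes the expansion in
  -- the frame hold at every point, so no locality of `Φ` has to be assumed.
  let ψ (y : M) : ℝ := if Orthonormal ℝ (fun i ↦ e i y) then 1 else 0
  have hψx : ψ x = 1 := if_pos h3.self_of_nhds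
  have hψ : FunSmoothNear ψ x := by
    refine (funSmoothNear_const 1 x).congr ?_
    filter_upwards [h3] with y hy
    exact (if_pos hy).symm
  let c (V : VField M) (i : Fin 3) : M → ℝ := fun y ↦ inner ℝ (e i y) (V y)
  have hc {V : VField M} (hV : SmoothNear V x) (i) : FunSmoothNear (c V i) x := (h2 i).inner hV
  have key {V : VField M} (hV : SmoothNear V x) : Φ V = c V 0 x • Φ (e 0) + c V 1 x • Φ (e 1) +
      c V 2 x • Φ (e 2) := by
    have h1 : ψ • V = ψ • (c V 0 • e 0 + c V 1 • e 1 + c V 2 • e 2) := by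
      funext y
      by_cases hy : Orthonormal ℝ (fun i ↦ e i y)
      · have := hy.eq_sum (V y)
        rw [Fin.sum_univ_three] at this
        exact congrArg (ψ y • ·) this
      · simp [ψ, hy]
    have h5 (i) := SmoothNear.smul (hc hV i) (h2 i)
    calc Φ V = Φ (ψ • V) := by rw [hsmul _ _ hψ hV, hψx, one_smul]
      _ = _ := by
        rw [h1, hsmul _ _ hψ (((h5 0).add (h5 1)).add (h5 2)), hψx, one_smul,
          hadd _ _ ((h5 0).add (h5 1)) (h5 2), hadd _ _ (h5 0) (h5 1)]
        simp only [hsmul _ _ (hc hV _) (h2 _)]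
  rw [key hV, key hW]
  simp only [c, hVW]

end Metric
end

noncomputable section

/-! ### Levi-Civita connections. -/

section LeviCivita

variable {M : Type*} [TopologicalSpace M] [ChartedSpace E3 M] [IsManifold (𝓡 3) ∞ M]

variable (M) in
/-- Connections on the tangent bundle. -/
abbrev Connection : Type _ :=
  CovariantDerivative (𝓡 3) E3 (TangentSpace (𝓡 3) : M → Type _)

variable {cov : Connection M} {x : M}

lemma cov_add {V W : VField M} (hV : SmoothNear V x) (hW : SmoothNear W x)
    (u : TangentSpace (𝓡 3) x) : cov (V + W) x u = cov V x u + cov W x u := by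
  rw [cov.isCovariantDerivativeOnUniv.add hV.mdiffAt hW.mdiffAt]
  rfl

lemma cov_smul {h : M → ℝ} {V : VField M} (hh : FunSmoothNear h x) (hV : SmoothNear V x)
    (u : TangentSpace (𝓡 3) x) :
    cov (h • V) x u = h x • cov V x u + mvfderiv (𝓡 3) h x u • V x := by
  rw [cov.isCovariantDerivativeOnUniv.leibniz hV.mdiffAt hh.mdiffAt]
  rfl

lemma cov_congr {V W : VField M} (hV : SmoothNear V x) (h : ∀ᶠ y in 𝓝 x, V y = W y) :
    cov V x = cov W x :=
  cov.isCovariantDerivativeOnUniv.congr_of_eventuallyEq hV.mdiffAt (hV.congr h).mdiffAt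
    Filter.univ_mem h

lemma cov_const_smul {V : VField M} (hV : SmoothNear V x) (c : ℝ) (u : TangentSpace (𝓡 3) x) :
    cov (c • V) x u = c • cov V x u := by
  have h : c • V = (fun _ ↦ c : M → ℝ) • V := rfl
  rw [h, cov_smul (funSmoothNear_const _ x) hV, mvfderiv_const]
  simp

variable [RiemannianBundle (fun x : M ↦ TangentSpace (𝓡 3) x)]
  [IsContMDiffRiemannianBundle (𝓡 3) ∞ E3 (fun x : M ↦ TangentSpace (𝓡 3) x)]

lemma IsLeviCivita.mvfderiv_inner (hcov : IsLeviCivita cov) {V W : VField M}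
    (hV : SmoothNear V x) (hW : SmoothNear W x) (u : TangentSpace (𝓡 3) x) :
    mvfderiv (𝓡 3) (fun y ↦ inner ℝ (V y) (W y)) x u =
      inner ℝ (cov V x u) (W x) + inner ℝ (V x) (cov W x u) := by
  have : IsContMDiffRiemannianBundle (𝓡 3) 1 E3 (fun x : M ↦ TangentSpace (𝓡 3) x) :=
    IsContMDiffRiemannianBundle.of_le (n := ∞) (by simp)
  have h := CovariantDerivative.IsMetricCompatible.mvfderiv_inner_eq hcov.1
    (FiberBundle.extend E3 u) hV.mdiffAt hW.mdiffAt
  simpa only [FiberBundle.extend_apply_self] using h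

lemma IsLeviCivita.mlieBracket (hcov : IsLeviCivita cov) {V W : VField M}
    (hV : SmoothNear V x) (hW : SmoothNear W x) :
    VectorField.mlieBracket (𝓡 3) V W x = cov W x (V x) - cov V x (W x) :=
  (cov.torsion_eq_zero_iff.1 hcov.2 hV.mdiffAt hW.mdiffAt).symm

/-- The Levi-Civita derivative of a smooth field along a smooth field is smooth. -/
lemma IsLeviCivita.smoothNear (hcov : IsLeviCivita cov) {V W : VField M}
    (hV : SmoothNear V x) (hW : SmoothNear W x) : SmoothNear (fun y ↦ cov W y (V y)) x := by
  refine smoothNear_of_inner fun Z hZ ↦ ?_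
  have b {A B : VField M} (hA : SmoothNear A x) (hB : SmoothNear B x) := hA.mlieBracket hB
  -- Koszul's formula: `2 ⟪∇_V W, Z⟫` is a combination of derivatives of inner products and of
  -- brackets, all of them smooth.
  refine (((((((hW.inner hZ).mvfderiv hV).add ((hZ.inner hV).mvfderiv hW)).sub
    ((hV.inner hW).mvfderiv hZ)).add ((b hV hW).inner hZ)).add ((b hZ hV).inner hW)).sub
    ((b hW hZ).inner hV)).mul (funSmoothNear_const (1 / 2) x) |>.congr ?_
  filter_upwards [hV.eventually, hW.eventually, hZ.eventually] with y h1 h2 h3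
  rw [hcov.mvfderiv_inner h2 h3, hcov.mvfderiv_inner h3 h1, hcov.mvfderiv_inner h1 h2,
    hcov.mlieBracket h1 h2, hcov.mlieBracket h3 h1, hcov.mlieBracket h2 h3]
  simp only [inner_sub_left]
  rw [real_inner_comm (Z y) (cov W y (V y)), real_inner_comm (cov Z y (V y)) (W y),
    real_inner_comm (cov V y (W y)) (Z y), real_inner_comm (cov W y (Z y)) (V y)]
  ring

/-- The derivatives of a smooth function along smooth fields commute up to the bracket. -/
lemma IsLeviCivita.mvfderiv_comm (hcov : IsLeviCivita cov) {U V : VField M} {h : M → ℝ}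
    (hU : SmoothNear U x) (hV : SmoothNear V x) (hh : FunSmoothNear h x) :
    mvfderiv (𝓡 3) (fun y ↦ mvfderiv (𝓡 3) h y (V y)) x (U x) -
        mvfderiv (𝓡 3) (fun y ↦ mvfderiv (𝓡 3) h y (U y)) x (V x) =
      mvfderiv (𝓡 3) h x (cov V x (U x)) - mvfderiv (𝓡 3) h x (cov U x (V x)) := by
  rw [← mvfderiv_mlieBracket hU hV hh (hh.mvfderiv hV) (hh.mvfderiv hU), hcov.mlieBracket hU hV,
    map_sub]

end LeviCivita

/-! ### Tensoriality of the curvature. -/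

section Curvature

variable {M : Type*} [TopologicalSpace M] [ChartedSpace E3 M] [IsManifold (𝓡 3) ∞ M]

/-- The curvature as an operation on vector fields. -/
def curvatureField (cov : Connection M) (U V W : VField M) (x : M) : TangentSpace (𝓡 3) x :=
  cov (fun y ↦ cov W y (V y)) x (U x) - cov (fun y ↦ cov W y (U y)) x (V x)
    - cov W x (VectorField.mlieBracket (𝓡 3) U V x)

lemma curvatureField_swap (cov : Connection M) (U V W : VField M) (x : M) :
    curvatureField cov U V W x = -curvatureField cov V U W x := by
  simp only [curvatureField]
  rw [VectorField.mlieBracket_swap]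
  simp only [Pi.neg_apply, map_neg]
  module

variable [RiemannianBundle (fun x : M ↦ TangentSpace (𝓡 3) x)]
  [IsContMDiffRiemannianBundle (𝓡 3) ∞ E3 (fun x : M ↦ TangentSpace (𝓡 3) x)]
  {cov : Connection M} {x : M}

lemma IsLeviCivita.curvatureField_add_left (hcov : IsLeviCivita cov) {U U' V W : VField M}
    (hU : SmoothNear U x) (hU' : SmoothNear U' x) (hV : SmoothNear V x) (hW : SmoothNear W x) :
    curvatureField cov (U + U') V W x =
      curvatureField cov U V W x + curvatureField cov U' V W x := by
  have e : (fun y ↦ cov W y ((U + U') y)) = (fun y ↦ cov W y (U y)) + (fun y ↦ cov W y (U' y)) := by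
    funext y; exact map_add _ _ _
  have h1 := hcov.smoothNear hU hW
  have h2 := hcov.smoothNear hU' hW
  simp only [curvatureField, hcov.mlieBracket (hU.add hU') hV,
    hcov.mlieBracket hU hV, hcov.mlieBracket hU' hV, cov_add hU hU']
  rw [e, cov_add h1 h2]
  simp only [Pi.add_apply, map_add, map_sub]
  module

lemma IsLeviCivita.curvatureField_smul_left (hcov : IsLeviCivita cov) {h : M → ℝ}
    {U V W : VField M} (hh : FunSmoothNear h x)
    (hU : SmoothNear U x) (hV : SmoothNear V x) (hW : SmoothNear W x) :
    curvatureField cov (h • U) V W x = h x • curvatureField cov U V W x := by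
  have e : (fun y ↦ cov W y ((h • U) y)) = h • (fun y ↦ cov W y (U y)) := by
    funext y; exact (cov W y).map_smul _ _
  have h1 := hcov.smoothNear hU hW
  simp only [curvatureField, hcov.mlieBracket (SmoothNear.smul hh hU) hV,
    hcov.mlieBracket hU hV, cov_smul hh hU]
  rw [e, cov_smul hh h1]
  simp only [Pi.smul_apply', map_add, map_sub, map_smul]
  module

lemma IsLeviCivita.curvatureField_add_right (hcov : IsLeviCivita cov) {U V W W' : VField M}
    (hU : SmoothNear U x) (hV : SmoothNear V x) (hW : SmoothNear W x) (hW' : SmoothNear W' x) :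
    curvatureField cov U V (W + W') x =
      curvatureField cov U V W x + curvatureField cov U V W' x := by
  have e {A : VField M} (hA : SmoothNear A x) (u : TangentSpace (𝓡 3) x) :
      cov (fun y ↦ cov (W + W') y (A y)) x u =
      cov (fun y ↦ cov W y (A y)) x u + cov (fun y ↦ cov W' y (A y)) x u := by
    rw [← cov_add (hcov.smoothNear hA hW) (hcov.smoothNear hA hW')]
    refine (congrArg (· u) (cov_congr ((hcov.smoothNear hA hW).add (hcov.smoothNear hA hW')) ?_)).symm
    filter_upwards [hW.eventually, hW'.eventually] with y h1 h2
    rw [cov_add h1 h2]; rfl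
  simp only [curvatureField, e hU, e hV, cov_add hW hW']
  module

/-- First derivatives of `h` times derivatives of `W` cancel in pairs; what is left in front of `W`
is `U V h - V U h - [U, V] h`, which vanishes since the connection is torsion-free. -/
lemma IsLeviCivita.curvatureField_smul_right (hcov : IsLeviCivita cov) {h : M → ℝ}
    {U V W : VField M} (hh : FunSmoothNear h x)
    (hU : SmoothNear U x) (hV : SmoothNear V x) (hW : SmoothNear W x) :
    curvatureField cov U V (h • W) x = h x • curvatureField cov U V W x := by
  have e {A : VField M} (hA : SmoothNear A x) : cov (fun y ↦ cov (h • W) y (A y)) x =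
      cov (h • (fun y ↦ cov W y (A y)) + (fun y ↦ mvfderiv (𝓡 3) h y (A y)) • W) x := by
    symm
    refine cov_congr ((SmoothNear.smul hh (hcov.smoothNear hA hW)).add
      (SmoothNear.smul (hh.mvfderiv hA) hW)) ?_
    filter_upwards [hW.eventually, hh.eventually] with y h1 h2
    rw [cov_smul h2 h1]; rfl
  have e' {A : VField M} (hA : SmoothNear A x) (u : TangentSpace (𝓡 3) x) :
      cov (fun y ↦ cov (h • W) y (A y)) x u =
      h x • cov (fun y ↦ cov W y (A y)) x u + mvfderiv (𝓡 3) h x u • cov W x (A x) +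
      (mvfderiv (𝓡 3) h x (A x) • cov W x u +
        mvfderiv (𝓡 3) (fun y ↦ mvfderiv (𝓡 3) h y (A y)) x u • W x) := by
    rw [e hA, cov_add (SmoothNear.smul hh (hcov.smoothNear hA hW))
      (SmoothNear.smul (hh.mvfderiv hA) hW),
      cov_smul hh (hcov.smoothNear hA hW), cov_smul (hh.mvfderiv hA) hW]
  have c := hcov.mvfderiv_comm hU hV hh
  simp only [curvatureField, e' hU, e' hV, hcov.mlieBracket hU hV, cov_smul hh hW]
  rw [map_sub (mvfderiv (𝓡 3) h x), ← c]
  module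

/-- The curvature at a point may be computed with any smooth fields. -/
lemma IsLeviCivita.curvatureAt_eq (hcov : IsLeviCivita cov) {U V W : VField M}
    (hU : SmoothNear U x) (hV : SmoothNear V x) (hW : SmoothNear W x) :
    curvatureAt cov x (U x) (V x) (W x) = curvatureField cov U V W x := by
  have ext (u : TangentSpace (𝓡 3) x) : (FiberBundle.extend E3 u : VField M) x = u :=
    FiberBundle.extend_apply_self ..
  have left {U U' V W : VField M} (hU : SmoothNear U x) (hU' : SmoothNear U' x)
      (hV : SmoothNear V x) (hW : SmoothNear W x) (h : U x = U' x) :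
      curvatureField cov U V W x = curvatureField cov U' V W x :=
    eq_of_tensorial (Φ := fun U ↦ curvatureField cov U V W x)
      (fun _ _ h1 h2 ↦ hcov.curvatureField_add_left h1 h2 hV hW)
      (fun _ _ h1 h2 ↦ hcov.curvatureField_smul_left h1 h2 hV hW) hU hU' h
  have right {U V W W' : VField M} (hU : SmoothNear U x)
      (hV : SmoothNear V x) (hW : SmoothNear W x) (hW' : SmoothNear W' x) (h : W x = W' x) :
      curvatureField cov U V W x = curvatureField cov U V W' x :=
    eq_of_tensorial (Φ := fun W ↦ curvatureField cov U V W x)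
      (fun _ _ h1 h2 ↦ hcov.curvatureField_add_right hU hV h1 h2)
      (fun _ _ h1 h2 ↦ hcov.curvatureField_smul_right h1 hU hV h2) hW hW' h
  have eU := smoothNear_extend (U x)
  have eV := smoothNear_extend (V x)
  have eW := smoothNear_extend (W x)
  have h : curvatureAt cov x (U x) (V x) (W x) = curvatureField cov (FiberBundle.extend E3 (U x))
      (FiberBundle.extend E3 (V x)) (FiberBundle.extend E3 (W x)) x := by
    simp only [curvatureField, ext]
    rfl
  -- The second slot is reduced to the first by skew-symmetry.
  rw [h, right eU eV eW hW (ext _), left eU hU eV hW (ext _), curvatureField_swap,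
    left eV hV hU hW (ext _), ← curvatureField_swap]

end Curvature
end

noncomputable section

/-! ### Symmetries of the curvature, Ricci tensor, exterior derivatives of dual forms. -/

section CurvatureTensor

variable {M : Type*} [TopologicalSpace M] [ChartedSpace E3 M] [IsManifold (𝓡 3) ∞ M]
  [RiemannianBundle (fun x : M ↦ TangentSpace (𝓡 3) x)]
  [IsContMDiffRiemannianBundle (𝓡 3) ∞ E3 (fun x : M ↦ TangentSpace (𝓡 3) x)]
  {cov : Connection M} {x : M}

lemma IsLeviCivita.curvatureAt_add_left (hcov : IsLeviCivita cov)
    (u u' v w : TangentSpace (𝓡 3) x) :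
    curvatureAt cov x (u + u') v w = curvatureAt cov x u v w + curvatureAt cov x u' v w := by
  obtain ⟨U, hU, rfl⟩ := exists_smoothNear_apply_eq u
  obtain ⟨U', hU', rfl⟩ := exists_smoothNear_apply_eq u'
  obtain ⟨V, hV, rfl⟩ := exists_smoothNear_apply_eq v
  obtain ⟨W, hW, rfl⟩ := exists_smoothNear_apply_eq w
  rw [hcov.curvatureAt_eq hU hV hW, hcov.curvatureAt_eq hU' hV hW,
    ← hcov.curvatureField_add_left hU hU' hV hW, ← hcov.curvatureAt_eq (hU.add hU') hV hW]
  rfl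

lemma IsLeviCivita.curvatureAt_smul_left (hcov : IsLeviCivita cov) (c : ℝ)
    (u v w : TangentSpace (𝓡 3) x) :
    curvatureAt cov x (c • u) v w = c • curvatureAt cov x u v w := by
  obtain ⟨U, hU, rfl⟩ := exists_smoothNear_apply_eq u
  obtain ⟨V, hV, rfl⟩ := exists_smoothNear_apply_eq v
  obtain ⟨W, hW, rfl⟩ := exists_smoothNear_apply_eq w
  have hc := funSmoothNear_const c x
  rw [hcov.curvatureAt_eq hU hV hW, ← hcov.curvatureField_smul_left hc hU hV hW,
    ← hcov.curvatureAt_eq (SmoothNear.smul hc hU) hV hW]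
  rfl

lemma IsLeviCivita.curvatureAt_swap (hcov : IsLeviCivita cov) (u v w : TangentSpace (𝓡 3) x) :
    curvatureAt cov x u v w = -curvatureAt cov x v u w := by
  obtain ⟨U, hU, rfl⟩ := exists_smoothNear_apply_eq u
  obtain ⟨V, hV, rfl⟩ := exists_smoothNear_apply_eq v
  obtain ⟨W, hW, rfl⟩ := exists_smoothNear_apply_eq w
  rw [hcov.curvatureAt_eq hU hV hW, hcov.curvatureAt_eq hV hU hW, curvatureField_swap]

/-- The exterior derivative of the form `v ↦ ⟪∇_v W, Z⟫`. -/
lemma IsLeviCivita.inner_curvatureField (hcov : IsLeviCivita cov) {U V W Z : VField M}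
    (hU : SmoothNear U x) (hV : SmoothNear V x) (hW : SmoothNear W x) (hZ : SmoothNear Z x) :
    mvfderiv (𝓡 3) (fun y ↦ inner ℝ (cov W y (V y)) (Z y)) x (U x) -
      mvfderiv (𝓡 3) (fun y ↦ inner ℝ (cov W y (U y)) (Z y)) x (V x) -
      inner ℝ (cov W x (VectorField.mlieBracket (𝓡 3) U V x)) (Z x) =
    inner ℝ (curvatureAt cov x (U x) (V x) (W x)) (Z x) +
      inner ℝ (cov W x (V x)) (cov Z x (U x)) - inner ℝ (cov W x (U x)) (cov Z x (V x)) := by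
  rw [hcov.mvfderiv_inner (hcov.smoothNear hV hW) hZ,
    hcov.mvfderiv_inner (hcov.smoothNear hU hW) hZ, hcov.curvatureAt_eq hU hV hW, curvatureField,
    inner_sub_left, inner_sub_left]
  ring

/-- The relation `U V h - V U h = [U, V] h` for `h = ⟪W, Z⟫`, expanded by metric compatibility, is
the sum of two instances of `inner_curvatureField`, in which the products of first derivatives
cancel. -/
lemma IsLeviCivita.curvatureAt_skew (hcov : IsLeviCivita cov) (u v w z : TangentSpace (𝓡 3) x) :
    inner ℝ (curvatureAt cov x u v w) z = -inner ℝ (curvatureAt cov x u v z) w := by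
  obtain ⟨U, hU, rfl⟩ := exists_smoothNear_apply_eq u
  obtain ⟨V, hV, rfl⟩ := exists_smoothNear_apply_eq v
  obtain ⟨W, hW, rfl⟩ := exists_smoothNear_apply_eq w
  obtain ⟨Z, hZ, rfl⟩ := exists_smoothNear_apply_eq z
  have h1 := hcov.inner_curvatureField hU hV hW hZ
  have h2 := hcov.inner_curvatureField hU hV hZ hW
  have h3 := mvfderiv_mlieBracket hU hV (hW.inner hZ) ((hW.inner hZ).mvfderiv hV)
    ((hW.inner hZ).mvfderiv hU)
  have key {A B : VField M} (hA : SmoothNear A x) (hB : SmoothNear B x) :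
      mvfderiv (𝓡 3) (fun y ↦ mvfderiv (𝓡 3) (fun y ↦ inner ℝ (W y) (Z y)) y (A y)) x (B x) =
      mvfderiv (𝓡 3) (fun y ↦ inner ℝ (cov W y (A y)) (Z y)) x (B x) +
      mvfderiv (𝓡 3) (fun y ↦ inner ℝ (cov Z y (A y)) (W y)) x (B x) := by
    have e : (fun y ↦ mvfderiv (𝓡 3) (fun y ↦ inner ℝ (W y) (Z y)) y (A y)) =ᶠ[𝓝 x]
        (fun y ↦ inner ℝ (cov W y (A y)) (Z y) + inner ℝ (cov Z y (A y)) (W y)) := by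
      filter_upwards [hW.eventually, hZ.eventually] with y h1 h2
      rw [hcov.mvfderiv_inner h1 h2, real_inner_comm (W y)]
    have e2 : mvfderiv (𝓡 3) (fun y ↦ mvfderiv (𝓡 3) (fun y ↦ inner ℝ (W y) (Z y)) y (A y)) x =
        mvfderiv (𝓡 3) (fun y ↦ inner ℝ (cov W y (A y)) (Z y) + inner ℝ (cov Z y (A y)) (W y)) x :=
      e.mfderiv_eq
    rw [e2, mvfderiv_fun_add ((hcov.smoothNear hA hW).inner hZ).mdiffAt
      ((hcov.smoothNear hA hZ).inner hW).mdiffAt]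
    rfl
  rw [key hV hU, key hU hV, hcov.mvfderiv_inner hW hZ] at h3
  have c1 := real_inner_comm (W x) (cov Z x (VectorField.mlieBracket (𝓡 3) U V x))
  have c2 := real_inner_comm (cov W x (U x)) (cov Z x (V x))
  have c3 := real_inner_comm (cov W x (V x)) (cov Z x (U x))
  linarith

/-- The Ricci tensor may be computed in any orthonormal basis. -/
lemma IsLeviCivita.ricciAt_eq (hcov : IsLeviCivita cov) {b : Fin 3 → TangentSpace (𝓡 3) x}
    (hb : Orthonormal ℝ b) (v w : TangentSpace (𝓡 3) x) :
    ricciAt cov x v w = ∑ i, inner ℝ (curvatureAt cov x (b i) v w) (b i) := by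
  obtain ⟨B, rfl⟩ := hb.exists_orthonormalBasis_coe
  let L : TangentSpace (𝓡 3) x →ₗ[ℝ] TangentSpace (𝓡 3) x :=
    { toFun := fun u ↦ curvatureAt cov x u v w
      map_add' := fun u u' ↦ hcov.curvatureAt_add_left u u' v w
      map_smul' := fun c u ↦ hcov.curvatureAt_smul_left c u v w }
  have h1 := L.trace_eq_sum_inner (stdOrthonormalBasis ℝ (TangentSpace (𝓡 3) x))
  have h2 := L.trace_eq_sum_inner B
  rw [h1] at h2
  exact (Finset.sum_congr rfl fun i _ ↦ real_inner_comm _ _).trans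
    (h2.trans (Finset.sum_congr rfl fun i _ ↦ real_inner_comm _ _))

/-- The exterior derivative of the form `v ↦ ⟪e, v⟫`. -/
lemma IsLeviCivita.inner_cov_sub (hcov : IsLeviCivita cov) {e U V : VField M}
    (he : SmoothNear e x) (hU : SmoothNear U x) (hV : SmoothNear V x) :
    inner ℝ (cov e x (U x)) (V x) - inner ℝ (cov e x (V x)) (U x) =
      mvfderiv (𝓡 3) (fun y ↦ inner ℝ (e y) (V y)) x (U x) -
      mvfderiv (𝓡 3) (fun y ↦ inner ℝ (e y) (U y)) x (V x) -
      inner ℝ (e x) (VectorField.mlieBracket (𝓡 3) U V x) := by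
  rw [hcov.mvfderiv_inner he hV, hcov.mvfderiv_inner he hU, hcov.mlieBracket hU hV, inner_sub_right]
  ring

end CurvatureTensor

/-! ### Poincaré lemma, local and global. -/

section Poincare

variable {M : Type*} [TopologicalSpace M] [ChartedSpace E3 M] [IsManifold (𝓡 3) ∞ M]
  [RiemannianBundle (fun x : M ↦ TangentSpace (𝓡 3) x)]
  [IsContMDiffRiemannianBundle (𝓡 3) ∞ E3 (fun x : M ↦ TangentSpace (𝓡 3) x)]
  {cov : Connection M}

/-- A field with symmetric covariant derivative is a gradient near each point. -/
lemma IsLeviCivita.exists_potential_near (hcov : IsLeviCivita cov) {e : VField M} {x : M}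
    (he : SmoothNear e x)
    (hsym : ∀ᶠ y in 𝓝 x, ∀ u v, inner ℝ (cov e y u) v = inner ℝ (cov e y v) u) :
    ∃ h : M → ℝ, ∀ᶠ y in 𝓝 x, ContMDiffAt (𝓡 3) 𝓘(ℝ) ∞ h y ∧
      ∀ v, mvfderiv (𝓡 3) h y v = inner ℝ (e y) v := by
  obtain ⟨r, hr, hB⟩ := exists_ball_subset_chart x (he.eventually.and hsym)
  set φ := extChartAt (𝓡 3) x with hφ
  set B := Metric.ball (φ x) r
  let α : E3 → E3 →L[ℝ] ℝ := fun z ↦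
    (innerSL ℝ (e (φ.symm z))).comp (mfderiv 𝓘(ℝ, E3) (𝓡 3) φ.symm z)
  let k (v : E3) : M → ℝ := fun y ↦ inner ℝ (e y) (chartField x v y)
  have hαk (z) (hz : z ∈ B) (v : E3) : α z v = k v (φ.symm z) := by
    simp only [k, hφ, chartField_symm x (hB z hz).1]
    rfl
  have hk (z) (hz : z ∈ B) (v : E3) : FunSmoothNear (k v) (φ.symm z) :=
    (hB z hz).2.1.inner (smoothNear_chartField x v (φ.map_target (hB z hz).1))
  have hkd (z) (hz : z ∈ B) (v : E3) := hasFDerivAt_comp_extChartAt_symm x (hB z hz).1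
    (hk z hz v).mdiffAt
  have hα : ContDiffOn ℝ ∞ α B := by
    refine contDiffOn_clm_apply.2 fun v z hz ↦ ContDiffAt.contDiffWithinAt ?_
    have h1 : ContDiffAt ℝ ∞ (fun w ↦ k v (φ.symm w)) z :=
      contMDiffAt_iff_contDiffAt.1 ((hk z hz v).self_of_nhds.comp z
        (contMDiffAt_extChartAt_symm_target x (hB z hz).1))
    refine h1.congr_of_eventuallyEq ?_
    filter_upwards [Metric.isOpen_ball.mem_nhds hz] with w hw using hαk w hw v
  have hαd (z) (hz : z ∈ B) : DifferentiableAt ℝ α z :=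
    (hα.contDiffAt (Metric.isOpen_ball.mem_nhds hz)).differentiableAt (by simp)
  have hder (z) (hz : z ∈ B) (u v : E3) : fderiv ℝ α z u v =
      mvfderiv (𝓡 3) (k v) (φ.symm z) (chartField x u (φ.symm z)) := by
    have h1 : HasFDerivAt (fun w ↦ α w v) ((fderiv ℝ α z).flip v) z := by
      simpa using (hαd z hz).hasFDerivAt.clm_apply (hasFDerivAt_const v z)
    have h2 : HasFDerivAt (fun w ↦ α w v) _ z := (hkd z hz v).congr_of_eventuallyEq (by
      filter_upwards [Metric.isOpen_ball.mem_nhds hz] with w hw using hαk w hw v)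
    have h3 := congrArg (fun L : E3 →L[ℝ] ℝ ↦ L u) (h1.unique h2)
    exact h3.trans (congrArg _ (chartField_symm x (hB z hz).1 u).symm)
  -- The Poincaré lemma on a ball. Since coordinate fields commute, symmetry of `∇e` is exactly
  -- symmetry of the derivative of `α`.
  obtain ⟨H, hH⟩ := (convex_ball (φ x) r).exists_forall_hasFDerivAt_of_fderiv_symmetric
    Metric.isOpen_ball (fun z hz ↦ (hαd z hz).differentiableWithinAt) (fun z hz u v ↦ by
      have c (w : E3) := smoothNear_chartField x w (φ.map_target (hB z hz).1)
      rw [hder z hz, hder z hz, hcov.mvfderiv_inner (hB z hz).2.1 (c v),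
        hcov.mvfderiv_inner (hB z hz).2.1 (c u), (hB z hz).2.2]
      have := hcov.mlieBracket (c u) (c v)
      rw [mlieBracket_chartField x u v (φ.map_target (hB z hz).1)] at this
      rw [sub_eq_zero.1 this.symm])
  have hHs : ContDiffOn ℝ ∞ H B := by
    refine (contDiffOn_infty_iff_fderiv_of_isOpen Metric.isOpen_ball).2
      ⟨fun z hz ↦ (hH z hz).differentiableAt.differentiableWithinAt, ?_⟩
    exact hα.congr fun z hz ↦ (hH z hz).fderiv
  refine ⟨fun y ↦ H (φ y), ?_⟩
  filter_upwards [chart_preimage_ball_mem x hr] with y hy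
  have hHy : ContDiffAt ℝ ∞ H (φ y) := hHs.contDiffAt (Metric.isOpen_ball.mem_nhds hy.2)
  have hφy : ContMDiffAt (𝓡 3) 𝓘(ℝ, E3) ∞ φ y := contMDiffAt_extChartAt' (by simpa using hy.1)
  refine ⟨hHy.contMDiffAt.comp y hφy, fun v ↦ ?_⟩
  have h1 : HasMFDerivAt (𝓡 3) 𝓘(ℝ) (fun y ↦ H (φ y)) y _ :=
    (hH _ hy.2).hasMFDerivAt.comp y (hφy.mdifferentiableAt (by simp)).hasMFDerivAt
  have h2 : mvfderiv (𝓡 3) (fun y ↦ H (φ y)) y v =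
      α (φ y) (mfderiv (𝓡 3) 𝓘(ℝ, E3) φ y v) :=
    congrArg (fun L : TangentSpace (𝓡 3) y →L[ℝ] ℝ ↦ L v) h1.mfderiv
  rw [h2]
  change inner ℝ (e (φ.symm (φ y))) (mfderiv 𝓘(ℝ, E3) (𝓡 3) φ.symm (φ y)
    (mfderiv (𝓡 3) 𝓘(ℝ, E3) φ y v)) = _
  rw [mfderiv_extChartAt_symm_comp x hy.1]
  rw [φ.left_inv hy.1]

/-- On a simply connected manifold, a field with symmetric covariant derivative is a gradient. -/
lemma IsLeviCivita.exists_potential (hcov : IsLeviCivita cov) [SimplyConnectedSpace M]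
    {e : VField M} (he : ∀ x, SmoothNear e x)
    (hsym : ∀ x, ∀ u v, inner ℝ (cov e x u) v = inner ℝ (cov e x v) u) :
    ∃ h : M → ℝ, ContMDiff (𝓡 3) 𝓘(ℝ) ∞ h ∧
      ∀ x v, mvfderiv (𝓡 3) h x v = inner ℝ (e x) v := by
  have : LocallyPathConnectedSpace M := ChartedSpace.locallyPathConnectedSpace E3 M
  have x₀ : M := Classical.arbitrary M
  have key : ∃ h : M → ℝ, h x₀ = 0 ∧ ∀ x, ∀ᶠ y in 𝓝 x, ContMDiffAt (𝓡 3) 𝓘(ℝ) ∞ h y ∧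
      ∀ v, mvfderiv (𝓡 3) h y v = inner ℝ (e y) v := by
    -- Local potentials differ by constants, and adding a constant gives one any prescribed value at
    -- a prescribed point.
    refine exists_global_section (F := fun _ : M ↦ ℝ)
      (fun h x ↦ ∀ᶠ y in 𝓝 x, ContMDiffAt (𝓡 3) 𝓘(ℝ) ∞ h y ∧
        ∀ v, mvfderiv (𝓡 3) h y v = inner ℝ (e y) v) ?_ ?_ ?_ x₀ 0
    · intro s s' x hs hss'
      filter_upwards [hs, eventually_eventually_nhds.2 hss'] with y h1 h2
      have h3 : s' =ᶠ[𝓝 y] s := h2.mono fun z hz ↦ hz.symm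
      refine ⟨h1.1.congr_of_eventuallyEq h3, fun v ↦ ?_⟩
      rw [← h1.2 v]
      exact congrArg (fun L : TangentSpace (𝓡 3) y →L[ℝ] ℝ ↦ L v) h3.mfderiv_eq
    · intro s s' x hs hs'
      have := eventually_eq_of_mvfderiv_eq_zero (h := fun y ↦ s y - s' y) (x := x) (by
        filter_upwards [hs, hs'] with y h1 h2
        have d1 := h1.1.mdifferentiableAt (by simp)
        have d2 := h2.1.mdifferentiableAt (by simp)
        refine ⟨d1.sub d2, ?_⟩
        rw [mvfderiv_fun_sub d1 d2]
        ext v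
        exact sub_eq_zero.2 ((h1.2 v).trans (h2.2 v).symm))
      filter_upwards [this] with y hy
      rw [← sub_eq_zero, hy, sub_eq_zero]
    · intro x
      obtain ⟨h, hh⟩ := hcov.exists_potential_near (he x) (Filter.Eventually.of_forall hsym)
      refine ⟨_, eventually_eventually_nhds.2 hh, fun y hy c ↦ ⟨fun z ↦ h z + (c - h y), by ring,
        fun z hz ↦ ?_⟩⟩
      filter_upwards [hz] with w hw
      refine ⟨hw.1.add contMDiffAt_const, fun v ↦ ?_⟩
      rw [mvfderiv_fun_add (hw.1.mdifferentiableAt (by simp)) mdifferentiableAt_const,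
        mvfderiv_const, add_zero, hw.2]
  obtain ⟨h, -, hh⟩ := key
  exact ⟨h, fun x ↦ (hh x).self_of_nhds.1, fun x ↦ (hh x).self_of_nhds.2⟩

end Poincare
end

noncomputable section

/-! ### The rotation about `ξ` and the curvature of the orthogonal planes. -/

section ContactRotation

variable {M : Type*} [TopologicalSpace M] [ChartedSpace E3 M] [IsManifold (𝓡 3) ∞ M]

/-- The rotation `v ↦ -(2 / f) ∇_v ξ`. -/
def contactRotation (cov : Connection M) (f : ℝ) (ξ : VField M) (x : M) :
    TangentSpace (𝓡 3) x →L[ℝ] TangentSpace (𝓡 3) x := (-(2 / f)) • cov ξ x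

lemma cov_eq_contactRotation (cov : Connection M) {f : ℝ} (ξ : VField M) {x : M} (hf : 0 < f) (v : TangentSpace (𝓡 3) x) : cov ξ x v = (-(f / 2)) • contactRotation cov f ξ x v := by
  simp only [contactRotation, FunLike.coe_smul, Pi.smul_apply, smul_smul]
  field_simp
  simp

end ContactRotation

section ContactField

variable {M : Type*} [TopologicalSpace M] [ChartedSpace E3 M]
  [RiemannianBundle (fun x : M ↦ TangentSpace (𝓡 3) x)]

lemma orthonormal_cons {x : M} {a b c : TangentSpace (𝓡 3) x} (ha : ‖a‖ = 1) (hb : ‖b‖ = 1)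
    (hc : ‖c‖ = 1) (hab : inner ℝ a b = 0) (hac : inner ℝ a c = 0) (hbc : inner ℝ b c = 0) :
    Orthonormal ℝ ![a, b, c] := by
  refine ⟨fun i ↦ by fin_cases i <;> assumption, fun i j hij ↦ ?_⟩
  fin_cases i <;> fin_cases j <;> first | exact absurd rfl hij | skip
  · exact hab
  · exact hac
  · exact (real_inner_comm _ _).trans hab
  · exact hbc
  · exact (real_inner_comm _ _).trans hac
  · exact (real_inner_comm _ _).trans hbc

lemma exists_orthonormal_cons {x : M} {a b : TangentSpace (𝓡 3) x} (ha : ‖a‖ = 1) (hb : ‖b‖ = 1)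
    (hab : inner ℝ a b = 0) : ∃ c, Orthonormal ℝ ![a, b, c] := by
  have hc : finrank ℝ (TangentSpace (𝓡 3) x) = Fintype.card (Fin 3) := by
    rw [(Fact.out : finrank ℝ (TangentSpace (𝓡 3) x) = 3), Fintype.card_fin]
  obtain ⟨B, hB⟩ := Orthonormal.exists_orthonormalBasis_extension_of_card_eq (𝕜 := ℝ) hc
    (v := ![a, b, 0]) (s := {0, 1}) (by
      refine ⟨fun i ↦ ?_, fun i j hij ↦ ?_⟩
      · obtain ⟨i, rfl | rfl⟩ := i
        exacts [ha, hb]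
      · obtain ⟨i, rfl | rfl⟩ := i <;> obtain ⟨j, rfl | rfl⟩ := j
        · exact absurd rfl hij
        · exact hab
        · exact (real_inner_comm _ _).trans hab
        · exact absurd rfl hij)
  refine ⟨B 2, ?_⟩
  convert B.orthonormal using 1
  funext i
  fin_cases i
  exacts [(hB 0 (by simp)).symm, (hB 1 (by simp)).symm, rfl]

lemma exists_unit_orthogonal {x : M} {a : TangentSpace (𝓡 3) x} (ha : ‖a‖ = 1) :
    ∃ b, inner ℝ a b = 0 ∧ ‖b‖ = 1 := by
  have hc : finrank ℝ (TangentSpace (𝓡 3) x) = Fintype.card (Fin 3) := by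
    rw [(Fact.out : finrank ℝ (TangentSpace (𝓡 3) x) = 3), Fintype.card_fin]
  obtain ⟨B, hB⟩ := Orthonormal.exists_orthonormalBasis_extension_of_card_eq (𝕜 := ℝ) hc
    (v := ![a, 0, 0]) (s := {0}) (by
      refine ⟨fun i ↦ ?_, fun i j hij ↦ ?_⟩
      · obtain ⟨i, rfl⟩ := i
        exact ha
      · obtain ⟨i, rfl⟩ := i
        obtain ⟨j, rfl⟩ := j
        exact absurd rfl hij)
  have h0 : B 0 = a := hB 0 rfl
  exact ⟨B 1, by rw [← h0]; exact B.orthonormal.2 (by decide), B.orthonormal.1 1⟩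

lemma Orthonormal.eq_sum_cons {x : M} {a b c : TangentSpace (𝓡 3) x}
    (h : Orthonormal ℝ ![a, b, c]) (v : TangentSpace (𝓡 3) x) :
    v = inner ℝ a v • a + inner ℝ b v • b + inner ℝ c v • c := by
  have := h.eq_sum v
  rw [Fin.sum_univ_three] at this
  exact this

lemma Orthonormal.inner_eq_sum_cons {x : M} {a b c : TangentSpace (𝓡 3) x}
    (h : Orthonormal ℝ ![a, b, c]) (v w : TangentSpace (𝓡 3) x) :
    inner ℝ v w = inner ℝ a v * inner ℝ a w + inner ℝ b v * inner ℝ b w +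
      inner ℝ c v * inner ℝ c w := by
  conv_lhs => rw [h.eq_sum_cons v]
  simp only [inner_add_left, real_inner_smul_left]

variable [IsManifold (𝓡 3) ∞ M]

/-- A unit field `ξ` whose covariant derivative is skew and `f / 2` times an isometry of the
orthogonal complement of `ξ`, together with the Ricci condition. -/
structure IsContactField (cov : Connection M) (f : ℝ) (ξ : VField M) : Prop where
  smooth : ∀ x, SmoothNear ξ x
  unit : ∀ x, ‖ξ x‖ = 1
  skew : ∀ x v w, inner ℝ (cov ξ x v) w = -inner ℝ (cov ξ x w) v
  perp : ∀ x v, inner ℝ (cov ξ x v) (ξ x) = 0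
  norm : ∀ x v, inner ℝ (ξ x) v = 0 → ‖v‖ = 1 → ‖cov ξ x v‖ = f / 2
  ricci : ∀ (x : M) (v w : TangentSpace (𝓡 3) x),
      ricciAt cov x v w =
        f ^ 2 / 2 * (-inner ℝ v w + 2 * (inner ℝ (ξ x) v * inner ℝ (ξ x) w))

namespace IsContactField

variable {cov : Connection M} {f : ℝ} {ξ : VField M} {x : M}

local notation "J" => contactRotation cov f ξ

lemma rotation_skew (h : IsContactField cov f ξ) (v w : TangentSpace (𝓡 3) x) : inner ℝ (J x v) w = -inner ℝ v (J x w) := by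
  simp only [contactRotation, FunLike.coe_smul, Pi.smul_apply, real_inner_smul_left,
    real_inner_smul_right, h.skew x v w, real_inner_comm v]
  ring

lemma inner_rotation_self (h : IsContactField cov f ξ) (v : TangentSpace (𝓡 3) x) : inner ℝ v (J x v) = 0 := by
  have := h.rotation_skew v v
  rw [real_inner_comm] at this
  linarith

lemma inner_rotation (h : IsContactField cov f ξ) (v : TangentSpace (𝓡 3) x) : inner ℝ (ξ x) (J x v) = 0 := by
  rw [real_inner_comm]
  simp only [contactRotation, FunLike.coe_smul, Pi.smul_apply, real_inner_smul_left, h.perp,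
    mul_zero]

lemma rotation_norm (h : IsContactField cov f ξ) (hf : 0 < f) {v : TangentSpace (𝓡 3) x} (hv : inner ℝ (ξ x) v = 0)
    (hv1 : ‖v‖ = 1) : ‖J x v‖ = 1 := by
  simp only [contactRotation, FunLike.coe_smul, Pi.smul_apply, norm_smul, h.norm x v hv hv1]
  rw [norm_neg, Real.norm_of_nonneg (by positivity)]
  field_simp

lemma orthonormal (h : IsContactField cov f ξ) (hf : 0 < f) {v : TangentSpace (𝓡 3) x} (hv : inner ℝ (ξ x) v = 0)
    (hv1 : ‖v‖ = 1) : Orthonormal ℝ ![ξ x, v, J x v] :=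
  orthonormal_cons (h.unit x) hv1 (h.rotation_norm hf hv hv1) hv (h.inner_rotation v)
    (h.inner_rotation_self v)

/-- In the orthonormal basis `ξ`, `v`, `J v` the vector `J (J v)` has, as `J` is skew with values
orthogonal to `ξ`, only the `v`-component `-‖J v‖² = -1`. -/
lemma rotation_rotation (h : IsContactField cov f ξ) (hf : 0 < f) {v : TangentSpace (𝓡 3) x} (hv : inner ℝ (ξ x) v = 0)
    (hv1 : ‖v‖ = 1) : J x (J x v) = -v := by
  rw [(h.orthonormal hf hv hv1).eq_sum_cons (J x (J x v)), h.inner_rotation, h.inner_rotation_self,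
    real_inner_comm, h.rotation_skew, real_inner_self_eq_norm_sq, h.rotation_norm hf hv hv1]
  simp

lemma rotation_eq (h : IsContactField cov f ξ) (hf : 0 < f) {v : TangentSpace (𝓡 3) x} (hv : inner ℝ (ξ x) v = 0)
    (hv1 : ‖v‖ = 1) (u : TangentSpace (𝓡 3) x) :
    J x u = inner ℝ v u • J x v - inner ℝ (J x v) u • v := by
  have h1 : inner ℝ v (J x u) = -inner ℝ (J x v) u := by rw [h.rotation_skew, neg_neg]
  have h2 : inner ℝ (J x v) (J x u) = inner ℝ v u := by
    rw [← neg_neg (inner ℝ (J x v) (J x u)), ← h.rotation_skew, h.rotation_rotation hf hv hv1,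
      inner_neg_left, neg_neg]
  rw [(h.orthonormal hf hv hv1).eq_sum_cons (J x u), h.inner_rotation, h1, h2]
  module

lemma eventually_rotation (h : IsContactField cov f ξ) (hf : 0 < f) {a : VField M}
    (ha0 : ∀ᶠ y in 𝓝 x, inner ℝ (ξ y) (a y) = 0 ∧ ‖a y‖ = 1) :
    ∀ᶠ y in 𝓝 x, inner ℝ (ξ y) (J y (a y)) = 0 ∧ ‖J y (a y)‖ = 1 :=
  ha0.mono fun _ hy ↦ ⟨h.inner_rotation _, h.rotation_norm hf hy.1 hy.2⟩

variable [IsContMDiffRiemannianBundle (𝓡 3) ∞ E3 (fun x : M ↦ TangentSpace (𝓡 3) x)]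

lemma smoothNear_rotation (h : IsContactField cov f ξ) (hcov : IsLeviCivita cov) {V : VField M} (hV : SmoothNear V x) :
    SmoothNear (fun y ↦ J y (V y)) x :=
  (hcov.smoothNear hV (h.smooth x)).const_smul (-(2 / f))

/-- The curvature of the plane field orthogonal to `ξ`. -/
lemma inner_curvatureAt (h : IsContactField cov f ξ) (hcov : IsLeviCivita cov) (hf : 0 < f) {a : TangentSpace (𝓡 3) x}
    (ha : inner ℝ (ξ x) a = 0) (ha1 : ‖a‖ = 1) (u v : TangentSpace (𝓡 3) x) :
    inner ℝ (curvatureAt cov x u v a) (J x a) =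
      3 / 4 * f ^ 2 * (inner ℝ a u * inner ℝ (J x a) v - inner ℝ (J x a) u * inner ℝ a v) := by
  have hb := h.orthonormal hf ha ha1
  set b := J x a with hbdef
  have hab : inner ℝ a b = 0 := h.inner_rotation_self a
  have hξb : inner ℝ (ξ x) b = 0 := h.inner_rotation a
  have hb1 : ‖b‖ = 1 := h.rotation_norm hf ha ha1
  -- The Ricci condition as a trace in the basis `ξ`, `a`, `b`. Five of its components suffice to
  -- determine `⟪R(·, ·) a, b⟫`.
  have R (v w) : inner ℝ (curvatureAt cov x (ξ x) v w) (ξ x) +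
      inner ℝ (curvatureAt cov x a v w) a + inner ℝ (curvatureAt cov x b v w) b =
      f ^ 2 / 2 * (-inner ℝ v w + 2 * (inner ℝ (ξ x) v * inner ℝ (ξ x) w)) := by
    rw [← h.ricci, hcov.ricciAt_eq hb, Fin.sum_univ_three]
    rfl
  have sk := fun u v w z ↦ hcov.curvatureAt_skew (x := x) u v w z
  have sw (u v w z : TangentSpace (𝓡 3) x) : inner ℝ (curvatureAt cov x u v w) z =
      -inner ℝ (curvatureAt cov x v u w) z := by
    rw [hcov.curvatureAt_swap, inner_neg_left]
  have z1 (u w z : TangentSpace (𝓡 3) x) : inner ℝ (curvatureAt cov x u u w) z = 0 := by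
    linarith [sw u u w z]
  have z2 (u v w : TangentSpace (𝓡 3) x) : inner ℝ (curvatureAt cov x u v w) w = 0 := by
    linarith [sk u v w w]
  have nn (u : TangentSpace (𝓡 3) x) (hu : ‖u‖ = 1) : inner ℝ u u = (1 : ℝ) := by
    rw [real_inner_self_eq_norm_sq, hu, one_pow]
  have r1 := R (ξ x) (ξ x)
  have r2 := R a a
  have r3 := R b b
  have r4 := R (ξ x) b
  have r5 := R (ξ x) a
  simp only [z1, z2, nn _ (h.unit x), nn _ ha1, nn _ hb1, ha, hξb] at r1 r2 r3 r4 r5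
  -- An off-diagonal Ricci component reduces to a single curvature term, and `Ric(ξ, a) = Ric(ξ, b)
  -- = 0`.
  have k1 : inner ℝ (curvatureAt cov x (ξ x) a a) b = 0 := by
    rw [sk, sw]
    linarith
  have k2 : inner ℝ (curvatureAt cov x (ξ x) b a) b = 0 := by
    rw [sw]
    linarith
  -- The sectional curvature of the plane of `a` and `b` is `(Ric(a, a) + Ric(b, b) - Ric(ξ, ξ)) / 2
  -- = -(3/4) f²`, and `⟪R(a, b) a, b⟫` is its opposite.
  have k3 : inner ℝ (curvatureAt cov x a b a) b = 3 / 4 * f ^ 2 := by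
    have s1 := sk (ξ x) a a (ξ x)
    have s1' := sw (ξ x) a (ξ x) a
    have s2 := sk (ξ x) b b (ξ x)
    have s2' := sw (ξ x) b (ξ x) b
    have s3 := sk a b b a
    have s3' := sw a b a b
    linarith
  have add2 (u v v' w : TangentSpace (𝓡 3) x) : curvatureAt cov x u (v + v') w =
      curvatureAt cov x u v w + curvatureAt cov x u v' w := by
    rw [hcov.curvatureAt_swap, hcov.curvatureAt_add_left, neg_add, ← hcov.curvatureAt_swap,
      ← hcov.curvatureAt_swap]
  have smul2 (c : ℝ) (u v w : TangentSpace (𝓡 3) x) : curvatureAt cov x u (c • v) w =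
      c • curvatureAt cov x u v w := by
    rw [hcov.curvatureAt_swap, hcov.curvatureAt_smul_left, ← smul_neg, ← hcov.curvatureAt_swap]
  conv_lhs => rw [hb.eq_sum_cons u, hb.eq_sum_cons v]
  simp only [hcov.curvatureAt_add_left, hcov.curvatureAt_smul_left, add2, smul2, inner_add_left,
    real_inner_smul_left, z1, k1, k2, k3, sw a (ξ x), sw b (ξ x), sw b a]
  ring

end IsContactField

variable [IsContMDiffRiemannianBundle (𝓡 3) ∞ E3 (fun x : M ↦ TangentSpace (𝓡 3) x)]

/-- Skewness and orthogonality to `ξ` come from alternation of the volume form. For the norm,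
complete `ξ`, `a` to an orthonormal triple by `c`: then `∇_a ξ` is a multiple of `c` with
coefficient `±f / 2`, whatever the orientation. -/
lemma IsHeisenbergField.isContactField {o : ManifoldOrientation M} {f : ℝ} {ξ : VField M}
    (hf : 0 < f) (h : IsHeisenbergField o f ξ) :
    ∃ cov : Connection M, IsLeviCivita cov ∧ IsContactField cov f ξ := by
  obtain ⟨cov, hcov, h1, h2⟩ := h.equations
  have perp (x v) : inner ℝ (cov ξ x v) (ξ x) = 0 := by
    rw [h1, hodgeStarAt, AlternatingMap.map_eq_zero_of_eq _ _ (i := 0) (j := 2) rfl (by decide),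
      mul_zero]
  have skew (x v w) : inner ℝ (cov ξ x v) w = -inner ℝ (cov ξ x w) v := by
    have : (o.orient x).volumeForm ![ξ x, v, w] = -(o.orient x).volumeForm ![ξ x, w, v] := by
      have := (o.orient x).volumeForm.map_swap ![ξ x, w, v] (i := 1) (j := 2) (by decide)
      rw [← this]
      congr 1
      funext i
      fin_cases i <;> rfl
    rw [h1, h1, hodgeStarAt, hodgeStarAt, this]
    ring
  refine ⟨cov, hcov, fun x ↦ Filter.Eventually.of_forall fun y ↦ h.smooth y, h.unit, skew, perp,
    fun x a ha ha1 ↦ ?_, h2⟩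
  obtain ⟨c, hc⟩ := exists_orthonormal_cons (h.unit x) ha1 ha
  have e := hc.eq_sum_cons (cov ξ x a)
  have s0 : inner ℝ (cov ξ x a) a = 0 := by
    have := skew x a a
    linarith
  rw [real_inner_comm, perp, real_inner_comm, s0, zero_smul, zero_smul, zero_add, zero_add] at e
  obtain ⟨B, hB⟩ := hc.exists_orthonormalBasis_coe
  have hv := (o.orient x).abs_volumeForm_apply_of_orthonormal B
  rw [hB] at hv
  have hc1 : ‖c‖ = 1 := hc.1 2
  rw [e, norm_smul, hc1, mul_one, real_inner_comm, h1, hodgeStarAt, Real.norm_eq_abs, abs_mul, hv,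
    mul_one, abs_neg, abs_of_pos (half_pos hf)]

end ContactField
end

noncomputable section

/-! ### Derivatives of unit fields orthogonal to `ξ` and the closed connection form. -/

section Transport

variable {M : Type*} [TopologicalSpace M] [ChartedSpace E3 M]

lemma mvfderiv_comp_real {g : ℝ → ℝ} {g' : ℝ} {h : M → ℝ} {x : M} (hg : HasDerivAt g g' (h x))
    (hh : MDifferentiableAt (𝓡 3) 𝓘(ℝ) h x) (v : TangentSpace (𝓡 3) x) :
    mvfderiv (𝓡 3) (fun y ↦ g (h y)) x v = g' * mvfderiv (𝓡 3) h x v := by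
  have h1 : HasMFDerivAt (𝓡 3) 𝓘(ℝ) (fun y ↦ g (h y)) x _ :=
    hg.hasFDerivAt.hasMFDerivAt.comp x hh.hasMFDerivAt
  have h2 : mvfderiv (𝓡 3) (fun y ↦ g (h y)) x v = _ :=
    congrArg (fun L : TangentSpace (𝓡 3) x →L[ℝ] ℝ ↦ L v) h1.mfderiv
  rw [h2]
  exact mul_comm _ _

lemma mvfderiv_congr {h k : M → ℝ} {x : M} (e : ∀ᶠ y in 𝓝 x, h y = k y) :
    mvfderiv (𝓡 3) h x = mvfderiv (𝓡 3) k x :=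
  Filter.EventuallyEq.mfderiv_eq (I := 𝓡 3) (I' := 𝓘(ℝ)) e

lemma mvfderiv_add_apply {h k : M → ℝ} {x : M} (hh : MDifferentiableAt (𝓡 3) 𝓘(ℝ) h x)
    (hk : MDifferentiableAt (𝓡 3) 𝓘(ℝ) k x) (v : TangentSpace (𝓡 3) x) :
    mvfderiv (𝓡 3) (fun y ↦ h y + k y) x v = mvfderiv (𝓡 3) h x v + mvfderiv (𝓡 3) k x v := by
  rw [mvfderiv_fun_add hh hk]
  rfl

lemma mvfderiv_mul_apply {h k : M → ℝ} {x : M} (hh : MDifferentiableAt (𝓡 3) 𝓘(ℝ) h x)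
    (hk : MDifferentiableAt (𝓡 3) 𝓘(ℝ) k x) (v : TangentSpace (𝓡 3) x) :
    mvfderiv (𝓡 3) (fun y ↦ h y * k y) x v =
      h x * mvfderiv (𝓡 3) k x v + k x * mvfderiv (𝓡 3) h x v := by
  rw [mvfderiv_fun_mul hh hk]
  rfl

lemma mvfderiv_const_apply (c : ℝ) (x : M) (v : TangentSpace (𝓡 3) x) :
    mvfderiv (𝓡 3) (fun _ : M ↦ c) x v = 0 := by
  rw [mvfderiv_const]
  rfl

lemma mvfderiv_const_mul_apply {h : M → ℝ} {x : M} (c : ℝ)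
    (hh : MDifferentiableAt (𝓡 3) 𝓘(ℝ) h x) (v : TangentSpace (𝓡 3) x) :
    mvfderiv (𝓡 3) (fun y ↦ c * h y) x v = c * mvfderiv (𝓡 3) h x v := by
  rw [mvfderiv_mul_apply mdifferentiableAt_const hh, mvfderiv_const_apply, mul_zero, add_zero]

variable [IsManifold (𝓡 3) ∞ M]
  [RiemannianBundle (fun x : M ↦ TangentSpace (𝓡 3) x)]
  [IsContMDiffRiemannianBundle (𝓡 3) ∞ E3 (fun x : M ↦ TangentSpace (𝓡 3) x)]
  {cov : Connection M} {f : ℝ} {ξ : VField M} {x : M}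

local notation "J" => contactRotation cov f ξ

namespace IsContactField

/-- The derivative of a unit field orthogonal to `ξ`. -/
lemma cov_eq_of_orthogonal (h : IsContactField cov f ξ) (hcov : IsLeviCivita cov) (hf : 0 < f)
    {a : VField M} (ha : SmoothNear a x)
    (ha0 : ∀ᶠ y in 𝓝 x, inner ℝ (ξ y) (a y) = 0 ∧ ‖a y‖ = 1) (v : TangentSpace (𝓡 3) x) :
    cov a x v = inner ℝ (cov a x v) (J x (a x)) • J x (a x) -
      (f / 2 * inner ℝ (J x (a x)) v) • ξ x := by
  -- Differentiating `⟪ξ, a⟫ = 0` and `⟪a, a⟫ = 1` fixes the components of `∇_v a` along `ξ` and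
  -- `a`; only the one along `J a` stays free.
  have h1 := hcov.mvfderiv_inner (h.smooth x) ha v
  rw [mvfderiv_congr (k := fun _ ↦ 0) (ha0.mono fun y hy ↦ hy.1), mvfderiv_const_apply,
    cov_eq_contactRotation cov ξ hf, real_inner_smul_left, h.rotation_skew, real_inner_comm] at h1
  have h2 := hcov.mvfderiv_inner ha ha v
  rw [mvfderiv_congr (k := fun _ ↦ 1) (ha0.mono fun y hy ↦ by
    rw [real_inner_self_eq_norm_sq, hy.2, one_pow]), mvfderiv_const_apply, real_inner_comm] at h2
  have h3 : inner ℝ (a x) (cov a x v) = 0 := by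
    linarith
  have h4 : inner ℝ (ξ x) (cov a x v) = -(f / 2 * inner ℝ (J x (a x)) v) := by
    linarith
  conv_lhs => rw [(h.orthonormal hf ha0.self_of_nhds.1 ha0.self_of_nhds.2).eq_sum_cons (cov a x v),
    h3, h4, real_inner_comm (cov a x v) (J x (a x))]
  module

/-- Apply `cov_eq_of_orthogonal` to `J a`, using `J (J a) = -a` and the derivative of `⟪a, J a⟫ =
0`. -/
lemma cov_rotation (h : IsContactField cov f ξ) (hcov : IsLeviCivita cov) (hf : 0 < f)
    {a : VField M} (ha : SmoothNear a x)
    (ha0 : ∀ᶠ y in 𝓝 x, inner ℝ (ξ y) (a y) = 0 ∧ ‖a y‖ = 1) (v : TangentSpace (𝓡 3) x) :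
    cov (fun y ↦ J y (a y)) x v = -inner ℝ (cov a x v) (J x (a x)) • a x +
      (f / 2 * inner ℝ (a x) v) • ξ x := by
  have hb := h.smoothNear_rotation hcov ha
  have h0 := ha0.self_of_nhds
  have h1 := hcov.mvfderiv_inner ha hb v
  rw [mvfderiv_congr (k := fun _ ↦ 0) (ha0.mono fun y hy ↦ h.inner_rotation_self _),
    mvfderiv_const_apply, real_inner_comm _ (a x)] at h1
  have h2 : inner ℝ (cov (fun y ↦ J y (a y)) x v) (a x) = -inner ℝ (cov a x v) (J x (a x)) := by
    linarith
  rw [h.cov_eq_of_orthogonal hcov hf hb (h.eventually_rotation hf ha0),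
    h.rotation_rotation hf h0.1 h0.2, inner_neg_right, h2, inner_neg_left]
  module

/-- The form `v ↦ ⟪∇_v a, J a⟫ + f / 2 ⟪ξ, v⟫` is closed. -/
lemma exists_angle (h : IsContactField cov f ξ) (hcov : IsLeviCivita cov) (hf : 0 < f)
    {a : VField M} (ha : SmoothNear a x)
    (ha0 : ∀ᶠ y in 𝓝 x, inner ℝ (ξ y) (a y) = 0 ∧ ‖a y‖ = 1) :
    ∃ φ : M → ℝ, ∀ᶠ y in 𝓝 x, ContMDiffAt (𝓡 3) 𝓘(ℝ) ∞ φ y ∧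
      ∀ v, mvfderiv (𝓡 3) φ y v =
        -(inner ℝ (cov a y v) (J y (a y)) + f / 2 * inner ℝ (ξ y) v) := by
  let b : VField M := fun y ↦ J y (a y)
  have hb : SmoothNear b x := h.smoothNear_rotation hcov ha
  let w (V : VField M) : M → ℝ := fun y ↦
    -(inner ℝ (cov a y (V y)) (b y) + f / 2 * inner ℝ (ξ y) (V y))
  have hw {V : VField M} {y : M} (ha : SmoothNear a y) (hb : SmoothNear b y) (hV : SmoothNear V y) :
      FunSmoothNear (w V) y :=
    (((funSmoothNear_const 0 y).sub (((hcov.smoothNear hV ha).inner hb).add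
      ((funSmoothNear_const (f / 2) y).mul ((h.smooth y).inner hV)))).congr
      (Filter.Eventually.of_forall fun z ↦ by simp only [w, zero_sub]))
  -- The field dual to the form `w`, as needed for `exists_potential_near`.
  let e : VField M := w ξ • ξ + w a • a + w b • b
  have he : SmoothNear e x := ((SmoothNear.smul (hw ha hb (h.smooth x)) (h.smooth x)).add
    (SmoothNear.smul (hw ha hb ha) ha)).add (SmoothNear.smul (hw ha hb hb) hb)
  have hinner (V : VField M) (y) (hy : inner ℝ (ξ y) (a y) = 0 ∧ ‖a y‖ = 1) :
      inner ℝ (e y) (V y) = w V y := by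
    have ho := h.orthonormal hf hy.1 hy.2
    have h1 : w V y = inner ℝ (ξ y) (V y) * w ξ y + inner ℝ (a y) (V y) * w a y +
        inner ℝ (b y) (V y) * w b y := by
      simp only [w]
      conv_lhs => rw [ho.eq_sum_cons (V y)]
      simp only [map_add, map_smul, inner_add_left, inner_add_right, real_inner_smul_left,
        real_inner_smul_right, b]
      ring
    rw [h1]
    simp only [e, Pi.add_apply, Pi.smul_apply', inner_add_left, real_inner_smul_left]
    ring
  obtain ⟨φ, hφ⟩ := hcov.exists_potential_near he (by
    filter_upwards [he.eventually, ha.eventually, hb.eventually,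
      eventually_eventually_nhds.2 ha0] with y he ha hb hy u v
    obtain ⟨U, hU, rfl⟩ := exists_smoothNear_apply_eq u
    obtain ⟨V, hV, rfl⟩ := exists_smoothNear_apply_eq v
    have hy0 := hy.self_of_nhds
    have ho := h.orthonormal hf hy0.1 hy0.2
    have der {A B : VField M} (hA : SmoothNear A y) (hB : SmoothNear B y) :
        mvfderiv (𝓡 3) (fun z ↦ inner ℝ (e z) (A z)) y (B y) =
        -(mvfderiv (𝓡 3) (fun z ↦ inner ℝ (cov a z (A z)) (b z)) y (B y) +
          f / 2 * mvfderiv (𝓡 3) (fun z ↦ inner ℝ (ξ z) (A z)) y (B y)) := by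
      have d1 := ((hcov.smoothNear hA ha).inner hb).mdiffAt
      have d2 := ((h.smooth y).inner hA).mdiffAt
      have e1 : mvfderiv (𝓡 3) (fun z ↦ inner ℝ (e z) (A z)) y =
          mvfderiv (𝓡 3) (fun z ↦ -1 * (inner ℝ (cov a z (A z)) (b z) +
            f / 2 * inner ℝ (ξ z) (A z))) y :=
        mvfderiv_congr (hy.mono fun z hz ↦ by rw [hinner A z hz]; simp only [w]; ring)
      have d3 : MDifferentiableAt (𝓡 3) 𝓘(ℝ) (fun z ↦ f / 2 * inner ℝ (ξ z) (A z)) y :=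
        mdifferentiableAt_const.mul d2
      have d4 : MDifferentiableAt (𝓡 3) 𝓘(ℝ) (fun z ↦ inner ℝ (cov a z (A z)) (b z) +
          f / 2 * inner ℝ (ξ z) (A z)) y := d1.add d3
      rw [e1, mvfderiv_const_mul_apply _ d4, mvfderiv_add_apply d1 d3,
        mvfderiv_const_mul_apply _ d2]
      ring
    rw [← sub_eq_zero, hcov.inner_cov_sub he hU hV, der hV hU, der hU hV]
    have hB : inner ℝ (e y) (VectorField.mlieBracket (𝓡 3) U V y) =
      w (VectorField.mlieBracket (𝓡 3) U V) y := hinner _ _ hy0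
    -- The exterior derivative of `⟪∇ a, b⟫` is `(3/4) f² a ∧ b` from the curvature, plus `-(1/4) f²
    -- a ∧ b` from the `ξ`-components of `∇ a` and `∇ b`. That of `(f/2) ξ` is `-(f²/2) a ∧ b`, so
    -- the sum vanishes.
    have i1 := hcov.inner_curvatureField hU hV ha hb
    have i2 := hcov.inner_cov_sub (h.smooth y) hU hV
    rw [hB]
    simp only [w]
    have i3 := h.inner_curvatureAt hcov hf hy0.1 hy0.2 (U y) (V y)
    rw [cov_eq_contactRotation cov ξ hf, cov_eq_contactRotation cov ξ hf,
      h.rotation_eq hf hy0.1 hy0.2 (U y), h.rotation_eq hf hy0.1 hy0.2 (V y)] at i2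
    rw [h.cov_rotation hcov hf ha hy, h.cov_rotation hcov hf ha hy,
      h.cov_eq_of_orthogonal hcov hf ha hy (U y), h.cov_eq_of_orthogonal hcov hf ha hy (V y)] at i1
    have n2 : inner ℝ (ξ y) (J y (a y)) = 0 := h.inner_rotation _
    have n4 : inner ℝ (J y (a y)) (J y (a y)) = (1 : ℝ) := by
      rw [real_inner_self_eq_norm_sq, h.rotation_norm hf hy0.1 hy0.2, one_pow]
    have n5 : inner ℝ (ξ y) (ξ y) = (1 : ℝ) := by
      rw [real_inner_self_eq_norm_sq, h.unit, one_pow]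
    have n6 : inner ℝ (J y (a y)) (a y) = 0 := (real_inner_comm _ _).trans (h.inner_rotation_self _)
    have n7 : inner ℝ (J y (a y)) (ξ y) = 0 := (real_inner_comm _ _).trans n2
    simp only [inner_sub_left, inner_add_right, real_inner_smul_left, real_inner_smul_right,
      n2, n4, n5, n6, n7, hy0.1, b]
      at i1 i2 ⊢
    linear_combination -i1 + (f / 2) * i2 - i3)
  refine ⟨φ, ?_⟩
  filter_upwards [hφ, ha0] with y hy hy0
  refine ⟨hy.1, fun v ↦ ?_⟩
  obtain ⟨V, hV, rfl⟩ := exists_smoothNear_apply_eq v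
  rw [hy.2, hinner V y hy0]

end IsContactField

end Transport
end

noncomputable section

/-! ### Local and global turning fields. -/

section GlobalFrame

lemma exists_cos_sin {p q : ℝ} (h : p ^ 2 + q ^ 2 = 1) :
    ∃ t : ℝ, Real.cos t = p ∧ Real.sin t = q := by
  have h1 : ‖(⟨p, q⟩ : ℂ)‖ = 1 := by
    rw [Complex.norm_def, Complex.normSq_mk, ← sq, ← sq, h, Real.sqrt_one]
  refine ⟨Complex.arg ⟨p, q⟩, ?_, ?_⟩
  · rw [Complex.cos_arg (by rw [← norm_ne_zero_iff, h1]; exact one_ne_zero), h1, div_one]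
  · rw [Complex.sin_arg, h1, div_one]

variable {M : Type*} [TopologicalSpace M] [ChartedSpace E3 M] [IsManifold (𝓡 3) ∞ M]
  [RiemannianBundle (fun x : M ↦ TangentSpace (𝓡 3) x)]

/-- A unit field `u` orthogonal to `ξ`, turning around `ξ` at the rate `-f / 2`, near `x`. -/
structure IsTurningNear (cov : Connection M) (f : ℝ) (ξ u : VField M) (x : M) : Prop where
  smooth : SmoothNear u x
  unit : ∀ᶠ y in 𝓝 x, inner ℝ (ξ y) (u y) = 0 ∧ ‖u y‖ = 1
  turning : ∀ᶠ y in 𝓝 x, ∀ v, inner ℝ (cov u y v) (contactRotation cov f ξ y (u y)) =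
    -(f / 2) * inner ℝ (ξ y) v

lemma IsTurningNear.eventually {cov : Connection M} {f : ℝ} {ξ u : VField M} {x : M}
    (h : IsTurningNear cov f ξ u x) : ∀ᶠ y in 𝓝 x, IsTurningNear cov f ξ u y := by
  filter_upwards [h.smooth.eventually, eventually_eventually_nhds.2 h.unit,
    eventually_eventually_nhds.2 h.turning] with y h1 h2 h3 using ⟨h1, h2, h3⟩

variable {cov : Connection M} {f : ℝ} {ξ : VField M} {x : M}

local notation "J" => contactRotation cov f ξ

lemma IsTurningNear.congr {u u' : VField M} (h : IsTurningNear cov f ξ u x)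
    (e : ∀ᶠ y in 𝓝 x, u y = u' y) : IsTurningNear cov f ξ u' x := by
  refine ⟨h.smooth.congr e, ?_, ?_⟩
  · filter_upwards [h.unit, e] with y h1 h2
    rwa [← h2]
  · filter_upwards [h.turning, h.smooth.eventually, eventually_eventually_nhds.2 e]
      with y h1 h2 h3 v
    rw [← h1 v, cov_congr h2 h3, h3.self_of_nhds]

variable [IsContMDiffRiemannianBundle (𝓡 3) ∞ E3 (fun x : M ↦ TangentSpace (𝓡 3) x)]

namespace IsContactField

lemma cov_turning (h : IsContactField cov f ξ) (hcov : IsLeviCivita cov) (hf : 0 < f)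
    {u : VField M} (hu : IsTurningNear cov f ξ u x) (v : TangentSpace (𝓡 3) x) :
    cov u x v = -(f / 2 * inner ℝ (ξ x) v) • J x (u x) - (f / 2 * inner ℝ (J x (u x)) v) • ξ x := by
  rw [h.cov_eq_of_orthogonal hcov hf hu.smooth hu.unit, hu.turning.self_of_nhds]
  module

/-- Two turning fields keep their angle. -/
lemma turning_unique (h : IsContactField cov f ξ) (hcov : IsLeviCivita cov) (hf : 0 < f)
    {u u' : VField M} (hu : IsTurningNear cov f ξ u x) (hu' : IsTurningNear cov f ξ u' x) :
    ∀ᶠ y in 𝓝 x, (u y = u' y ↔ u x = u' x) := by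
  -- The derivative of `⟪u, u'⟫` along `v` is `-(f/2) ⟪ξ, v⟫ (⟪J u, u'⟫ + ⟪u, J u'⟫) = 0`. Unit
  -- vectors coincide exactly when their product is `1`, so a constant product gives the
  -- equivalence.
  have h1 : ∀ᶠ y in 𝓝 x, inner ℝ (u y) (u' y) = inner ℝ (u x) (u' x) := by
    refine eventually_eq_of_mvfderiv_eq_zero (h := fun y ↦ inner ℝ (u y) (u' y)) ?_
    filter_upwards [hu.eventually, hu'.eventually] with y h1 h2
    refine ⟨(h1.smooth.inner h2.smooth).mdiffAt, ?_⟩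
    ext v
    rw [hcov.mvfderiv_inner h1.smooth h2.smooth, h.cov_turning hcov hf h1,
      h.cov_turning hcov hf h2]
    have e1 := h.rotation_skew (u y) (u' y)
    have e2 := (real_inner_comm (ξ y) (u y)).trans h1.unit.self_of_nhds.1
    simp only [inner_sub_left, inner_sub_right, real_inner_smul_left, real_inner_smul_right,
      e1, h2.unit.self_of_nhds.1, e2]
    change _ = (0 : ℝ)
    ring
  filter_upwards [h1, hu.unit, hu'.unit] with y hy h2 h3
  rw [← inner_eq_one_iff_of_norm_eq_one (𝕜 := ℝ) h2.2 h3.2,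
    ← inner_eq_one_iff_of_norm_eq_one (𝕜 := ℝ) hu.unit.self_of_nhds.2 hu'.unit.self_of_nhds.2, hy]

/-- Turning fields with prescribed value exist locally. -/
lemma exists_turning_near (h : IsContactField cov f ξ) (hcov : IsLeviCivita cov) (hf : 0 < f)
    (x : M) : ∃ U ∈ 𝓝 x, ∀ y ∈ U, ∀ c : TangentSpace (𝓡 3) y, inner ℝ (ξ y) c = 0 → ‖c‖ = 1 →
      ∃ u : VField M, u y = c ∧ ∀ z ∈ U, IsTurningNear cov f ξ u z := by
  obtain ⟨a₀, ha₀, ha₁⟩ := exists_unit_orthogonal (h.unit x)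
  obtain ⟨c₀, hc₀⟩ := exists_orthonormal_cons (h.unit x) ha₁ ha₀
  -- As `ξ` has unit length it remains the first member of the frame, so that `e 1` is orthogonal to
  -- it near `x`.
  obtain ⟨e, -, he2, he3, he4⟩ := exists_orthonormal_frame
    (s := ![ξ, FiberBundle.extend E3 a₀, FiberBundle.extend E3 c₀]) (x := x) (fun i ↦ by
      fin_cases i
      exacts [h.smooth x, smoothNear_extend _, smoothNear_extend _]) (by
      convert hc₀ using 1
      funext i
      fin_cases i
      exacts [rfl, FiberBundle.extend_apply_self .., FiberBundle.extend_apply_self ..])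
  let a := e 1
  have ha : SmoothNear a x := he2 1
  have ha0 : ∀ᶠ y in 𝓝 x, inner ℝ (ξ y) (a y) = 0 ∧ ‖a y‖ = 1 := by
    filter_upwards [he3] with y hy
    refine ⟨?_, hy.1 1⟩
    have h1 : inner ℝ (e 0 y) (e 1 y) = 0 := hy.2 (by decide)
    have h2 : e 0 y = ‖ξ y‖⁻¹ • ξ y := he4 y
    rwa [h2, h.unit, inv_one, one_smul] at h1
  obtain ⟨φ, hφ⟩ := h.exists_angle hcov hf ha ha0
  let b : VField M := fun y ↦ J y (a y)
  refine ⟨_, eventually_eventually_nhds.2 ((ha.eventually.and (eventually_eventually_nhds.2 ha0)).and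
    (eventually_eventually_nhds.2 hφ)), fun y hy c hc hc1 ↦ ?_⟩
  have hy0 := hy.self_of_nhds.1.2.self_of_nhds
  have ho := h.orthonormal hf hy0.1 hy0.2
  obtain ⟨t, ht1, ht2⟩ : ∃ t, Real.cos t = inner ℝ (a y) c ∧ Real.sin t = inner ℝ (b y) c := by
    apply exists_cos_sin
    have := ho.inner_eq_sum_cons c c
    rw [hc, real_inner_self_eq_norm_sq, hc1] at this
    linear_combination -this
  -- The primitive `φ` is fixed; only the additive constant depends on `y` and `c`. Hence one
  -- neighbourhood serves all initial values.
  let ψ : M → ℝ := fun z ↦ φ z + (t - φ y)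
  let C : M → ℝ := fun z ↦ Real.cos (ψ z)
  let S : M → ℝ := fun z ↦ Real.sin (ψ z)
  refine ⟨C • a + S • b, ?_, fun z hz ↦ ?_⟩
  · have h1 := ho.eq_sum_cons c
    rw [hc, zero_smul, zero_add, ← ht1] at h1
    rw [h1]
    simp only [Pi.add_apply, Pi.smul_apply', C, S, ψ, add_sub_cancel, ht2, b]
  · have hψ {w} (hw : ∀ᶠ y in 𝓝 w, ContMDiffAt (𝓡 3) 𝓘(ℝ) ∞ φ y ∧ ∀ v, mvfderiv (𝓡 3) φ y v =
        -(inner ℝ (cov a y v) (J y (a y)) + f / 2 * inner ℝ (ξ y) v)) : FunSmoothNear ψ w :=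
      FunSmoothNear.add (hw.mono fun _ h ↦ h.1) (funSmoothNear_const _ w)
    have hC {w} (hw : FunSmoothNear ψ w) : FunSmoothNear C w :=
      FunSmoothNear.comp (.of_forall fun _ ↦ Real.contDiff_cos.contDiffAt) hw
    have hS {w} (hw : FunSmoothNear ψ w) : FunSmoothNear S w :=
      FunSmoothNear.comp (.of_forall fun _ ↦ Real.contDiff_sin.contDiffAt) hw
    have hz0 := hz.self_of_nhds
    have sm {w} (hw : ((SmoothNear a w) ∧ ∀ᶠ y in 𝓝 w, inner ℝ (ξ y) (a y) = 0 ∧ ‖a y‖ = 1) ∧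
        ∀ᶠ y in 𝓝 w, ContMDiffAt (𝓡 3) 𝓘(ℝ) ∞ φ y ∧ ∀ v, mvfderiv (𝓡 3) φ y v =
        -(inner ℝ (cov a y v) (J y (a y)) + f / 2 * inner ℝ (ξ y) v)) :
        SmoothNear (C • a) w ∧ SmoothNear (S • b) w :=
      ⟨SmoothNear.smul (hC (hψ hw.2)) hw.1.1,
        SmoothNear.smul (hS (hψ hw.2)) (h.smoothNear_rotation hcov hw.1.1)⟩
    refine ⟨(sm hz0).1.add (sm hz0).2, ?_, ?_⟩
    · filter_upwards [hz0.1.2] with w hw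
      have ho := h.orthonormal hf hw.1 hw.2
      have n1 : inner ℝ (a w) (b w) = 0 := h.inner_rotation_self _
      have n2 : inner ℝ (ξ w) (b w) = 0 := h.inner_rotation _
      have n3 : inner ℝ (b w) (b w) = (1 : ℝ) := by
        rw [real_inner_self_eq_norm_sq, h.rotation_norm hf hw.1 hw.2, one_pow]
      have n4 : inner ℝ (a w) (a w) = (1 : ℝ) := by
        rw [real_inner_self_eq_norm_sq, hw.2, one_pow]
      refine ⟨?_, ?_⟩
      · simp only [Pi.add_apply, Pi.smul_apply', inner_add_right, real_inner_smul_right, hw.1, n2,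
          mul_zero, add_zero]
      · rw [← sq_eq_sq₀ (norm_nonneg _) zero_le_one, ← real_inner_self_eq_norm_sq]
        simp only [Pi.add_apply, Pi.smul_apply', inner_add_right, real_inner_smul_right,
          inner_add_left, real_inner_smul_left, n1, real_inner_comm (a w) (b w),
          n3, n4]
        have := Real.cos_sq_add_sin_sq (ψ w)
        simp only [C, S]
        linear_combination this
    -- Rotation by the angle `ψ` adds `dψ` to the connection form `⟪∇ a, J a⟫`, and `dψ = dφ` was
    -- chosen to leave `-(f/2) ξ`.
    · filter_upwards [hz] with w hw v
      have hw0 := hw.1.2.self_of_nhds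
      have ho := h.orthonormal hf hw0.1 hw0.2
      have hψw := hψ hw.2
      have dC : mvfderiv (𝓡 3) C w v = -S w * mvfderiv (𝓡 3) ψ w v :=
        mvfderiv_comp_real (Real.hasDerivAt_cos _) hψw.mdiffAt v
      have dS : mvfderiv (𝓡 3) S w v = C w * mvfderiv (𝓡 3) ψ w v :=
        mvfderiv_comp_real (Real.hasDerivAt_sin _) hψw.mdiffAt v
      have dψ : mvfderiv (𝓡 3) ψ w v =
          -(inner ℝ (cov a w v) (J w (a w)) + f / 2 * inner ℝ (ξ w) v) := by
        have := mvfderiv_add_apply (h := φ) (k := fun _ ↦ t - φ y) (x := w)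
          (hw.2.self_of_nhds.1.mdifferentiableAt (by simp)) mdifferentiableAt_const v
        rw [mvfderiv_const_apply, add_zero, hw.2.self_of_nhds.2] at this
        exact this
      have hJ : J w ((C • a + S • b) w) = C w • b w - S w • a w := by
        simp only [Pi.add_apply, Pi.smul_apply', map_add, map_smul, b,
          h.rotation_rotation hf hw0.1 hw0.2]
        module
      rw [hJ, cov_add (sm hw).1 (sm hw).2, cov_smul (hC hψw) hw.1.1,
        cov_smul (hS hψw) (h.smoothNear_rotation hcov hw.1.1), dC, dS, dψ,
        h.cov_rotation hcov hf hw.1.1 hw.1.2 v]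
      have n1 : inner ℝ (a w) (b w) = 0 := h.inner_rotation_self _
      have n2 : inner ℝ (ξ w) (b w) = 0 := h.inner_rotation _
      have n3 : inner ℝ (b w) (b w) = (1 : ℝ) := by
        rw [real_inner_self_eq_norm_sq, h.rotation_norm hf hw0.1 hw0.2, one_pow]
      have n4 : inner ℝ (a w) (a w) = (1 : ℝ) := by
        rw [real_inner_self_eq_norm_sq, hw0.2, one_pow]
      have n5 : inner ℝ (b w) (a w) = 0 := (real_inner_comm _ _).trans n1
      have n6 : inner ℝ (cov a w v) (a w) = 0 := by
        rw [h.cov_eq_of_orthogonal hcov hf hw.1.1 hw.1.2, inner_sub_left, real_inner_smul_left,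
          real_inner_smul_left, hw0.1]
        have : inner ℝ (J w (a w)) (a w) = 0 := n5
        rw [this]
        ring
      have e : C w ^ 2 + S w ^ 2 = 1 := Real.cos_sq_add_sin_sq (ψ w)
      simp only [inner_add_left, inner_sub_right, real_inner_smul_left, real_inner_smul_right,
        hw0.1, n2]
      change _ = -(f / 2) * inner ℝ (ξ w) v
      have k : J w (a w) = b w := rfl
      simp only [k, n1, n3, n4, n5, n6]
      linear_combination (-(f / 2) * inner ℝ (ξ w) v) * e

/-- On a simply connected manifold there is a global turning field. -/
lemma exists_turning (h : IsContactField cov f ξ) (hcov : IsLeviCivita cov) (hf : 0 < f)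
    [SimplyConnectedSpace M] : ∃ u : VField M, ∀ x, IsTurningNear cov f ξ u x := by
  classical
  have : LocallyPathConnectedSpace M := ChartedSpace.locallyPathConnectedSpace E3 M
  have x₀ : M := Classical.arbitrary M
  let F (x : M) : Type := {c : TangentSpace (𝓡 3) x // inner ℝ (ξ x) c = 0 ∧ ‖c‖ = 1}
  have c₀ (x : M) : F x := ⟨_, (exists_unit_orthogonal (h.unit x)).choose_spec⟩
  have key : ∃ s : Π x, F x, s x₀ = c₀ x₀ ∧ ∀ x, IsTurningNear cov f ξ (fun y ↦ (s y).1) x := by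
    refine exists_global_section (F := F) (fun s x ↦ IsTurningNear cov f ξ (fun y ↦ (s y).1) x)
      (fun s s' x hs hss' ↦ hs.congr (hss'.mono fun y hy ↦ congrArg _ hy))
      (fun s s' x hs hs' ↦ ?_) (fun x ↦ ?_) x₀ (c₀ x₀)
    · exact (h.turning_unique hcov hf hs hs').mono fun y hy ↦
        (Subtype.ext_iff.trans hy).trans Subtype.ext_iff.symm
    · obtain ⟨U, hU, hUc⟩ := h.exists_turning_near hcov hf x
      refine ⟨U, hU, fun y hy c ↦ ?_⟩
      obtain ⟨u, hu1, hu2⟩ := hUc y hy c.1 c.2.1 c.2.2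
      -- The value `c₀` is a mere default: near every point of `U` the field `u` is unit and
      -- orthogonal to `ξ`.
      let s (z : M) : F z := if hz : inner ℝ (ξ z) (u z) = 0 ∧ ‖u z‖ = 1 then ⟨u z, hz⟩ else c₀ z
      have hs (z : M) (hz : inner ℝ (ξ z) (u z) = 0 ∧ ‖u z‖ = 1) : u z = (s z).1 := by
        simp only [s, dif_pos hz]
      refine ⟨s, Subtype.ext ?_, fun z hz ↦ (hu2 z hz).congr ?_⟩
      · rw [← hs y (by rw [hu1]; exact c.2), hu1]
      · filter_upwards [(hu2 z hz).unit] with w hw using hs w hw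
  obtain ⟨s, -, hs⟩ := key
  exact ⟨_, hs⟩

end IsContactField

end GlobalFrame
end

noncomputable section

/-! ### Inverse function theorem on manifolds. -/

section InverseFunction

variable {M : Type*} [TopologicalSpace M] [ChartedSpace E3 M] [IsManifold (𝓡 3) ∞ M]

/-- The inverse function theorem on a manifold. -/
lemma exists_openPartialHomeomorph_of_isInvertible {Φ : M → E3}
    (hΦ : ContMDiff (𝓡 3) 𝓘(ℝ, E3) ∞ Φ)
    (hinv : ∀ p, (mfderiv (𝓡 3) 𝓘(ℝ, E3) Φ p).IsInvertible) (p : M) :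
    ∃ e : OpenPartialHomeomorph M E3, p ∈ e.source ∧ Set.EqOn Φ e e.source ∧
      ∀ z ∈ e.target, ContMDiffAt 𝓘(ℝ, E3) (𝓡 3) ∞ e.symm z := by
  let A := chartAt E3 p
  let Ψ : E3 → E3 := fun z ↦ Φ (A.symm z)
  have hA (z) (hz : z ∈ A.target) : ContMDiffAt 𝓘(ℝ, E3) (𝓡 3) ∞ A.symm z := by
    have := contMDiffAt_extChartAt_symm_target p (z := z) (by simpa using hz)
    simpa using this
  have hΨ (z) (hz : z ∈ A.target) : ContDiffAt ℝ ∞ Ψ z :=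
    contMDiffAt_iff_contDiffAt.1 ((hΦ _).comp z (hA z hz))
  have hder (z) (hz : z ∈ A.target) : ∃ L : E3 ≃L[ℝ] E3, HasFDerivAt Ψ (L : E3 →L[ℝ] E3) z := by
    have h1 : (mfderiv 𝓘(ℝ, E3) (𝓡 3) A.symm z).IsInvertible := by
      have := isInvertible_mfderivWithin_extChartAt_symm (I := 𝓡 3) (x := p) (y := z)
        (by simpa using hz)
      rw [ModelWithCorners.range_eq_univ, mfderivWithin_univ] at this
      exact this
    have h2 : HasMFDerivAt 𝓘(ℝ, E3) 𝓘(ℝ, E3) Ψ z _ :=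
      ((hΦ (A.symm z)).mdifferentiableAt (by simp)).hasMFDerivAt.comp z
        ((hA z hz).mdifferentiableAt (by simp)).hasMFDerivAt
    obtain ⟨L, hL⟩ := (hinv (A.symm z)).comp h1
    refine ⟨L, ?_⟩
    have h3 := h2.hasFDerivAt
    rw [← hL] at h3
    exact h3
  have hp : A p ∈ A.target := A.map_source (mem_chart_source E3 p)
  obtain ⟨L, hL⟩ := hder _ hp
  let H := (hΨ _ hp).toOpenPartialHomeomorph Ψ hL (by simp)
  have hH : ⇑H = Ψ := rfl
  refine ⟨A.trans H, ?_, fun y hy ↦ ?_, fun z hz ↦ ?_⟩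
  · rw [OpenPartialHomeomorph.trans_source]
    exact ⟨mem_chart_source E3 p, (hΨ _ hp).mem_toOpenPartialHomeomorph_source hL (by simp)⟩
  · rw [OpenPartialHomeomorph.trans_source] at hy
    change Φ y = Φ (A.symm (A y))
    rw [A.left_inv hy.1]
  · rw [OpenPartialHomeomorph.trans_target] at hz
    -- The derivative is invertible at every point, so the local inverse is smooth on its whole
    -- domain and not only at the image of `p`.
    obtain ⟨L', hL'⟩ := hder _ hz.2
    have h1 : ContDiffAt ℝ ∞ H.symm z := H.contDiffAt_symm hz.1 hL' (hΨ _ hz.2)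
    exact (hA _ hz.2).comp z h1.contMDiffAt

/-- A bijective smooth map with invertible derivatives has a smooth inverse. -/
lemma exists_smooth_inverse {Φ : M → E3} (hΦ : ContMDiff (𝓡 3) 𝓘(ℝ, E3) ∞ Φ)
    (hinv : ∀ p, (mfderiv (𝓡 3) 𝓘(ℝ, E3) Φ p).IsInvertible) (hb : Function.Bijective Φ) :
    ContMDiff 𝓘(ℝ, E3) (𝓡 3) ∞ (Equiv.ofBijective Φ hb).symm := by
  intro z
  obtain ⟨p, rfl⟩ := hb.2 z
  obtain ⟨e, hp, he, hs⟩ := exists_openPartialHomeomorph_of_isInvertible hΦ hinv p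
  have hz : Φ p ∈ e.target := by rw [he hp]; exact e.map_source hp
  refine (hs _ hz).congr_of_eventuallyEq ?_
  filter_upwards [e.open_target.mem_nhds hz] with w hw
  rw [Equiv.symm_apply_eq]
  change w = Φ (e.symm w)
  rw [he (e.map_target hw), e.right_inv hw]

end InverseFunction

/-! ### Lifting of segments in complete manifolds. -/

section Lifting

variable {M : Type*} [EMetricSpace M] [ChartedSpace E3 M]
  [RiemannianBundle (fun x : M ↦ TangentSpace (𝓡 3) x)] [IsRiemannianManifold (𝓡 3) M]

/-- The distance between the endpoints of a curve with bounded speed. -/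
lemma edist_le_of_speed_le {γ : ℝ → M} {a b : ℝ} (hab : a ≤ b) {C : ENNReal}
    (hγ : ∀ t ∈ Set.Icc a b, ContMDiffAt 𝓘(ℝ) (𝓡 3) ∞ γ t)
    (hC : ∀ t ∈ Set.Icc a b, ‖mfderiv 𝓘(ℝ) (𝓡 3) γ t 1‖ₑ ≤ C) :
    edist (γ a) (γ b) ≤ C * ENNReal.ofReal (b - a) := by
  rw [IsRiemannianManifold.out (I := 𝓡 3) (γ a) (γ b)]
  refine (riemannianEDist_le_pathELength (I := 𝓡 3) (γ := γ) (a := a) (b := b)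
    (fun t ht ↦ ((hγ t ht).of_le (by exact ENat.LEInfty.out)).contMDiffWithinAt) rfl rfl hab).trans ?_
  rw [pathELength_eq_lintegral_mfderiv_Icc]
  refine (MeasureTheory.setLIntegral_mono measurable_const hC).trans ?_
  rw [MeasureTheory.setLIntegral_const, Real.volume_Icc]

variable [IsManifold (𝓡 3) ∞ M]

/-- Lifting of segments through a local diffeomorphism which does not shrink vectors too much. -/
lemma exists_lift_segment [CompleteSpace M] {Φ : M → E3}
    (hΦ : ContMDiff (𝓡 3) 𝓘(ℝ, E3) ∞ Φ)
    (hinv : ∀ p, (mfderiv (𝓡 3) 𝓘(ℝ, E3) Φ p).IsInvertible) (x₀ : M) (v : E3) (C : NNReal)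
    (hC : ∀ (p : M) (t : ℝ), -1 ≤ t → t ≤ 2 → Φ p = Φ x₀ + t • v → ∀ w : TangentSpace (𝓡 3) p,
      mfderiv (𝓡 3) 𝓘(ℝ, E3) Φ p w = v → ‖w‖ₑ ≤ C) :
    ∃ γ : C(unitInterval, M), γ 0 = x₀ ∧ ∀ t : unitInterval, Φ (γ t) = Φ x₀ + (t : ℝ) • v := by
  have hloc : IsLocalHomeomorph Φ := IsLocalHomeomorph.mk Φ fun p ↦ by
    obtain ⟨e, h1, h2, -⟩ := exists_openPartialHomeomorph_of_isInvertible hΦ hinv p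
    exact ⟨e, h1, h2⟩
  let σ : ℝ → E3 := fun t ↦ Φ x₀ + t • v
  have hσ : ContDiff ℝ ∞ σ := contDiff_const.add (contDiff_id.smul contDiff_const)
  have hσ' (t : ℝ) : HasFDerivAt σ ((1 : ℝ →L[ℝ] ℝ).smulRight v) t :=
    ((ContinuousLinearMap.hasFDerivAt (1 : ℝ →L[ℝ] ℝ)).smul_const v).const_add _
  -- local lifts
  have loc (q : M) (t₀ : ℝ) (h0 : 0 ≤ t₀) (h1 : t₀ < 1) (hq : Φ q = σ t₀) (y : ℝ) (hy : t₀ < y) :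
      ∃ t₁, t₀ < t₁ ∧ t₁ ≤ y ∧ ∃ c : ℝ → M, c t₀ = q ∧ (∀ t ∈ Set.Icc t₀ t₁, Φ (c t) = σ t) ∧
        ∀ s ∈ Set.Icc t₀ t₁, ∀ t ∈ Set.Icc t₀ t₁, s ≤ t →
          edist (c s) (c t) ≤ C * ENNReal.ofReal (t - s) := by
    obtain ⟨e, hqe, he, hs⟩ := exists_openPartialHomeomorph_of_isInvertible hΦ hinv q
    have hmem : σ ⁻¹' e.target ∈ 𝓝 t₀ := by
      refine hσ.continuous.continuousAt.preimage_mem_nhds (e.open_target.mem_nhds ?_)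
      rw [← hq, he hqe]
      exact e.map_source hqe
    obtain ⟨r, hr, hB⟩ := Metric.mem_nhds_iff.1 hmem
    -- In the length of the time step, `r / 2` keeps `σ` in the domain of the local inverse, `y -
    -- t₀` keeps the end before `y`, and `1` keeps the time below `2`, where the speed bound `hC` is
    -- available.
    have hm0 : 0 < min (r / 2) (min (y - t₀) 1) := by
      refine lt_min (by positivity) (lt_min (by linarith) one_pos)
    refine ⟨t₀ + min (r / 2) (min (y - t₀) 1), by linarith, ?_, fun t ↦ e.symm (σ t), ?_, ?_, ?_⟩
    · have := (min_le_right (r / 2) (min (y - t₀) 1)).trans (min_le_left _ _)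
      linarith
    · change e.symm (σ t₀) = q
      rw [← hq, he hqe, e.left_inv hqe]
    all_goals
      have hin (t) (ht : t ∈ Set.Icc t₀ (t₀ + min (r / 2) (min (y - t₀) 1))) : σ t ∈ e.target := by
        refine hB ?_
        have := min_le_left (r / 2) (min (y - t₀) 1)
        rw [Metric.mem_ball, Real.dist_eq, abs_of_nonneg (by linarith [ht.1])]
        linarith [ht.2]
      have hle (t) (ht : t ∈ Set.Icc t₀ (t₀ + min (r / 2) (min (y - t₀) 1))) : 0 ≤ t ∧ t ≤ 2 := by
        have := (min_le_right (r / 2) (min (y - t₀) 1)).trans (min_le_right _ _)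
        exact ⟨by linarith [ht.1], by linarith [ht.2]⟩
      have hΦe (z) (hz : z ∈ e.target) : Φ (e.symm z) = z := by
        rw [he (e.map_target hz), e.right_inv hz]
    · exact fun t ht ↦ hΦe _ (hin t ht)
    · intro s hs' t ht hst
      have hsm (τ) (hτ : τ ∈ Set.Icc s t) :
          τ ∈ Set.Icc t₀ (t₀ + min (r / 2) (min (y - t₀) 1)) :=
        ⟨hs'.1.trans hτ.1, hτ.2.trans ht.2⟩
      have hc (τ) (hτ : τ ∈ Set.Icc s t) :
          ContMDiffAt 𝓘(ℝ) (𝓡 3) ∞ (fun t ↦ e.symm (σ t)) τ :=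
        (hs _ (hin τ (hsm τ hτ))).comp τ hσ.contDiffAt.contMDiffAt
      refine edist_le_of_speed_le hst hc fun τ hτ ↦ ?_
      -- The derivative of `Φ` sends the velocity of the lift to that of `σ`, which is `v`; so `hC`
      -- applies to it.
      refine hC _ τ (by linarith [hle τ (hsm τ hτ)]) (hle τ (hsm τ hτ)).2
        (hΦe _ (hin τ (hsm τ hτ))) _ ?_
      have h2 : HasMFDerivAt 𝓘(ℝ) 𝓘(ℝ, E3) (fun t ↦ Φ (e.symm (σ t))) τ _ :=
        ((hΦ (e.symm (σ τ))).mdifferentiableAt (by simp)).hasMFDerivAt.comp τ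
          ((hc τ hτ).mdifferentiableAt (by simp)).hasMFDerivAt
      have h3 : HasFDerivAt (fun t ↦ Φ (e.symm (σ t))) ((1 : ℝ →L[ℝ] ℝ).smulRight v) τ := by
        refine (hσ' τ).congr_of_eventuallyEq ?_
        filter_upwards [hσ.continuous.continuousAt.preimage_mem_nhds
          (e.open_target.mem_nhds (hin τ (hsm τ hτ)))] with t ht using hΦe _ ht
      let D : ℝ →L[ℝ] E3 := (mfderiv (𝓡 3) 𝓘(ℝ, E3) Φ (e.symm (σ τ))).comp
        (mfderiv 𝓘(ℝ) (𝓡 3) (fun t ↦ e.symm (σ t)) τ)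
      have h5 : HasFDerivAt (fun t ↦ Φ (e.symm (σ t))) D τ := h2.hasFDerivAt
      have h4 := congrArg (fun L : ℝ →L[ℝ] E3 ↦ L 1) (h5.unique h3)
      refine h4.trans ?_
      simp
  -- the set of times up to which there is a lift
  let S : Set ℝ := {T | ∃ γ : ℝ → M, γ 0 = x₀ ∧ (∀ t ∈ Set.Icc 0 T, Φ (γ t) = σ t) ∧
    ∀ s ∈ Set.Icc 0 T, ∀ t ∈ Set.Icc 0 T, s ≤ t → edist (γ s) (γ t) ≤ C * ENNReal.ofReal (t - s)}
  have hSdown {T T' : ℝ} (hT : T ∈ S) (h : T' ≤ T) : T' ∈ S := by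
    obtain ⟨γ, h1, h2, h3⟩ := hT
    exact ⟨γ, h1, fun t ht ↦ h2 t ⟨ht.1, ht.2.trans h⟩, fun s hs t ht ↦
      h3 s ⟨hs.1, hs.2.trans h⟩ t ⟨ht.1, ht.2.trans h⟩⟩
  have hcont {γ : ℝ → M} {T : ℝ} (h : ∀ s ∈ Set.Icc 0 T, ∀ t ∈ Set.Icc 0 T, s ≤ t →
      edist (γ s) (γ t) ≤ C * ENNReal.ofReal (t - s)) : ContinuousOn γ (Set.Icc 0 T) := by
    have : LipschitzOnWith C γ (Set.Icc 0 T) := by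
      intro s hs t ht
      rw [edist_dist s t, Real.dist_eq]
      rcases le_total s t with hst | hst
      · rw [abs_sub_comm, abs_of_nonneg (by linarith)]
        exact h s hs t ht hst
      · rw [edist_comm, abs_of_nonneg (by linarith)]
        exact h t ht s hs hst
    exact this.continuousOn
  have h0S : (0 : ℝ) ∈ S := by
    refine ⟨fun _ ↦ x₀, rfl, fun t ht ↦ ?_, fun s hs t ht _ ↦ by simp⟩
    rw [Set.Icc_self, Set.mem_singleton_iff] at ht
    simp [σ, ht]
  -- At a limit time `T`, the lifts up to times `t < T` are glued into one Lipschitz curve on `[0,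
  -- T)`, which converges by completeness.
  have hclosed : IsClosed (S ∩ Set.Icc 0 1) := by
    refine isClosed_of_closure_subset fun T hT ↦ ?_
    have hTI : T ∈ Set.Icc (0 : ℝ) 1 :=
      closure_minimal Set.inter_subset_right isClosed_Icc hT
    refine ⟨?_, hTI⟩
    by_contra hTS
    have hlt (t : ℝ) (ht : t < T) : t ∈ S := by
      obtain ⟨T', h1, h2, -⟩ := mem_closure_iff.1 hT _ isOpen_Ioi ht
      exact hSdown h2 (le_of_lt h1)
    have hT0 : 0 < T := hTI.1.lt_of_ne (fun h ↦ hTS (h ▸ h0S))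
    choose γ g1 g2 g3 using hlt
    let Γ (t : ℝ) : M := if ht : t < T then γ t ht t else x₀
    have hΓ (t : ℝ) (ht : t < T) : Γ t = γ t ht t := dif_pos ht
    -- Lifts from the same initial point coincide, since `Φ` is locally injective and `M` is
    -- Hausdorff.
    have agree (s t : ℝ) (hs : 0 ≤ s) (hst : s ≤ t) (ht : t < T) : γ t ht s = Γ s := by
      rw [hΓ s (hst.trans_lt ht)]
      refine (T2Space.isSeparatedMap Φ).eqOn_of_comp_eqOn hloc.isLocallyInjective
        (s := Set.Icc 0 s) isPreconnected_Icc ((hcont (g3 t ht)).mono (Set.Icc_subset_Icc_right hst))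
        (hcont (g3 s (hst.trans_lt ht))) (fun τ hτ ↦ ?_) (Set.left_mem_Icc.2 hs)
        ((g1 t ht).trans (g1 s (hst.trans_lt ht)).symm) (Set.right_mem_Icc.2 hs)
      exact (g2 t ht τ ⟨hτ.1, hτ.2.trans hst⟩).trans (g2 s _ τ hτ).symm
    have lip (s t : ℝ) (hs : 0 ≤ s) (hst : s ≤ t) (ht : t < T) :
        edist (Γ s) (Γ t) ≤ C * ENNReal.ofReal (t - s) := by
      rw [← agree s t hs hst ht, hΓ t ht]
      exact g3 t ht s ⟨hs, hst⟩ t ⟨hs.trans hst, le_rfl⟩ hst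
    have hL : LipschitzOnWith C Γ (Set.Ico 0 T) := by
      intro s hs t ht
      rw [edist_dist s t, Real.dist_eq]
      rcases le_total s t with hst | hst
      · rw [abs_sub_comm, abs_of_nonneg (by linarith)]
        exact lip s t hs.1 hst ht.2
      · rw [edist_comm, abs_of_nonneg (by linarith)]
        exact lip t s ht.1 hst hs.2
    have hne : (𝓝[Set.Ico 0 T] T).NeBot := by
      rw [← mem_closure_iff_nhdsWithin_neBot, closure_Ico hT0.ne]
      exact Set.right_mem_Icc.2 hT0.le
    have hcau : Cauchy (Filter.map Γ (𝓝[Set.Ico 0 T] T)) :=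
      (cauchy_nhds.mono nhdsWithin_le_nhds).map_of_le hL.uniformContinuousOn
        (Filter.le_principal_iff.2 self_mem_nhdsWithin)
    obtain ⟨q, hq⟩ := CompleteSpace.complete hcau
    have hq : Filter.Tendsto Γ (𝓝[Set.Ico 0 T] T) (𝓝 q) := hq
    have hΦΓ (t : ℝ) (h0 : 0 ≤ t) (ht : t < T) : Φ (Γ t) = σ t := by
      rw [hΓ t ht]
      exact g2 t ht t ⟨h0, le_rfl⟩
    have hΦq : Φ q = σ T := by
      refine tendsto_nhds_unique ((hΦ.continuous.tendsto q).comp hq)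
        ((hσ.continuous.continuousAt.mono_left nhdsWithin_le_nhds).congr' ?_)
      filter_upwards [self_mem_nhdsWithin] with t ht using (hΦΓ t ht.1 ht.2).symm
    have lipq (s : ℝ) (hs : 0 ≤ s) (hsT : s < T) : edist (Γ s) q ≤ C * ENNReal.ofReal (T - s) := by
      refine le_of_tendsto (tendsto_const_nhds.edist hq) ?_
      filter_upwards [self_mem_nhdsWithin, nhdsWithin_le_nhds (lt_mem_nhds hsT)] with t ht hst
      exact (lip s t hs hst.le ht.2).trans
        (mul_le_mul_right (ENNReal.ofReal_le_ofReal (by linarith [ht.2])) _)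
    refine hTS ⟨fun t ↦ if t < T then Γ t else q, ?_, fun t ht ↦ ?_, fun s hs t ht hst ↦ ?_⟩
    · simp only [if_pos hT0, hΓ 0 hT0, g1]
    · by_cases h : t < T
      · simp only [if_pos h]
        exact hΦΓ t ht.1 h
      · simp only [if_neg h]
        rw [hΦq, le_antisymm ht.2 (not_lt.1 h)]
    · by_cases h : t < T
      · simp only [if_pos h, if_pos (hst.trans_lt h)]
        exact lip s t hs.1 hst h
      · have hT : t = T := le_antisymm ht.2 (not_lt.1 h)
        by_cases h' : s < T
        · simp only [if_pos h', if_neg h]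
          rw [hT]
          exact lipq s hs.1 h'
        · simp only [if_neg h', if_neg h, edist_self]
          exact zero_le
  -- Continuous induction on `[0, 1]`: a lift up to `T < 1` is prolonged by a local lift from its
  -- endpoint, and the Lipschitz bound passes to the concatenation through `γ T`.
  have hall := hclosed.Icc_subset_of_forall_exists_gt h0S (fun T hT y hy ↦ by
    obtain ⟨⟨γ, h1, h2, h3⟩, hT0, hT1⟩ := hT
    obtain ⟨t₁, ht1, ht2, c, hc0, hc1, hc2⟩ := loc (γ T) T hT0 hT1 (h2 T ⟨hT0, le_rfl⟩) y hy
    refine ⟨t₁, ⟨fun t ↦ if t ≤ T then γ t else c t, ?_, fun t ht ↦ ?_, fun s hs t ht hst ↦ ?_⟩,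
      ht1, ht2⟩
    · simp only [if_pos hT0, h1]
    · by_cases h : t ≤ T
      · simp only [if_pos h]
        exact h2 t ⟨ht.1, h⟩
      · simp only [if_neg h]
        exact hc1 t ⟨(not_le.1 h).le, ht.2⟩
    · by_cases h : t ≤ T
      · simp only [if_pos h, if_pos (hst.trans h)]
        exact h3 s ⟨hs.1, hst.trans h⟩ t ⟨ht.1, h⟩ hst
      · by_cases h' : s ≤ T
        · simp only [if_pos h', if_neg h]
          refine (edist_triangle _ (γ T) _).trans ?_
          have e1 := h3 s ⟨hs.1, h'⟩ T ⟨hT0, le_rfl⟩ h'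
          have e2 := hc2 T ⟨le_rfl, ht1.le⟩ t ⟨(not_le.1 h).le, ht.2⟩ (not_le.1 h).le
          rw [hc0] at e2
          refine (add_le_add e1 e2).trans_eq ?_
          rw [← mul_add, ← ENNReal.ofReal_add (by linarith) (by linarith [not_le.1 h])]
          congr 2
          ring
        · simp only [if_neg h', if_neg h]
          exact hc2 s ⟨(not_le.1 h').le, hs.2⟩ t ⟨(not_le.1 h).le, ht.2⟩ hst)
  obtain ⟨γ, h1, h2, h3⟩ := hall (Set.right_mem_Icc.2 zero_le_one)
  refine ⟨⟨fun t ↦ γ t, ?_⟩, h1, fun t ↦ h2 t t.2⟩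
  exact continuousOn_iff_continuous_domRestrict.1 (hcont h3)

end Lifting
end

noncomputable section

/-! ### Maps to `ℝ³` by components. -/

section Components

variable {M : Type*} [TopologicalSpace M] [ChartedSpace E3 M]

lemma contMDiff_triple {X Y Z : M → ℝ} (hX : ContMDiff (𝓡 3) 𝓘(ℝ) ∞ X)
    (hY : ContMDiff (𝓡 3) 𝓘(ℝ) ∞ Y) (hZ : ContMDiff (𝓡 3) 𝓘(ℝ) ∞ Z) :
    ContMDiff (𝓡 3) 𝓘(ℝ, E3) ∞ (fun p ↦ (!₂[X p, Y p, Z p] : E3)) := by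
  have h : ContDiff ℝ ∞ (fun q : ℝ × ℝ × ℝ ↦ (!₂[q.1, q.2.1, q.2.2] : E3)) :=
    Heisenberg.contDiff_mk contDiff_fst (contDiff_fst.comp contDiff_snd)
      (contDiff_snd.comp contDiff_snd)
  exact h.contMDiff.comp (hX.prodMk_space (hY.prodMk_space hZ))

/-- The components of the derivative of a map to `ℝ³`. -/
lemma mfderiv_apply_component {Φ : M → E3} {p : M}
    (hΦ : MDifferentiableAt (𝓡 3) 𝓘(ℝ, E3) Φ p) (v : TangentSpace (𝓡 3) p) (i : Fin 3) :
    (show E3 from mfderiv (𝓡 3) 𝓘(ℝ, E3) Φ p v) i = mvfderiv (𝓡 3) (fun q ↦ Φ q i) p v := by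
  have h1 : HasMFDerivAt (𝓡 3) 𝓘(ℝ) (fun q ↦ Φ q i) p _ :=
    (EuclideanSpace.proj i : E3 →L[ℝ] ℝ).hasMFDerivAt.comp p hΦ.hasMFDerivAt
  exact (congrArg (fun L : TangentSpace (𝓡 3) p →L[ℝ] ℝ ↦ L v) h1.mfderiv).symm

lemma isInvertible_of_injective {p : M} (L : TangentSpace (𝓡 3) p →L[ℝ] E3)
    (h : ∀ v, L v = 0 → v = 0) : L.IsInvertible := by
  let L' : E3 →ₗ[ℝ] E3 := L.toLinearMap
  have hL : Function.Injective L' := (injective_iff_map_eq_zero L').2 h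
  refine ⟨(LinearEquiv.ofInjectiveEndo L' hL).toContinuousLinearEquiv, ?_⟩
  ext v
  rfl

end Components

/-! ### The model left-invariant metric. -/

section HeisenbergMetric

/-- The left-invariant form `c (dz - x dy)`. -/
def heisenbergForm (c : ℝ) (p : E3) : E3 →L[ℝ] ℝ :=
  c • ((EuclideanSpace.proj 2 : E3 →L[ℝ] ℝ) - p 0 • (EuclideanSpace.proj 1 : E3 →L[ℝ] ℝ))

/-- The bilinear form `dx² + dy² + c² (dz - x dy)²`. -/
def heisenbergBilin (c : ℝ) (p : E3) : E3 →L[ℝ] E3 →L[ℝ] ℝ :=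
  (EuclideanSpace.proj 0 : E3 →L[ℝ] ℝ).smulRight (EuclideanSpace.proj 0 : E3 →L[ℝ] ℝ) +
    (EuclideanSpace.proj 1 : E3 →L[ℝ] ℝ).smulRight (EuclideanSpace.proj 1 : E3 →L[ℝ] ℝ) +
    (heisenbergForm c p).smulRight (heisenbergForm c p)

lemma heisenbergBilin_apply (c : ℝ) (p v w : E3) : heisenbergBilin c p v w =
    v 0 * w 0 + v 1 * w 1 + c ^ 2 * ((v 2 - p 0 * v 1) * (w 2 - p 0 * w 1)) := by
  simp [heisenbergBilin, heisenbergForm]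
  ring

lemma contDiff_heisenbergBilin (c : ℝ) : ContDiff ℝ ∞ (heisenbergBilin c) := by
  have h0 : ContDiff ℝ ∞ (fun p : E3 ↦ p 0) := Heisenberg.contDiff_apply 0
  have h1 : ContDiff ℝ ∞ (heisenbergForm c) := by
    have h2 : ContDiff ℝ ∞ (fun p : E3 ↦ p 0 • (EuclideanSpace.proj 1 : E3 →L[ℝ] ℝ)) :=
      h0.smul contDiff_const
    exact (contDiff_const.sub h2).const_smul c
  have h2 : ContDiff ℝ ∞ (fun p ↦ (heisenbergForm c p).smulRight (heisenbergForm c p)) :=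
    ContDiff.smulRight (f := heisenbergForm c) (g := heisenbergForm c) h1 h1
  exact contDiff_const.add h2

lemma isVonNBounded_heisenbergBilin (c : ℝ) (hc : 0 < c) (p : E3) :
    Bornology.IsVonNBounded ℝ {v : E3 | heisenbergBilin c p v v < 1} := by
  rw [NormedSpace.isVonNBounded_iff, isBounded_iff_forall_norm_le]
  -- On the unit ball of the form, `|v 0|` and `|v 1|` are at most `1`, and `c |v 2 - p 0 * v 1| ≤
  -- 1` gives `|v 2| ≤ 1 / c + |p 0|`.
  refine ⟨√(2 + (1 / c + |p 0|) ^ 2), fun v hv ↦ Real.le_sqrt_of_sq_le ?_⟩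
  rw [Set.mem_ofPred_eq, heisenbergBilin_apply] at hv
  rw [EuclideanSpace.norm_sq_eq, Fin.sum_univ_three]
  simp only [Real.norm_eq_abs, sq_abs]
  have h0 : v 0 ^ 2 ≤ 1 := by nlinarith [sq_nonneg (v 1), sq_nonneg (c * (v 2 - p 0 * v 1))]
  have h1 : v 1 ^ 2 ≤ 1 := by nlinarith [sq_nonneg (v 0), sq_nonneg (c * (v 2 - p 0 * v 1))]
  have h2 : |c * (v 2 - p 0 * v 1)| ≤ 1 :=
    (sq_le_one_iff_abs_le_one _).1 (by nlinarith [sq_nonneg (v 0), sq_nonneg (v 1)])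
  have h3 : |v 1| ≤ 1 := (sq_le_one_iff_abs_le_one _).1 h1
  have h4 : |v 2 - p 0 * v 1| ≤ 1 / c := by
    rw [abs_mul, abs_of_pos hc] at h2
    rwa [le_div_iff₀' hc]
  have h5 : |v 2| ≤ 1 / c + |p 0| := by
    calc |v 2| = |(v 2 - p 0 * v 1) + p 0 * v 1| := by ring_nf
      _ ≤ |v 2 - p 0 * v 1| + |p 0| * |v 1| := (abs_add_le _ _).trans_eq (by rw [abs_mul])
      _ ≤ 1 / c + |p 0| * 1 := by gcongr
      _ = _ := by ring
  have h6 : v 2 ^ 2 ≤ (1 / c + |p 0|) ^ 2 := by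
    rw [← sq_abs (v 2)]
    gcongr
  linarith

lemma heisenbergBilin_self_pos {c : ℝ} (hc : 0 < c) (p : E3) {v : E3} (hv : v ≠ 0) :
    0 < heisenbergBilin c p v v := by
  rw [heisenbergBilin_apply]
  by_contra! h
  have h0 : v 0 = 0 := by
    nlinarith [sq_nonneg (v 0), sq_nonneg (v 1), sq_nonneg (c * (v 2 - p 0 * v 1))]
  have h1 : v 1 = 0 := by
    nlinarith [sq_nonneg (v 0), sq_nonneg (v 1), sq_nonneg (c * (v 2 - p 0 * v 1))]
  have h2 : c * v 2 = 0 := by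
    rw [h0, h1] at h
    nlinarith [sq_nonneg (c * v 2)]
  refine hv (PiLp.ext fun i ↦ ?_)
  fin_cases i
  exacts [h0, h1, (mul_eq_zero.1 h2).resolve_left hc.ne']

/-- The trivializations of the tangent bundle of a vector space are identities, so `B` is its own
coordinate expression. -/
lemma contMDiff_bilin {B : E3 → E3 →L[ℝ] E3 →L[ℝ] ℝ} (hB : ContDiff ℝ ∞ B) :
    ContMDiff 𝓘(ℝ, E3) (𝓘(ℝ, E3).prod 𝓘(ℝ, E3 →L[ℝ] E3 →L[ℝ] ℝ)) ∞
      (fun b ↦ TotalSpace.mk' (E3 →L[ℝ] E3 →L[ℝ] ℝ)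
        (E := fun b : E3 ↦ TangentSpace 𝓘(ℝ, E3) b →L[ℝ] TangentSpace 𝓘(ℝ, E3) b →L[ℝ] ℝ) b
        (B b : TangentSpace 𝓘(ℝ, E3) b →L[ℝ] TangentSpace 𝓘(ℝ, E3) b →L[ℝ] ℝ)) := by
  intro x
  refine (contMDiffAt_section _).2 ?_
  refine hB.contMDiff.contMDiffAt.congr_of_eventuallyEq (Filter.Eventually.of_forall fun y ↦ ?_)
  refine ContinuousLinearMap.ext fun v ↦ ContinuousLinearMap.ext fun w ↦ ?_
  have hb : y ∈ (trivializationAt E3 (TangentSpace 𝓘(ℝ, E3)) x).baseSet := Set.mem_univ y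
  have hs (u : E3) : (trivializationAt E3 (TangentSpace 𝓘(ℝ, E3)) x).symm y u = u :=
    (Trivialization.symmL_apply (R := ℝ) _ hb u).symm.trans
      (congrArg (fun L : E3 →L[ℝ] E3 ↦ L u) (TangentBundle.symmL_model_space (𝕜 := ℝ) x y))
  refine (inCoordinates_apply_eq₂ (F₁ := E3) (F₂ := E3) (F₃ := ℝ)
    (E₁ := fun b : E3 ↦ TangentSpace 𝓘(ℝ, E3) b) (E₂ := fun b : E3 ↦ TangentSpace 𝓘(ℝ, E3) b)
    (E₃ := Bundle.Trivial E3 ℝ) hb hb (Set.mem_univ _)).trans ?_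
  refine (congrArg (fun L : ℝ →ₗ[ℝ] ℝ ↦ L _)
    (Bundle.Trivial.linearMapAt_trivialization ℝ E3 ℝ y)).trans ?_
  exact congrArg₂ (fun v w : E3 ↦ B y v w) (hs v) (hs w)

/-- The left-invariant metric `dx² + dy² + c² (dz - x dy)²` on the Heisenberg group. -/
def heisenbergMetric (c : ℝ) (hc : 0 < c) :
    ContMDiffRiemannianMetric (𝓡 3) ∞ E3 (fun p : Heisenberg ↦ TangentSpace (𝓡 3) p) where
  inner p := (heisenbergBilin c p : E3 →L[ℝ] E3 →L[ℝ] ℝ)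
  symm p v w := (heisenbergBilin_apply c p v w).trans
    ((by ring : _ = _).trans (heisenbergBilin_apply c p w v).symm)
  pos p _ hv := heisenbergBilin_self_pos hc p hv
  isVonNBounded p := isVonNBounded_heisenbergBilin c hc p
  contMDiff := contMDiff_bilin (contDiff_heisenbergBilin c)

lemma heisenbergMetric_inner (c : ℝ) (hc : 0 < c) (q : Heisenberg) (v w : E3) :
    (heisenbergMetric c hc).inner q v w = v 0 * w 0 + v 1 * w 1 +
      c ^ 2 * ((v 2 - q.coord 0 * v 1) * (w 2 - q.coord 0 * w 1)) :=
  heisenbergBilin_apply c q v w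

/-- The left translation by `a`, as a map of `ℝ³`, and its derivative. -/
lemma hasFDerivAt_mul_left (a p : Heisenberg) :
    HasFDerivAt (fun q : E3 ↦ (show E3 from a * (show Heisenberg from q)))
      ((ContinuousLinearMap.id ℝ E3) + ((a.coord 0 • (EuclideanSpace.proj 1 : E3 →L[ℝ] ℝ)).smulRight
        (EuclideanSpace.single 2 1 : E3))) p := by
  have h : (fun q : E3 ↦ (show E3 from a * (show Heisenberg from q))) = fun q : E3 ↦
      ((ContinuousLinearMap.id ℝ E3) + ((a.coord 0 • (EuclideanSpace.proj 1 : E3 →L[ℝ] ℝ)).smulRight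
        (EuclideanSpace.single 2 1 : E3))) q + (show E3 from a) := by
    funext q
    refine PiLp.ext fun i ↦ ?_
    have h0 : (show E3 from a * (show Heisenberg from q)) 0 = a.coord 0 + q 0 := rfl
    have h1 : (show E3 from a * (show Heisenberg from q)) 1 = a.coord 1 + q 1 := rfl
    have h2 : (show E3 from a * (show Heisenberg from q)) 2 = a.coord 2 + q 2 + a.coord 0 * q 1 := rfl
    have key (b q : E3) (i : Fin 3) : ((ContinuousLinearMap.id ℝ E3) +
        ((b 0 • (EuclideanSpace.proj 1 : E3 →L[ℝ] ℝ)).smulRight (EuclideanSpace.single 2 1 : E3)))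
          q i = q i + b 0 * q 1 * (EuclideanSpace.single 2 (1 : ℝ) : E3) i := by simp
    have h3 (i : Fin 3) : (fun q : E3 ↦ ((ContinuousLinearMap.id ℝ E3) +
        ((a.coord 0 • (EuclideanSpace.proj 1 : E3 →L[ℝ] ℝ)).smulRight
          (EuclideanSpace.single 2 1 : E3))) q + (show E3 from a)) q i =
        q i + a.coord 0 * q 1 * (EuclideanSpace.single 2 (1 : ℝ) : E3) i + a.coord i :=
      congrArg (· + a.coord i) (key (show E3 from a) q i)
    refine Eq.trans ?_ (h3 i).symm
    fin_cases i
    · exact h0.trans (by simp; ring)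
    · exact h1.trans (by simp; ring)
    · exact h2.trans (by simp; ring)
  rw [h]
  exact (ContinuousLinearMap.hasFDerivAt _).add_const _

/-- The derivative of a left translation. -/
lemma mfderiv_mul_left (a p : Heisenberg) (v : E3) :
    mfderiv (𝓡 3) (𝓡 3) (fun q : Heisenberg ↦ a * q) p v =
      (!₂[v 0, v 1, v 2 + a.coord 0 * v 1] : E3) := by
  have h : HasMFDerivAt (𝓡 3) (𝓡 3) (fun q : Heisenberg ↦ a * q) p
    ((ContinuousLinearMap.id ℝ E3) + ((a.coord 0 • (EuclideanSpace.proj 1 : E3 →L[ℝ] ℝ)).smulRight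
        (EuclideanSpace.single 2 1 : E3)) : E3 →L[ℝ] E3) := (hasFDerivAt_mul_left a p).hasMFDerivAt
  refine (congrArg (fun L : E3 →L[ℝ] E3 ↦ L v) h.mfderiv).trans (PiLp.ext fun i ↦ ?_)
  fin_cases i <;> simp

/-- Translation by `a` adds `a.coord 0 * dy` to `dz` and `a.coord 0` to `x`, so `dx`, `dy` and `dz -
x dy` are all preserved. -/
lemma isLeftInvariant_heisenbergMetric (c : ℝ) (hc : 0 < c) :
    IsLeftInvariant (heisenbergMetric c hc) := by
  intro a p v w
  have h0 : (a * p).coord 0 = a.coord 0 + p.coord 0 := rfl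
  refine (congrArg₂ (fun v w : E3 ↦ (heisenbergMetric c hc).inner (a * p) v w)
    (mfderiv_mul_left a p v) (mfderiv_mul_left a p w)).trans ?_
  refine (heisenbergMetric_inner c hc _ _ _).trans ?_
  refine Eq.trans ?_ (heisenbergMetric_inner c hc p v w).symm
  have h1 (u : E3) : (!₂[u 0, u 1, u 2 + a.coord 0 * u 1] : E3) 0 = u 0 ∧
      (!₂[u 0, u 1, u 2 + a.coord 0 * u 1] : E3) 1 = u 1 ∧
      (!₂[u 0, u 1, u 2 + a.coord 0 * u 1] : E3) 2 = u 2 + a.coord 0 * u 1 := ⟨rfl, rfl, rfl⟩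
  rw [h0, (h1 v).1, (h1 v).2.1, (h1 v).2.2, (h1 w).1, (h1 w).2.1, (h1 w).2.2]
  ring

end HeisenbergMetric
end

noncomputable section

/-! ### Global coordinates from a turning field. -/

section Coordinates

variable {M : Type*} [TopologicalSpace M] [ChartedSpace E3 M] [IsManifold (𝓡 3) ∞ M]
  [RiemannianBundle (fun x : M ↦ TangentSpace (𝓡 3) x)]
  [IsContMDiffRiemannianBundle (𝓡 3) ∞ E3 (fun x : M ↦ TangentSpace (𝓡 3) x)]
  {cov : Connection M} {f : ℝ} {ξ : VField M}

local notation "J" => contactRotation cov f ξ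

/-- A simply connected manifold with a contact field has an orthonormal frame `ξ`, `e`, `e'` and
functions `X`, `Y`, `Z` with `dX = e`, `dY = e'` and `f (dZ - X dY) = ξ`. -/
lemma IsContactField.exists_coordinates (h : IsContactField cov f ξ) (hcov : IsLeviCivita cov)
    (hf : 0 < f) [SimplyConnectedSpace M] :
    ∃ (e e' : VField M) (X Y Z : M → ℝ), (∀ x, Orthonormal ℝ ![ξ x, e x, e' x]) ∧
      ContMDiff (𝓡 3) 𝓘(ℝ) ∞ X ∧ ContMDiff (𝓡 3) 𝓘(ℝ) ∞ Y ∧ ContMDiff (𝓡 3) 𝓘(ℝ) ∞ Z ∧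
      (∀ x v, mvfderiv (𝓡 3) X x v = inner ℝ (e x) v) ∧
      (∀ x v, mvfderiv (𝓡 3) Y x v = inner ℝ (e' x) v) ∧
      (∀ x v, f * (mvfderiv (𝓡 3) Z x v - X x * inner ℝ (e' x) v) = inner ℝ (ξ x) v) := by
  obtain ⟨u, hu⟩ := h.exists_turning hcov hf
  let e' : VField M := fun x ↦ J x (u x)
  have hu0 (x : M) := (hu x).unit.self_of_nhds
  have ho (x : M) : Orthonormal ℝ ![ξ x, u x, e' x] := h.orthonormal hf (hu0 x).1 (hu0 x).2
  have he' (x : M) : SmoothNear e' x := h.smoothNear_rotation hcov (hu x).smooth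
  have ce (x : M) (v : TangentSpace (𝓡 3) x) : cov u x v =
      -(f / 2 * inner ℝ (ξ x) v) • e' x - (f / 2 * inner ℝ (e' x) v) • ξ x :=
    h.cov_turning hcov hf (hu x) v
  have ce' (x : M) (v : TangentSpace (𝓡 3) x) : cov e' x v =
      (f / 2 * inner ℝ (ξ x) v) • u x + (f / 2 * inner ℝ (u x) v) • ξ x := by
    refine (h.cov_rotation hcov hf (hu x).smooth (hu x).unit v).trans ?_
    rw [(hu x).turning.self_of_nhds v]
    module
  have cξ (x : M) (v : TangentSpace (𝓡 3) x) : cov ξ x v =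
      (-(f / 2)) • (inner ℝ (u x) v • e' x - inner ℝ (e' x) v • u x) := by
    rw [cov_eq_contactRotation cov ξ hf, h.rotation_eq hf (hu0 x).1 (hu0 x).2 v]
  -- The formulas `ce` and `ce'` are symmetric: the turning rate `-f / 2` is just what balances the
  -- components along `ξ`.
  obtain ⟨X, hX, dX⟩ := hcov.exists_potential (fun x ↦ (hu x).smooth) (fun x v w ↦ by
    rw [ce, ce]
    simp only [inner_sub_left, real_inner_smul_left]
    ring)
  obtain ⟨Y, hY, dY⟩ := hcov.exists_potential he' (fun x v w ↦ by
    rw [ce', ce']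
    simp only [inner_add_left, real_inner_smul_left]
    ring)
  have hXn (x : M) : FunSmoothNear X x := Filter.Eventually.of_forall hX
  -- `d(ξ / f) = -u ∧ e'`, whereas `d(X e') = dX ∧ e' = u ∧ e'`.
  obtain ⟨Z, hZ, dZ⟩ := hcov.exists_potential (e := (1 / f) • ξ + X • e')
    (fun x ↦ ((h.smooth x).const_smul _).add (SmoothNear.smul (hXn x) (he' x))) (fun x v w ↦ by
    have k (v : TangentSpace (𝓡 3) x) : cov ((1 / f) • ξ + X • e') x v =
      (1 / 2 : ℝ) • (inner ℝ (u x) v • e' x + inner ℝ (e' x) v • u x) +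
      X x • ((f / 2 * inner ℝ (ξ x) v) • u x + (f / 2 * inner ℝ (u x) v) • ξ x) := by
      rw [cov_add ((h.smooth x).const_smul _) (SmoothNear.smul (hXn x) (he' x)),
        cov_const_smul (h.smooth x), cov_smul (hXn x) (he' x), ce', cξ, dX, smul_smul]
      have : 1 / f * -(f / 2) = -(1 / 2) := by field_simp
      rw [this]
      module
    rw [k, k]
    simp only [inner_add_left, real_inner_smul_left]
    ring)
  refine ⟨u, e', X, Y, Z, ho, hX, hY, hZ, dX, dY, fun x v ↦ ?_⟩
  rw [dZ]
  have : ((1 / f) • ξ + X • e') x = (1 / f) • ξ x + X x • e' x := rfl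
  rw [this, inner_add_left, real_inner_smul_left, real_inner_smul_left]
  field_simp
  ring

end Coordinates

/-! ### The isometry onto the Heisenberg group. -/

section Isometry

variable {M : Type*} [EMetricSpace M] [ChartedSpace E3 M] [IsManifold (𝓡 3) ∞ M]
  [RiemannianBundle (fun x : M ↦ TangentSpace (𝓡 3) x)]
  [IsContMDiffRiemannianBundle (𝓡 3) ∞ E3 (fun x : M ↦ TangentSpace (𝓡 3) x)]
  [IsRiemannianManifold (𝓡 3) M] {cov : Connection M} {f : ℝ} {ξ : VField M}

lemma IsContactField.exists_isometry (h : IsContactField cov f ξ) (hcov : IsLeviCivita cov)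
    (hf : 0 < f) [CompleteSpace M] [SimplyConnectedSpace M] :
    ∃ Φ : M ≃ₘ^∞⟮𝓡 3, 𝓡 3⟯ Heisenberg, ∀ (x : M) (v w : TangentSpace (𝓡 3) x),
      (heisenbergMetric f hf).inner (Φ x) (mfderiv (𝓡 3) (𝓡 3) Φ x v)
        (mfderiv (𝓡 3) (𝓡 3) Φ x w) = inner ℝ v w := by
  obtain ⟨e, e', X, Y, Z, ho, hX, hY, hZ, dX, dY, dZ⟩ := h.exists_coordinates hcov hf
  let Φ : M → E3 := fun p ↦ !₂[X p, Y p, Z p]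
  have hΦ : ContMDiff (𝓡 3) 𝓘(ℝ, E3) ∞ Φ := contMDiff_triple hX hY hZ
  have D (p : M) (v : TangentSpace (𝓡 3) p) (i : Fin 3) :
      (show E3 from mfderiv (𝓡 3) 𝓘(ℝ, E3) Φ p v) i = mvfderiv (𝓡 3) (fun q ↦ Φ q i) p v :=
    mfderiv_apply_component ((hΦ p).mdifferentiableAt (by simp)) v i
  have D0 (p : M) (v : TangentSpace (𝓡 3) p) :
      (show E3 from mfderiv (𝓡 3) 𝓘(ℝ, E3) Φ p v) 0 = inner ℝ (e p) v := (D p v 0).trans (dX p v)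
  have D1 (p : M) (v : TangentSpace (𝓡 3) p) :
      (show E3 from mfderiv (𝓡 3) 𝓘(ℝ, E3) Φ p v) 1 = inner ℝ (e' p) v := (D p v 1).trans (dY p v)
  have D2 (p : M) (v : TangentSpace (𝓡 3) p) :
      f * ((show E3 from mfderiv (𝓡 3) 𝓘(ℝ, E3) Φ p v) 2 -
        X p * (show E3 from mfderiv (𝓡 3) 𝓘(ℝ, E3) Φ p v) 1) = inner ℝ (ξ p) v := by
    rw [D1, D p v 2, ← dZ]
    rfl
  have hinner (p : M) (v w : TangentSpace (𝓡 3) p) : inner ℝ v w =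
      heisenbergBilin f (Φ p) (mfderiv (𝓡 3) 𝓘(ℝ, E3) Φ p v) (mfderiv (𝓡 3) 𝓘(ℝ, E3) Φ p w) := by
    rw [(ho p).inner_eq_sum_cons v w]
    refine Eq.trans ?_ (heisenbergBilin_apply f (Φ p) _ _).symm
    have : Φ p 0 = X p := rfl
    rw [← D0, ← D0, ← D1, ← D1, ← D2, ← D2, this]
    ring
  have hinv (p : M) : (mfderiv (𝓡 3) 𝓘(ℝ, E3) Φ p).IsInvertible := by
    refine isInvertible_of_injective _ fun v hv ↦ ?_
    rw [← inner_self_eq_zero (𝕜 := ℝ), hinner]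
    exact (congrArg (fun z : E3 ↦ heisenbergBilin f (Φ p) z z) hv).trans
      ((heisenbergBilin_apply f (Φ p) 0 0).trans (by simp))
  have hloc : IsLocalHomeomorph Φ := IsLocalHomeomorph.mk Φ fun p ↦ by
    obtain ⟨e, h1, h2, -⟩ := exists_openPartialHomeomorph_of_isInvertible hΦ hinv p
    exact ⟨e, h1, h2⟩
  have x₀ : M := Classical.arbitrary M
  have hlift (v : E3) : ∃ γ : C(unitInterval, M), γ 0 = x₀ ∧
      ∀ t : unitInterval, Φ (γ t) = Φ x₀ + (t : ℝ) • v := by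
    -- `K` bounds the coordinate `X x₀ + t * v 0` for `|t| ≤ 2`. It thereby bounds the metric length
    -- of `v` along the segment, the point where the coefficient `x` of the metric could have grown.
    set K := |X x₀| + 2 * |v 0| with hK
    have hK0 : 0 ≤ K := by positivity
    have hC0 : 0 ≤ |v 0| + |v 1| + f * (|v 2| + K * |v 1|) := by positivity
    refine exists_lift_segment hΦ hinv x₀ v ⟨_, hC0⟩ fun p t ht1 ht2 hp w hw ↦ ?_
    refine ENNReal.coe_le_coe.2 (NNReal.coe_le_coe.1 ?_)
    change ‖w‖ ≤ |v 0| + |v 1| + f * (|v 2| + K * |v 1|)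
    have hXp : X p = X x₀ + t * v 0 := congrArg (fun z : E3 ↦ z 0) hp
    have hXK : |X p| ≤ K := by
      rw [hXp, hK]
      refine (abs_add_le _ _).trans ?_
      rw [abs_mul]
      gcongr
      exact abs_le.2 ⟨by linarith, ht2⟩
    have h1 : ‖w‖ ^ 2 = v 0 * v 0 + v 1 * v 1 + f ^ 2 * ((v 2 - X p * v 1) * (v 2 - X p * v 1)) := by
      rw [← real_inner_self_eq_norm_sq, hinner]
      exact (congrArg (fun z : E3 ↦ heisenbergBilin f (Φ p) z z) hw).trans
        (heisenbergBilin_apply f (Φ p) v v)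
    have h2 : |v 2 - X p * v 1| ≤ |v 2| + K * |v 1| := by
      refine (abs_sub _ _).trans ?_
      rw [abs_mul]
      gcongr
    refine le_of_sq_le_sq ?_ hC0
    have h3 : f * |v 2 - X p * v 1| ≤ f * (|v 2| + K * |v 1|) := by gcongr
    have h4 : ‖w‖ ^ 2 = |v 0| ^ 2 + |v 1| ^ 2 + (f * |v 2 - X p * v 1|) ^ 2 := by
      rw [h1, mul_pow, sq_abs, sq_abs, sq_abs]
      ring
    calc ‖w‖ ^ 2 ≤ (|v 0| + |v 1| + f * |v 2 - X p * v 1|) ^ 2 := by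
          rw [h4]
          have a0 := abs_nonneg (v 0)
          have a1 := abs_nonneg (v 1)
          have a2 : 0 ≤ f * |v 2 - X p * v 1| := by positivity
          nlinarith [mul_nonneg a0 a1, mul_nonneg a0 a2, mul_nonneg a1 a2]
      _ ≤ _ := by gcongr
  have hb : Function.Bijective Φ := hloc.bijective_of_lift_segments x₀ hlift
  exact ⟨{ toEquiv := Equiv.ofBijective Φ hb
           contMDiff_toFun := hΦ
           contMDiff_invFun := exists_smooth_inverse hΦ hinv hb }, fun x v w ↦ (hinner x v w).symm⟩

end Isometry

end

noncomputable section

/-! ### Connections prescribed on an orthonormal frame. -/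

section FrameConnection

variable {M : Type*} [TopologicalSpace M] [ChartedSpace E3 M]
  [RiemannianBundle (fun x : M ↦ TangentSpace (𝓡 3) x)]

lemma Orthonormal.eq_sum' {x : M} {b : Fin 3 → TangentSpace (𝓡 3) x}
    (hb : Orthonormal ℝ b) (v : TangentSpace (𝓡 3) x) : v = ∑ i, inner ℝ v (b i) • b i := by
  simpa only [real_inner_comm] using hb.eq_sum v

variable [IsManifold (𝓡 3) ∞ M]
  [IsContMDiffRiemannianBundle (𝓡 3) ∞ E3 (fun x : M ↦ TangentSpace (𝓡 3) x)]

lemma mdiffAt_inner {V W : VField M} {x : M}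
    (hV : MDifferentiableAt (𝓡 3) (𝓡 3).tangent (fun z ↦ (⟨z, V z⟩ : TangentBundle (𝓡 3) M)) x)
    (hW : MDifferentiableAt (𝓡 3) (𝓡 3).tangent (fun z ↦ (⟨z, W z⟩ : TangentBundle (𝓡 3) M)) x) :
    MDifferentiableAt (𝓡 3) 𝓘(ℝ) (fun y ↦ inner ℝ (V y) (W y)) x := by
  have : IsContMDiffRiemannianBundle (𝓡 3) 1 E3 (fun x : M ↦ TangentSpace (𝓡 3) x) :=
    IsContMDiffRiemannianBundle.of_le (n := ∞) (by simp)
  exact hV.inner_bundle hW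

/-- The connection with prescribed derivatives `Γ k` of the members of an orthonormal frame `e`. -/
def frameConnection (e : Fin 3 → VField M) (he : ∀ i x, SmoothNear (e i) x)
    (Γ : Fin 3 → Π x : M, TangentSpace (𝓡 3) x →L[ℝ] TangentSpace (𝓡 3) x)
    (ho : ∀ x, Orthonormal ℝ (fun i ↦ e i x)) : Connection M where
  -- The formula forced by the Leibniz rule on `σ = ∑ k, ⟪σ, e k⟫ e k`.
  toFun σ x := ∑ k, ((mvfderiv (𝓡 3) (fun y ↦ inner ℝ (σ y) (e k y)) x).smulRight (e k x) +
    (inner ℝ (σ x) (e k x) : ℝ) • Γ k x)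
  isCovariantDerivativeOnUniv :=
    { add {σ σ' x} hσ hσ' _ := by
        rw [← Finset.sum_add_distrib]
        refine Finset.sum_congr rfl fun k _ ↦ ContinuousLinearMap.ext fun v ↦ ?_
        have := mvfderiv_add_apply (mdiffAt_inner hσ (he k x).mdiffAt)
          (mdiffAt_inner hσ' (he k x).mdiffAt) v
        have h : (fun y ↦ inner ℝ ((σ + σ') y) (e k y)) =
          fun y ↦ inner ℝ (σ y) (e k y) + inner ℝ (σ' y) (e k y) := by
          funext y; exact inner_add_left _ _ _
        have h' : (inner ℝ ((σ + σ') x) (e k x) : ℝ) = _ := congrFun h x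
        simp only [FunLike.coe_add, Pi.add_apply, ContinuousLinearMap.smulRight_apply,
          FunLike.coe_smul, Pi.smul_apply] at h h' this ⊢
        rw [h, h', this]
        module
      leibniz {σ g x} hσ hg _ := by
        refine ContinuousLinearMap.ext fun v ↦ ?_
        have h (k : Fin 3) : (fun y ↦ (inner ℝ ((g • σ) y) (e k y) : ℝ)) =
            fun y ↦ g y * inner ℝ (σ y) (e k y) := by
          funext y; exact real_inner_smul_left _ _ _
        have h' (k : Fin 3) : (inner ℝ ((g • σ) x) (e k x) : ℝ) = _ := congrFun (h k) x
        have d (k : Fin 3) := mvfderiv_mul_apply hg (mdiffAt_inner hσ (he k x).mdiffAt) v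
        have hs : σ x = ∑ k, (inner ℝ (σ x) (e k x) : ℝ) • e k x := (ho x).eq_sum' _
        simp only [FunLike.coe_add, Pi.add_apply, ContinuousLinearMap.smulRight_apply,
          FunLike.coe_smul, Pi.smul_apply, FunLike.coe_sum, Finset.sum_apply, h, h', d] at hs ⊢
        have hs' : mvfderiv (𝓡 3) g x v • σ x =
            ∑ k, mvfderiv (𝓡 3) g x v • (inner ℝ (σ x) (e k x) : ℝ) • e k x := by
          conv_lhs => rw [hs, Finset.smul_sum]
        rw [hs', Finset.smul_sum, ← Finset.sum_add_distrib]
        refine Finset.sum_congr rfl fun k _ ↦ ?_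
        module }

variable {e : Fin 3 → VField M} {he : ∀ i x, SmoothNear (e i) x}
    {Γ : Fin 3 → Π x : M, TangentSpace (𝓡 3) x →L[ℝ] TangentSpace (𝓡 3) x}
  {ho : ∀ x, Orthonormal ℝ (fun i ↦ e i x)}
lemma frameConnection_apply (σ : VField M) (x : M) (v : TangentSpace (𝓡 3) x) :
    frameConnection e he Γ ho σ x v =
      ∑ k, (mvfderiv (𝓡 3) (fun y ↦ inner ℝ (σ y) (e k y)) x v • e k x +
        (inner ℝ (σ x) (e k x) : ℝ) • Γ k x v) := by
  simp only [frameConnection, FunLike.coe_sum, Finset.sum_apply, FunLike.coe_add, Pi.add_apply,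
    ContinuousLinearMap.smulRight_apply, FunLike.coe_smul, Pi.smul_apply]

lemma frameConnection_frame (i : Fin 3) (x : M) (v : TangentSpace (𝓡 3) x) :
    frameConnection e he Γ ho (e i) x v = Γ i x v := by
  have h (k : Fin 3) : (fun y ↦ (inner ℝ (e i y) (e k y) : ℝ)) = fun _ ↦ if i = k then 1 else 0 := by
    funext y
    exact orthonormal_iff_ite.1 (ho y) i k
  have h' (k : Fin 3) : (inner ℝ (e i x) (e k x) : ℝ) = if i = k then 1 else 0 := congrFun (h k) x
  rw [frameConnection_apply]
  simp only [h, h', mvfderiv_const_apply]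
  simp

/-- Both conditions are tensorial and need only be tested on the frame: there `hm` says that the
products `⟪e k, e l⟫` have zero derivative, and `ht` that the torsion vanishes. -/
lemma isLeviCivita_frameConnection
    (hm : ∀ k l x v, inner ℝ (Γ k x v) (e l x) + inner ℝ (e k x) (Γ l x v) = (0 : ℝ))
    (ht : ∀ i j x, VectorField.mlieBracket (𝓡 3) (e i) (e j) x = Γ j x (e i x) - Γ i x (e j x)) :
    IsLeviCivita (frameConnection e he Γ ho) := by
  have : IsContMDiffRiemannianBundle (𝓡 3) 1 E3 (fun x : M ↦ TangentSpace (𝓡 3) x) :=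
    IsContMDiffRiemannianBundle.of_le (n := ∞) (by simp)
  refine ⟨(frameConnection e he Γ ho).isMetricCompatible_iff.2 fun {x X σ τ} hX hσ hτ ↦ ?_, ?_⟩
  · have h (y : M) : inner ℝ (σ y) (τ y) =
        ∑ k, (inner ℝ (σ y) (e k y) : ℝ) * (inner ℝ (τ y) (e k y) : ℝ) := by
      conv_lhs => rw [(ho y).eq_sum' (τ y)]
      rw [inner_sum]
      refine Finset.sum_congr rfl fun k _ ↦ ?_
      rw [real_inner_smul_right, mul_comm]
    have dm (k : Fin 3) := (mdiffAt_inner hσ (he k x).mdiffAt)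
    have dm' (k : Fin 3) := (mdiffAt_inner hτ (he k x).mdiffAt)
    have hd : mvfderiv (𝓡 3) (fun y ↦ (inner ℝ (σ y) (τ y) : ℝ)) x (X x) =
      ∑ k, ((inner ℝ (σ x) (e k x) : ℝ) * mvfderiv (𝓡 3) (fun y ↦ inner ℝ (τ y) (e k y)) x (X x) +
        (inner ℝ (τ x) (e k x) : ℝ) * mvfderiv (𝓡 3) (fun y ↦ inner ℝ (σ y) (e k y)) x (X x)) := by
      have d (k : Fin 3) : MDifferentiableAt (𝓡 3) 𝓘(ℝ)
        (fun y ↦ (inner ℝ (σ y) (e k y) : ℝ) * (inner ℝ (τ y) (e k y) : ℝ)) x := (dm k).mul (dm' k)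
      have d' : MDifferentiableAt (𝓡 3) 𝓘(ℝ)
        (fun y ↦ (inner ℝ (σ y) (e 0 y) : ℝ) * (inner ℝ (τ y) (e 0 y) : ℝ) +
          (inner ℝ (σ y) (e 1 y) : ℝ) * (inner ℝ (τ y) (e 1 y) : ℝ)) x := (d 0).add (d 1)
      simp only [h, Fin.sum_univ_three]
      rw [mvfderiv_add_apply d' (d 2), mvfderiv_add_apply (d 0) (d 1),
        mvfderiv_mul_apply (dm 0) (dm' 0), mvfderiv_mul_apply (dm 1) (dm' 1),
        mvfderiv_mul_apply (dm 2) (dm' 2)]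
    change mvfderiv (𝓡 3) (fun y ↦ (inner ℝ (σ y) (τ y) : ℝ)) x (X x) =
      inner ℝ (frameConnection e he Γ ho σ x (X x)) (τ x) +
        inner ℝ (σ x) (frameConnection e he Γ ho τ x (X x))
    rw [hd, frameConnection_apply, frameConnection_apply]
    have e1 : ∑ k, ∑ l, (inner ℝ (σ x) (e k x) : ℝ) * (inner ℝ (τ x) (e l x) : ℝ) *
        (inner ℝ (Γ k x (X x)) (e l x) + inner ℝ (e k x) (Γ l x (X x))) = 0 :=
      Finset.sum_eq_zero fun k _ ↦ Finset.sum_eq_zero fun l _ ↦ by rw [hm, mul_zero]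
    have e2 (w : TangentSpace (𝓡 3) x) : (inner ℝ w (τ x) : ℝ) =
        ∑ l, (inner ℝ (τ x) (e l x) : ℝ) * inner ℝ w (e l x) := by
      conv_lhs => rw [(ho x).eq_sum' (τ x), inner_sum]
      simp only [real_inner_smul_right]
    have e3 (w : TangentSpace (𝓡 3) x) : (inner ℝ (σ x) w : ℝ) =
        ∑ l, (inner ℝ (σ x) (e l x) : ℝ) * inner ℝ (e l x) w := by
      conv_lhs => rw [(ho x).eq_sum' (σ x), sum_inner]
      simp only [real_inner_smul_left]
    have e4 (k : Fin 3) : (inner ℝ (e k x) (τ x) : ℝ) = inner ℝ (τ x) (e k x) :=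
      real_inner_comm _ _
    simp only [sum_inner, inner_sum, inner_add_left, inner_add_right, real_inner_smul_left,
      real_inner_smul_right, e2 (Γ _ _ _), e3 (Γ _ _ _), e4]
    simp only [Fin.sum_univ_three] at e1 ⊢
    linear_combination -e1
  · funext x
    refine ContinuousLinearMap.ext fun u ↦ ContinuousLinearMap.ext fun v ↦ ?_
    have h (i j : Fin 3) : (frameConnection e he Γ ho).torsion x (e i x) (e j x) = 0 := by
      rw [(frameConnection e he Γ ho).torsion_apply (he i x).mdiffAt (he j x).mdiffAt,
        frameConnection_frame, frameConnection_frame, ht, sub_self]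
    change _ = (0 : TangentSpace (𝓡 3) x)
    rw [(ho x).eq_sum u, (ho x).eq_sum v]
    simp only [map_sum, map_smul, FunLike.coe_sum, Finset.sum_apply, FunLike.coe_smul,
      Pi.smul_apply, h, smul_zero, Finset.sum_const_zero]

end FrameConnection

end

noncomputable section

/-! ### Combinations of a frame with constant coefficients. -/

section FrameComb

variable {M : Type*} [TopologicalSpace M] [ChartedSpace E3 M] {f : ℝ} {e : Fin 3 → VField M}

/-- The combination of the members of a frame with constant coefficients `s`. -/
def frameComb (e : Fin 3 → VField M) (s : Fin 3 → ℝ) : VField M :=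
  s 0 • e 0 + s 1 • e 1 + s 2 • e 2

/-- The covariant derivative in terms of constant coefficients. -/
def gammaProd (f : ℝ) (s t : Fin 3 → ℝ) : Fin 3 → ℝ :=
  (f / 2) • ![s 1 * t 2 - s 2 * t 1, s 2 * t 0 + s 0 * t 2, -(s 1 * t 0 + s 0 * t 1)]

lemma frameComb_apply (s : Fin 3 → ℝ) (x : M) :
    frameComb e s x = s 0 • e 0 x + s 1 • e 1 x + s 2 • e 2 x := rfl

lemma frameComb_sub (s t : Fin 3 → ℝ) (x : M) :
    frameComb e (s - t) x = frameComb e s x - frameComb e t x := by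
  simp only [frameComb_apply, Pi.sub_apply]
  module

variable [IsManifold (𝓡 3) ∞ M]

lemma smoothNear_frameComb (he : ∀ i x, SmoothNear (e i) x) (s : Fin 3 → ℝ) (x : M) :
    SmoothNear (frameComb e s) x :=
  (((he 0 x).const_smul _).add ((he 1 x).const_smul _)).add ((he 2 x).const_smul _)

end FrameComb

/-! ### Connection and Ricci tensor of a Heisenberg frame. -/

section HeisenbergFrame

variable {M : Type*} [TopologicalSpace M] [ChartedSpace E3 M]
  [RiemannianBundle (fun x : M ↦ TangentSpace (𝓡 3) x)]

/-- The covariant derivatives of the members of an orthonormal frame `e` with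
`[e 1, e 2] = f • e 0` whose other brackets vanish. -/
def heisenbergGamma (f : ℝ) (e : Fin 3 → VField M) (k : Fin 3) (x : M) :
    TangentSpace (𝓡 3) x →L[ℝ] TangentSpace (𝓡 3) x :=
  (f / 2) • ![(innerSL ℝ (e 2 x)).smulRight (e 1 x) - (innerSL ℝ (e 1 x)).smulRight (e 2 x),
    -((innerSL ℝ (e 0 x)).smulRight (e 2 x) + (innerSL ℝ (e 2 x)).smulRight (e 0 x)),
    (innerSL ℝ (e 0 x)).smulRight (e 1 x) + (innerSL ℝ (e 1 x)).smulRight (e 0 x)] k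

variable {f : ℝ} {e : Fin 3 → VField M} {x : M}

lemma heisenbergGamma_zero (v : TangentSpace (𝓡 3) x) : heisenbergGamma f e 0 x v =
    (f / 2) • ((inner ℝ (e 2 x) v : ℝ) • e 1 x - (inner ℝ (e 1 x) v : ℝ) • e 2 x) := rfl

lemma heisenbergGamma_one (v : TangentSpace (𝓡 3) x) : heisenbergGamma f e 1 x v =
    (f / 2) • -((inner ℝ (e 0 x) v : ℝ) • e 2 x + (inner ℝ (e 2 x) v : ℝ) • e 0 x) := rfl

lemma heisenbergGamma_two (v : TangentSpace (𝓡 3) x) : heisenbergGamma f e 2 x v =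
    (f / 2) • ((inner ℝ (e 0 x) v : ℝ) • e 1 x + (inner ℝ (e 1 x) v : ℝ) • e 0 x) := rfl

variable [IsManifold (𝓡 3) ∞ M]

/-- An orthonormal frame with `[e 1, e 2] = f • e 0` whose other brackets vanish. -/
structure IsHeisenbergFrame (f : ℝ) (e : Fin 3 → VField M) : Prop where
  smooth : ∀ i x, SmoothNear (e i) x
  orthonormal : ∀ x, Orthonormal ℝ (fun i ↦ e i x)
  bracket : ∀ x, VectorField.mlieBracket (𝓡 3) (e 1) (e 2) x = f • e 0 x
  bracket_one : ∀ x, VectorField.mlieBracket (𝓡 3) (e 1) (e 0) x = 0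
  bracket_two : ∀ x, VectorField.mlieBracket (𝓡 3) (e 2) (e 0) x = 0

lemma IsHeisenbergFrame.inner_eq (h : IsHeisenbergFrame f e) (i j : Fin 3) :
    (inner ℝ (e i x) (e j x) : ℝ) = if i = j then 1 else 0 :=
  orthonormal_iff_ite.1 (h.orthonormal x) i j

lemma IsHeisenbergFrame.norm_eq (h : IsHeisenbergFrame f e) (i : Fin 3) : ‖e i x‖ = 1 :=
  (h.orthonormal x).1 i

variable {cov : Connection M}

lemma IsHeisenbergFrame.cov_frameComb (h : IsHeisenbergFrame f e)
    (hc : ∀ k x v, cov (e k) x v = heisenbergGamma f e k x v) (s t : Fin 3 → ℝ) (x : M) :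
    cov (frameComb e t) x (frameComb e s x) = frameComb e (gammaProd f s t) x := by
  have i (k : Fin 3) : (inner ℝ (e k x) (frameComb e s x) : ℝ) = s k := by
    simp only [frameComb_apply, inner_add_right, real_inner_smul_right, h.inner_eq]
    fin_cases k <;> simp
  have s0 (k : Fin 3) : SmoothNear (t k • e k) x := (h.smooth k x).const_smul _
  conv_lhs => rw [frameComb]
  rw [cov_add ((s0 0).add (s0 1)) (s0 2), cov_add (s0 0) (s0 1), cov_const_smul (h.smooth 0 x),
    cov_const_smul (h.smooth 1 x), cov_const_smul (h.smooth 2 x), hc, hc, hc,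
    heisenbergGamma_zero, heisenbergGamma_one, heisenbergGamma_two, i, i, i]
  rw [frameComb_apply]
  simp [gammaProd]
  module

variable [IsContMDiffRiemannianBundle (𝓡 3) ∞ E3 (fun x : M ↦ TangentSpace (𝓡 3) x)]

lemma IsHeisenbergFrame.exists_leviCivita (h : IsHeisenbergFrame f e) :
    ∃ cov : Connection M, IsLeviCivita cov ∧ ∀ k x v, cov (e k) x v = heisenbergGamma f e k x v := by
  refine ⟨frameConnection e h.smooth (heisenbergGamma f e) h.orthonormal,
    isLeviCivita_frameConnection (fun k l x v ↦ ?_) (fun i j x ↦ ?_), frameConnection_frame⟩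
  · fin_cases k <;> fin_cases l <;>
      simp [heisenbergGamma_zero, heisenbergGamma_one, heisenbergGamma_two, inner_add_left,
        inner_sub_left, inner_add_right, inner_sub_right, real_inner_smul_left,
        real_inner_smul_right, h.inner_eq, h.norm_eq]
  · have self (V : VField M) : VectorField.mlieBracket (𝓡 3) V V x = 0 := by simp
    have swap (V W : VField M) : VectorField.mlieBracket (𝓡 3) V W x =
        -VectorField.mlieBracket (𝓡 3) W V x := by rw [VectorField.mlieBracket_swap]; rfl
    fin_cases i <;> fin_cases j <;>
      simp [heisenbergGamma_zero, heisenbergGamma_one, heisenbergGamma_two, h.inner_eq, h.norm_eq,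
        self, h.bracket, h.bracket_one, h.bracket_two, swap (e 0), swap (e 2) (e 1)] <;>
      module

/-- Constant combinations of the frame are stable under covariant derivation, so curvature is
computed by the bilinear product `gammaProd` alone. -/
lemma IsHeisenbergFrame.curvatureAt_frameComb (h : IsHeisenbergFrame f e) (hcov : IsLeviCivita cov)
    (hc : ∀ k x v, cov (e k) x v = heisenbergGamma f e k x v) (r s t : Fin 3 → ℝ) (x : M) :
    curvatureAt cov x (frameComb e r x) (frameComb e s x) (frameComb e t x) =
      frameComb e (gammaProd f r (gammaProd f s t) - gammaProd f s (gammaProd f r t) -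
        gammaProd f (gammaProd f r s - gammaProd f s r) t) x := by
  have hs (s) := smoothNear_frameComb h.smooth s x
  have e1 (s) : (fun y ↦ cov (frameComb e t) y (frameComb e s y)) = frameComb e (gammaProd f s t) :=
    funext fun y ↦ h.cov_frameComb hc s t y
  rw [hcov.curvatureAt_eq (hs r) (hs s) (hs t), curvatureField, e1, e1,
    hcov.mlieBracket (hs r) (hs s), h.cov_frameComb hc, h.cov_frameComb hc, h.cov_frameComb hc,
    h.cov_frameComb hc, ← frameComb_sub, ← frameComb_sub, h.cov_frameComb hc, ← frameComb_sub]

lemma IsHeisenbergFrame.ricciAt_eq (h : IsHeisenbergFrame f e) (hcov : IsLeviCivita cov)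
    (hc : ∀ k x v, cov (e k) x v = heisenbergGamma f e k x v) (v w : TangentSpace (𝓡 3) x) :
    ricciAt cov x v w =
      f ^ 2 / 2 * (-inner ℝ v w + 2 * (inner ℝ (e 0 x) v * inner ℝ (e 0 x) w)) := by
  have i (k : Fin 3) (s : Fin 3 → ℝ) : (inner ℝ (frameComb e s x) (e k x) : ℝ) = s k := by
    simp only [frameComb_apply, inner_add_left, real_inner_smul_left, h.inner_eq]
    fin_cases k <;> simp
  have hv (v : TangentSpace (𝓡 3) x) : v = frameComb e (fun k ↦ inner ℝ v (e k x)) x := by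
    rw [frameComb_apply]
    refine ((h.orthonormal x).eq_sum' v).trans ?_
    rw [Fin.sum_univ_three]
  have hk (k : Fin 3) : e k x = frameComb e (Pi.single k 1) x := by
    rw [frameComb_apply]
    fin_cases k <;> simp
  obtain ⟨s, rfl⟩ : ∃ s, v = frameComb e s x := ⟨_, hv v⟩
  obtain ⟨t, rfl⟩ : ∃ s, w = frameComb e s x := ⟨_, hv w⟩
  have hr (k : Fin 3) : inner ℝ (curvatureAt cov x (e k x) (frameComb e s x) (frameComb e t x)) (e k x) =
    (gammaProd f (Pi.single k 1) (gammaProd f s t) - gammaProd f s (gammaProd f (Pi.single k 1) t) -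
        gammaProd f (gammaProd f (Pi.single k 1) s - gammaProd f s (Pi.single k 1)) t) k := by
    conv_lhs => rw [hk k, h.curvatureAt_frameComb hcov hc, ← hk k, i]
  have hst : inner ℝ (frameComb e s x) (frameComb e t x) = s 0 * t 0 + s 1 * t 1 + s 2 * t 2 := by
    conv_lhs => rw [frameComb_apply t]
    simp only [inner_add_right, real_inner_smul_right, i]
    ring
  have i' (k : Fin 3) (s : Fin 3 → ℝ) : (inner ℝ (e k x) (frameComb e s x) : ℝ) = s k :=
    (real_inner_comm _ _).trans (i k s)
  rw [hcov.ricciAt_eq (h.orthonormal x), Fin.sum_univ_three, hr, hr, hr, hst, i', i']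
  simp [gammaProd]
  ring

end HeisenbergFrame

end

noncomputable section

/-! ### Orientations and the Hodge dual. -/

section PositiveTriple

variable {M : Type*} [TopologicalSpace M] [ChartedSpace E3 M] [IsManifold (𝓡 3) ∞ M]
  [RiemannianBundle (fun x : M ↦ TangentSpace (𝓡 3) x)]

/-- The Hodge dual of the first member of a positive orthonormal triple. -/
lemma hodgeStarAt_eq (o : ManifoldOrientation M) {x : M} {b : Fin 3 → TangentSpace (𝓡 3) x}
    (hb : Orthonormal ℝ b) (hp : IsPositiveTriple (o.orient x) b) (v w : TangentSpace (𝓡 3) x) :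
    hodgeStarAt o x (b 0) v w =
      inner ℝ (b 1) v * inner ℝ (b 2) w - inner ℝ (b 2) v * inner ℝ (b 1) w := by
  obtain ⟨B, rfl⟩ := hb.exists_orthonormalBasis_coe
  obtain ⟨B', hB, ho⟩ := hp
  have h : B'= B.toBasis := Basis.eq_of_apply_eq fun i ↦ by rw [hB, B.coe_toBasis]
  rw [hodgeStarAt, (o.orient x).volumeForm_robust B (h ▸ ho), Basis.det_apply, Matrix.det_fin_three]
  simp [Basis.toMatrix_apply, B.repr_apply_apply]
  ring

end PositiveTriple

section StandardOrientation

/-- A triple of vectors in `ℝ³` is positive for the standard orientation when its determinant is. -/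
lemma isPositive_iff (v : Fin 3 → E3) :
    (∃ b : Basis (Fin 3) ℝ E3, ⇑b = v ∧
      b.orientation = (EuclideanSpace.basisFun (Fin 3) ℝ).toBasis.orientation) ↔
    0 < (Matrix.of fun i j ↦ v j i).det := by
  have h : (EuclideanSpace.basisFun (Fin 3) ℝ).toBasis.det v = (Matrix.of fun i j ↦ v j i).det := by
    rw [Basis.det_apply]
    congr 1
  rw [← h]
  constructor
  · rintro ⟨b, rfl, hb⟩
    rwa [eq_comm, Basis.orientation_eq_iff_det_pos] at hb
  · intro hv
    have := (Module.Basis.is_basis_iff_det (EuclideanSpace.basisFun (Fin 3) ℝ).toBasis (v := v)).2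
      (isUnit_iff_ne_zero.2 hv.ne')
    refine ⟨Basis.mk this.1 this.2.ge, Basis.coe_mk _ _, ?_⟩
    rwa [eq_comm, Basis.orientation_eq_iff_det_pos, Basis.coe_mk]

lemma continuousAt_of_contMDiffAt_section {V : E3 → E3} {x : E3}
    (h : ContMDiffAt 𝓘(ℝ, E3) 𝓘(ℝ, E3).tangent ∞
      (fun y ↦ (⟨y, V y⟩ : TangentBundle 𝓘(ℝ, E3) E3)) x) : ContinuousAt V x :=
  (contMDiffAt_vectorSpace_iff_contDiffAt.1 h).continuousAt

/-- The standard orientation of the Heisenberg group. -/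
def heisenbergOrientation : ManifoldOrientation Heisenberg where
  orient _ := (EuclideanSpace.basisFun (Fin 3) ℝ).toBasis.orientation
  eventually_positive x X hX hp := by
    let Y (i : Fin 3) (y : E3) : E3 := X i y
    have hc (i : Fin 3) : ContinuousAt (Y i) x :=
      continuousAt_of_contMDiffAt_section (hX i)
    have hd : ContinuousAt (fun y : E3 ↦ (Matrix.of fun i j ↦ Y j y i).det) x := by
      have : ContinuousAt (fun y : E3 ↦ (Matrix.of fun i j ↦ Y j y i)) x :=
        continuousAt_pi.2 fun i ↦ continuousAt_pi.2 fun j ↦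
          (EuclideanSpace.proj i : E3 →L[ℝ] ℝ).continuous.continuousAt.comp (hc j)
      exact (continuous_id.matrix_det).continuousAt.comp this
    filter_upwards [hd.eventually (lt_mem_nhds ((isPositive_iff (fun i ↦ Y i x)).1 hp))] with y hy
    exact (isPositive_iff (fun i ↦ Y i y)).2 hy

end StandardOrientation

/-! ### Left-invariant fields and their brackets. -/

section LeftInvariantFields

/-- The left translate to `p` of the tangent vector `v` at the identity. -/
def leftVec (v p : E3) : E3 := !₂[v 0, v 1, v 2 + p 0 * v 1]

/-- The left-invariant field with value `v` at the identity. -/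
def leftField (v : E3) : VField Heisenberg := fun p ↦ leftVec v p

lemma leftField_eq_mfderiv (v : E3) (p : Heisenberg) :
    mfderiv (𝓡 3) (𝓡 3) (fun q : Heisenberg ↦ p * q) 1 v = leftField v p :=
  mfderiv_mul_left p 1 v

/-- This turns a basis orthonormal at the identity into a global orthonormal frame. -/
lemma inner_leftField {g : ContMDiffRiemannianMetric (𝓡 3) ∞ E3
    (fun p : Heisenberg ↦ TangentSpace (𝓡 3) p)} (hg : IsLeftInvariant g) (v w : E3)
    (p : Heisenberg) : g.inner p (leftField v p) (leftField w p) = g.inner 1 v w := by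
  rw [← hg p 1 v w]
  refine Eq.trans ?_ (congrArg₂ (fun v w : E3 ↦ g.inner (p * 1) v w)
    (leftField_eq_mfderiv v p) (leftField_eq_mfderiv w p)).symm
  exact (congrArg (fun q : Heisenberg ↦ g.inner q (leftField v p : E3) (leftField w p : E3))
    (mul_one p)).symm

/-- A left-invariant field, as an affine map. -/
lemma hasFDerivAt_leftVec (v : E3) (p : E3) : HasFDerivAt (leftVec v)
    ((v 1 • (EuclideanSpace.proj 0 : E3 →L[ℝ] ℝ)).smulRight (EuclideanSpace.single 2 1 : E3)) p := by
  have h : (leftVec v) = fun q ↦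
    ((v 1 • (EuclideanSpace.proj 0 : E3 →L[ℝ] ℝ)).smulRight (EuclideanSpace.single 2 1 : E3)) q + v := by
    funext q
    refine PiLp.ext fun i ↦ ?_
    have h3 (i : Fin 3) : ((v 1 • (EuclideanSpace.proj 0 : E3 →L[ℝ] ℝ)).smulRight
      (EuclideanSpace.single 2 1 : E3) q + v) i = v 1 * q 0 * (EuclideanSpace.single 2 (1 : ℝ) : E3) i + v i := by
      simp
    refine Eq.trans ?_ (h3 i).symm
    have h0 : leftVec v q 0 = v 0 := rfl
    have h1 : leftVec v q 1 = v 1 := rfl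
    have h2 : leftVec v q 2 = v 2 + q 0 * v 1 := rfl
    fin_cases i
    · exact h0.trans (by simp)
    · exact h1.trans (by simp)
    · exact h2.trans (by simp; ring)
  rw [h]
  exact (ContinuousLinearMap.hasFDerivAt _).add_const _

lemma contDiff_leftVec (v : E3) : ContDiff ℝ ∞ (leftVec v) :=
  Heisenberg.contDiff_mk contDiff_const contDiff_const
    (contDiff_const.add ((Heisenberg.contDiff_apply 0).mul contDiff_const))

lemma contMDiff_leftField (v : E3) : ContMDiff (𝓡 3) (𝓡 3).tangent ∞
    (fun p ↦ (⟨p, leftField v p⟩ : TangentBundle (𝓡 3) Heisenberg)) :=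
  fun _ ↦ contMDiffAt_vectorSpace_iff_contDiffAt.2 (contDiff_leftVec v).contDiffAt

lemma smoothNear_leftField (v : E3) (p : Heisenberg) : SmoothNear (leftField v) p :=
  Filter.Eventually.of_forall (contMDiff_leftField v)

lemma lieBracket_leftVec (v w p : E3) : VectorField.lieBracket ℝ (leftVec v) (leftVec w) p =
    EuclideanSpace.single 2 (v 0 * w 1 - v 1 * w 0) := by
  rw [VectorField.lieBracket, (hasFDerivAt_leftVec v p).fderiv, (hasFDerivAt_leftVec w p).fderiv]
  have h0 (v : E3) : leftVec v p 0 = v 0 := rfl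
  refine PiLp.ext fun i ↦ ?_
  simp [h0]
  fin_cases i <;> simp
  ring

lemma mlieBracket_eq_lieBracket (V W : E3 → E3) (p : E3) :
    VectorField.mlieBracket 𝓘(ℝ, E3) V W p = VectorField.lieBracket ℝ V W p :=
  congrFun ((VectorField.mlieBracketWithin_univ.symm.trans
    VectorField.mlieBracketWithin_eq_lieBracketWithin).trans VectorField.lieBracketWithin_univ) p

lemma mlieBracket_leftField (v w : E3) (p : Heisenberg) :
    VectorField.mlieBracket (𝓡 3) (leftField v) (leftField w) p =
      (EuclideanSpace.single 2 (v 0 * w 1 - v 1 * w 0) : E3) :=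
  (mlieBracket_eq_lieBracket (leftVec v) (leftVec w) p).trans (lieBracket_leftVec v w p)

end LeftInvariantFields

/-! ### An adapted frame for an arbitrary left-invariant metric. -/

section OrthonormalFrame

/-- A basis of `ℝ³` orthonormal for a given inner product and triangular in the basis
`Z`, `X`, `Y`. -/
lemma exists_orthonormal_triangular (B : E3 →L[ℝ] E3 →L[ℝ] ℝ) (hs : ∀ v w, B v w = B w v)
    (hp : ∀ v, v ≠ 0 → 0 < B v v) :
    ∃ t : Fin 3 → E3, (∀ i j, B (t i) (t j) = if i = j then 1 else 0) ∧ t 0 0 = 0 ∧ t 0 1 = 0 ∧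
      0 < t 0 2 ∧ 0 < t 1 0 ∧ t 1 1 = 0 ∧ 0 < t 2 1 := by
  have normalize (v : E3) (hv : v ≠ 0) : ∃ r : ℝ, 0 < r ∧ B (r • v) (r • v) = 1 := by
    refine ⟨(√(B v v))⁻¹, inv_pos.2 (Real.sqrt_pos.2 (hp v hv)), ?_⟩
    simp only [map_smul, FunLike.coe_smul, Pi.smul_apply, smul_eq_mul]
    rw [← mul_assoc, ← mul_inv, Real.mul_self_sqrt (hp v hv).le, inv_mul_cancel₀ (hp v hv).ne']
  have ne {v : E3} (i : Fin 3) (h : v i = 1) : v ≠ 0 := by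
    rintro rfl
    exact zero_ne_one h
  -- Gram–Schmidt starting with the central direction, so that `t 0` stays central; each normalizing
  -- factor is positive, hence the signs of the diagonal coefficients.
  obtain ⟨r, hr, hr1⟩ := normalize (EuclideanSpace.single 2 1) (ne 2 (by simp))
  set z : E3 := r • EuclideanSpace.single 2 1 with hz
  let x' : E3 := EuclideanSpace.single 0 1 - B (EuclideanSpace.single 0 1) z • z
  obtain ⟨p, hpp, hp1⟩ := normalize x' (ne 0 (by simp [x', hz]))
  have hxz : B (p • x') z = 0 := by
    simp [x', hr1]
  set x := p • x' with hx
  let y' : E3 := EuclideanSpace.single 1 1 - B (EuclideanSpace.single 1 1) z • z -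
    B (EuclideanSpace.single 1 1) x • x
  obtain ⟨q, hq, hq1⟩ := normalize y' (ne 1 (by simp [x', y', hz, hx]))
  have hyz : B (q • y') z = 0 := by
    simp [y', hr1, hxz]
  have hyx : B (q • y') x = 0 := by
    simp [y', hp1, hs z x, hxz]
  refine ⟨![z, x, q • y'], fun i j ↦ ?_, ?_⟩
  · fin_cases i <;> fin_cases j
    exacts [hr1, (hs _ _).trans hxz, (hs _ _).trans hyz, hxz, hp1, (hs _ _).trans hyx, hyz, hyx, hq1]
  · simp [hz, hx, x', y', hr, hpp, hq]

theorem exists_isHeisenbergField (g : ContMDiffRiemannianMetric (𝓡 3) ∞ E3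
      (fun p : Heisenberg ↦ TangentSpace (𝓡 3) p)) (hg : IsLeftInvariant g) :
    letI : RiemannianBundle (fun p : Heisenberg ↦ TangentSpace (𝓡 3) p) := ⟨g.toRiemannianMetric⟩
    ∃ (f : ℝ) (ξ : Π p : Heisenberg, TangentSpace (𝓡 3) p),
      0 < f ∧ IsHeisenbergField heisenbergOrientation f ξ := by
  let : RiemannianBundle (fun p : Heisenberg ↦ TangentSpace (𝓡 3) p) := ⟨g.toRiemannianMetric⟩
  obtain ⟨t, ht, h00, h01, h02, h10, h11, h21⟩ :=
    exists_orthonormal_triangular (g.inner 1) (g.symm 1) (g.pos 1)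
  have ho (p : Heisenberg) : Orthonormal ℝ (fun i ↦ leftField (t i) p) :=
    orthonormal_iff_ite.2 fun i j ↦ (inner_leftField hg (t i) (t j) p).trans (ht i j)
  -- As `t 1 1 = 0`, the bracket of the fields of `t 1` and `t 2` is `t 1 0 * t 2 1` times the
  -- central direction, that is, this quotient times `t 0`.
  have hf : 0 < t 1 0 * t 2 1 / t 0 2 := by positivity
  have hframe : IsHeisenbergFrame (t 1 0 * t 2 1 / t 0 2) (fun i ↦ leftField (t i)) := by
    refine ⟨fun i ↦ smoothNear_leftField (t i), ho, fun p ↦ ?_, fun p ↦ ?_, fun p ↦ ?_⟩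
    · refine (mlieBracket_leftField _ _ p).trans ?_
      change _ = (t 1 0 * t 2 1 / t 0 2) • leftVec (t 0) p
      refine PiLp.ext fun i ↦ ?_
      fin_cases i <;> simp [leftVec, h00, h01, h11]
      field_simp
    · refine (mlieBracket_leftField _ _ p).trans ?_
      rw [h00, h01, mul_zero, mul_zero, sub_self]
      exact (PiLp.single_eq_zero_iff 2 _).2 rfl
    · refine (mlieBracket_leftField _ _ p).trans ?_
      rw [h00, h01, mul_zero, mul_zero, sub_self]
      exact (PiLp.single_eq_zero_iff 2 _).2 rfl
  -- The determinant is `t 0 2 * t 1 0 * t 2 1` at every point; one orientation therefore serves all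
  -- metrics.
  have hpos (p : Heisenberg) : IsPositiveTriple (heisenbergOrientation.orient p)
      (fun i ↦ leftField (t i) p) := by
    refine (isPositive_iff (fun i ↦ leftVec (t i) p)).2 ?_
    rw [Matrix.det_fin_three]
    simp [leftVec, h00, h01, h11]
    positivity
  obtain ⟨cov, hcov, hc⟩ := hframe.exists_leviCivita
  refine ⟨_, leftField (t 0), hf, contMDiff_leftField _, fun p ↦ (ho p).1 0, cov, hcov,
    fun p v w ↦ ?_, fun p v w ↦ hframe.ricciAt_eq hcov hc v w⟩
  refine Eq.trans ?_ (congrArg (_ * ·) (hodgeStarAt_eq heisenbergOrientation (ho p) (hpos p) v w).symm)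
  rw [hc 0 p v, heisenbergGamma_zero, real_inner_smul_left, inner_sub_left, real_inner_smul_left,
    real_inner_smul_left]
  ring

end OrthonormalFrame

end

theorem mainTheorem7 :
    (∀ (M : Type*) [EMetricSpace M] [ChartedSpace (EuclideanSpace ℝ (Fin 3)) M] [IsManifold (𝓡 3) ∞ M]
      [RiemannianBundle (fun x : M ↦ TangentSpace (𝓡 3) x)]
      [IsContMDiffRiemannianBundle (𝓡 3) ∞ (EuclideanSpace ℝ (Fin 3))
        (fun x : M ↦ TangentSpace (𝓡 3) x)]
      [IsRiemannianManifold (𝓡 3) M] [CompleteSpace M] [SimplyConnectedSpace M]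
      (o : ManifoldOrientation M) (f : ℝ) (ξ : Π x : M, TangentSpace (𝓡 3) x),
      0 < f → IsHeisenbergField o f ξ →
      ∃ g : ContMDiffRiemannianMetric (𝓡 3) ∞ (EuclideanSpace ℝ (Fin 3))
        (fun p : Heisenberg ↦ TangentSpace (𝓡 3) p),
        IsLeftInvariant g ∧
        ∃ Φ : M ≃ₘ^∞⟮𝓡 3, 𝓡 3⟯ Heisenberg, ∀ (x : M) (v w : TangentSpace (𝓡 3) x),
          g.inner (Φ x) (mfderiv (𝓡 3) (𝓡 3) Φ x v) (mfderiv (𝓡 3) (𝓡 3) Φ x w) =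
            inner ℝ v w) ∧
    (∃ o : ManifoldOrientation Heisenberg,
      ∀ g : ContMDiffRiemannianMetric (𝓡 3) ∞ (EuclideanSpace ℝ (Fin 3))
        (fun p : Heisenberg ↦ TangentSpace (𝓡 3) p),
        IsLeftInvariant g →
        letI : RiemannianBundle (fun p : Heisenberg ↦ TangentSpace (𝓡 3) p) :=
          ⟨g.toRiemannianMetric⟩
        ∃ (f : ℝ) (ξ : Π p : Heisenberg, TangentSpace (𝓡 3) p),
          0 < f ∧ IsHeisenbergField o f ξ) := by
  refine ⟨?_, heisenbergOrientation, exists_isHeisenbergField⟩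
  intro M _ _ _ _ _ _ _ _ o f ξ hf h
  obtain ⟨cov, hcov, hξ⟩ := h.isContactField hf
  exact ⟨heisenbergMetric f hf, isLeftInvariant_heisenbergMetric f hf, hξ.exists_isometry hcov hf⟩
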